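/- Conventions. $\mathbb{R}^d$ and $\mathbb{R}^k$ carry the sup norm. A box in $\mathbb{R}^d$ is a product of $d$ intervals of positive length, each open, closed or half-open. For a box $B$ let $T_B(x)=\mathrm{vol}(B)^{-1/d}(x-\min\overline{B})$, where $\min\overline B$ is the lower left corner, and let $B^*=T_B(B)$, a box of volume one with lower left corner $0$. For a probability measure $\mu$ on $\mathbb{R}^d$ with $\mu(B)>0$ let $\mu^B=T_B\big(\mu|_B/\mu(B)\big)$. Let $\mathcal{E}$ be a family of boxes in $\mathbb{R}^d$. A partition operator $\Delta$ on $\mathcal{E}$ assigns to each $E\in\mathcal{E}$ a partition $\Delta E\subseteq\mathcal{E}$ of $E$ such that $\Delta(SE)=S(\Delta E)$ whenever $Sx=ax+b$ with $a>0$, $b\in\mathbb{R}^d$, and $E,SE\in\mathcal{E}$. Put $\Delta^0(E)=\{E\}$ and $\Delta^{n+1}(E)=\bigcup_{E'\in\Delta^nE}\Delta(E')$. For $0<\rho<1$, $\Delta$ is $\rho$-regular if for every $E\in\mathcal{E}$ there is $C>1$ such that for all $n\ge1$ every element of $\Delta^nE$ contains a ball of radius $\rho^n/C$ and is contained in a ball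 of radius $C\rho^n$. A CP-chain for a $\rho$-regular partition operator $\Delta$ on $\mathcal{E}$ is a stationary Markov process $(\mu_n,B_n)_{n\ge1}$ of pairs in which $B_n\in\mathcal{E}$, $B_n^*\in\mathcal{E}$ and $\mu_n$ is a Borel probability measure with $\mu_n(B_n^*)=1$, and whose transition law from a state $(\mu,A)$ is to move, for each $B\in\Delta(A^*)$, to $(\mu^B,B)$ with probability $\mu(B)$. It is ergodic if its law $P$ on sequences is ergodic for the shift. "For $P$-a.e. $\mu$" refers to the distribution of $\mu_1$. The lower Hausdorff dimension of a Borel measure $\nu$ is $\dim_*\nu=\inf\{\dim_H A: A\text{ Borel},\ \nu(A)>0\}$, and $g\mu$ denotes the image of $\mu$ under $g$. For a closed set $K\subseteq\mathbb{R}^d$, $C^1(K,\mathbb{R}^k)$ consists of the maps that are $C^1$ in a neighbourhood of $K$, with the $C^1$ topology given by $\|g\|_{C^1}=\sup_{x\in K}\|g(x)\|+\sup_{x\in K}\|D_xg\|$. Let $\pi$ be the orthogonal projection of $\mathbb{R}^d$ to a $k$-dimensional subspace $V$ (an element of $\Pi_{d,k}$), regarded as a map to $\mathbb{R}^k$ through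 an arbitrary fixed affine identification of $V$ with $\mathbb{R}^k$. Theorem. Let $P$ be the distribution of an ergodic CP-chain, for some $\rho$-regular partition operator with $0<\rho<1$, and fix $\pi$ as above. Then: 1. For $P$-a.e. $\mu$, the map $g\mapsto\dim_*g\mu$ on $C^1(\operatorname{supp}\mu,\mathbb{R}^k)$ is lower semicontinuous at $\pi$ in the $C^1$ topology. 2. The modulus is uniform in $\mu$: for every $\varepsilon>0$ there is $\delta>0$ such that for $P$-a.e. $\mu$, every $g\in C^1(\operatorname{supp}\mu,\mathbb{R}^k)$ with $\|g-\pi\|_{C^1}<\delta$ satisfies $\dim_*g\mu\ge\dim_*\pi\mu-\varepsilon$. -/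

import Mathlib

open MeasureTheory ProbabilityTheory Filter Set
open scoped ENNReal NNReal Topology

noncomputable section

namespace CP

/-- A `d`-dimensional box: a product of `d` intervals of positive length, each of which may be
open, closed or half-open. The Boolean vectors record which endpoints belong to the intervals. -/
structure Box (d : ℕ) where
  lower : Fin d → ℝ
  upper : Fin d → ℝ
  lowerClosed : Fin d → Bool
  upperClosed : Fin d → Bool
  lower_lt_upper : ∀ i, lower i < upper i

namespace Box

variable {d : ℕ}

/-- The box as a subset of `ℝ^d`. -/
def toSet (B : Box d) : Set (Fin d → ℝ) :=
  {x | ∀ i, (if B.lowerClosed i then B.lower i ≤ x i else B.lower i < x i) ∧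
    (if B.upperClosed i then x i ≤ B.upper i else x i < B.upper i)}

/-- The Borel structure on the space of boxes, coming from the parameters of a box. -/
instance : MeasurableSpace (Box d) :=
  MeasurableSpace.comap (fun B => (B.lower, B.upper, B.lowerClosed, B.upperClosed)) inferInstance

/-- The image of a box under the homothety `x ↦ a x + b`, with `a > 0`. -/
def homothety (B : Box d) (a : ℝ) (ha : 0 < a) (b : Fin d → ℝ) : Box d where
  lower i := a * B.lower i + b i
  upper i := a * B.upper i + b i
  lowerClosed := B.lowerClosed
  upperClosed := B.upperClosed
  lower_lt_upper i := by
    have := mul_lt_mul_of_pos_left (B.lower_lt_upper i) ha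
    linarith

/-- The volume of a box. -/
def vol (B : Box d) : ℝ := ∏ i, (B.upper i - B.lower i)

lemma vol_pos (B : Box d) : 0 < B.vol :=
  Finset.prod_pos fun i _ => sub_pos.mpr (B.lower_lt_upper i)

/-- The factor `vol(B)^(-1/d)` by which the box has to be scaled to have volume one. -/
def scaleFactor (B : Box d) : ℝ := B.vol ^ (-(d : ℝ)⁻¹)

lemma scaleFactor_pos (B : Box d) : 0 < B.scaleFactor := Real.rpow_pos_of_pos B.vol_pos _

/-- The rescaling map `T_B`: the homothety that takes the lower left corner of `B` to the origin
and takes `B` to a box of volume one. -/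
def rescale (B : Box d) (x : Fin d → ℝ) : Fin d → ℝ := B.scaleFactor • (x - B.lower)

/-- The normalized box `B^* = T_B(B)`: volume one and lower left corner at the origin. -/
def normalize (B : Box d) : Box d :=
  B.homothety B.scaleFactor B.scaleFactor_pos (-(B.scaleFactor • B.lower))

end Box

/-- `Δ` is a partition operator on the family of boxes `E`: it assigns to each box of `E` a
partition of it into boxes of `E`, in a translation and scale invariant manner. (The values of `Δ`
outside `E` are irrelevant.) -/
structure IsPartitionOperator {d : ℕ} (E : Set (Box d)) (Δ : Box d → Set (Box d)) : Prop where
  subset : ∀ A ∈ E, Δ A ⊆ E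
  disjoint : ∀ A ∈ E, (Δ A).PairwiseDisjoint Box.toSet
  cover : ∀ A ∈ E, ⋃ B ∈ Δ A, B.toSet = A.toSet
  invariant : ∀ A ∈ E, ∀ (a : ℝ) (ha : 0 < a) (b : Fin d → ℝ), A.homothety a ha b ∈ E →
    Δ (A.homothety a ha b) = (fun B : Box d => B.homothety a ha b) '' Δ A

/-- The iterates `Δ^n` of a partition operator. -/
def iterate {d : ℕ} (Δ : Box d → Set (Box d)) : ℕ → Box d → Set (Box d)
  | 0, A => {A}
  | n + 1, A => ⋃ B ∈ iterate Δ n A, Δ B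

/-- The partition operator `Δ` on `E` is `ρ`-regular: for every `A ∈ E` there is a constant `C > 1`
such that for all `n ≥ 1` each element of `Δ^n A` contains a ball of radius `ρ^n / C` and is
contained in a ball of radius `C ρ^n`. -/
def IsRegular {d : ℕ} (E : Set (Box d)) (Δ : Box d → Set (Box d)) (ρ : ℝ) : Prop :=
  ∀ A ∈ E, ∃ C : ℝ, 1 < C ∧ ∀ n : ℕ, 1 ≤ n → ∀ B ∈ iterate Δ n A,
    (∃ x, Metric.closedBall x (ρ ^ n / C) ⊆ B.toSet) ∧
    (∃ x, B.toSet ⊆ Metric.closedBall x (C * ρ ^ n))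

/-- Pairs `(μ, B)` of a probability measure on `ℝ^d` and a box. The σ-algebra on the probability
measures is generated by the evaluations `μ ↦ μ(A)`, so it is the Borel σ-algebra of the weak
topology. -/
abbrev State (d : ℕ) : Type := ProbabilityMeasure (Fin d → ℝ) × Box d

/-- `μ^B`, the conditional measure of `μ` on `B` rescaled by `T_B`. It is used only when
`μ(B) > 0`; otherwise the value is arbitrary. -/
def rescaledMeasure {d : ℕ} (μ : ProbabilityMeasure (Fin d → ℝ)) (B : Box d) :
    ProbabilityMeasure (Fin d → ℝ) :=
  if h : (μ : Measure (Fin d → ℝ)) B.toSet = 0 then μ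
  else ⟨(ProbabilityTheory.cond (μ : Measure (Fin d → ℝ)) B.toSet).map B.rescale, by
    have := cond_isProbabilityMeasure (μ := (μ : Measure (Fin d → ℝ))) h
    refine Measure.isProbabilityMeasure_map (Measurable.aemeasurable ?_)
    unfold Box.rescale
    fun_prop⟩

/-- The transition law from the state `(μ, A)`: for each `B ∈ Δ(A^*)`, move to `(μ^B, B)` with
probability `μ(B)`. -/
def transition {d : ℕ} (Δ : Box d → Set (Box d)) (s : State d) : Measure (State d) :=
  Measure.sum fun B : Δ s.2.normalize =>
    (s.1 : Measure (Fin d → ℝ)) B.1.toSet • Measure.dirac (rescaledMeasure s.1 B.1, B.1)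

/-- The shift on sequences of states. -/
def shift {d : ℕ} (ω : ℕ → State d) : ℕ → State d := fun n => ω (n + 1)

/-- `P` is the distribution of a CP-chain for the partition operator `Δ` on `E`: the law of a
stationary Markov process of pairs `(μ_n, B_n)`, where `B_n ∈ E` and `μ_n` is supported on `B_n^*`
(and `Δ(B_n^*)` makes sense, that is `B_n^* ∈ E`), with the above transition law. -/
structure IsCPChain {d : ℕ} (E : Set (Box d)) (Δ : Box d → Set (Box d))
    (P : Measure (ℕ → State d)) : Prop where
  isProbabilityMeasure : IsProbabilityMeasure P
  stationary : MeasurePreserving shift P P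
  mem_state : ∀ᵐ ω ∂P, ∀ n, (ω n).2 ∈ E ∧ (ω n).2.normalize ∈ E ∧
    ((ω n).1 : Measure (Fin d → ℝ)) (ω n).2.normalize.toSetᶜ = 0
  markov : ∀ (n : ℕ) (S : Set (State d)), MeasurableSet S →
    P[fun ω => S.indicator (fun _ => (1 : ℝ)) (ω (n + 1)) |
        Filtration.piLE (X := fun _ : ℕ => State d) n]
      =ᵐ[P] fun ω => (transition Δ (ω n)).real S

/-- The marginal distribution of `μ_1`, the measure component of the process. -/
def measureMarginal {d : ℕ} (P : Measure (ℕ → State d)) :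
    Measure (ProbabilityMeasure (Fin d → ℝ)) :=
  P.map fun ω => (ω 0).1

/-- The topological support of a probability measure. -/
def supp {d : ℕ} (μ : ProbabilityMeasure (Fin d → ℝ)) : Set (Fin d → ℝ) :=
  (μ : Measure (Fin d → ℝ)).support

/-- The lower Hausdorff dimension `inf {dim A : A Borel, ν(A) > 0}`. -/
def lowerDim {k : ℕ} (ν : Measure (Fin k → ℝ)) : ℝ≥0∞ :=
  ⨅ (A : Set (Fin k → ℝ)) (_ : MeasurableSet A) (_ : 0 < ν A), dimH A

/-- `C¹` maps from `K ⊆ ℝ^d` to `ℝ^k`: maps that are `C¹` in a neighbourhood of `K`. The values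
away from `K` play no role: the `C¹` distance below only looks at values and derivatives on `K`. -/
structure C1Map {d : ℕ} (K : Set (Fin d → ℝ)) (k : ℕ) where
  toFun : (Fin d → ℝ) → (Fin k → ℝ)
  contDiff : ∃ U, IsOpen U ∧ K ⊆ U ∧ ContDiffOn ℝ 1 toFun U

/-- The `C¹` (pseudo-)distance `sup_K ‖g - h‖ + sup_K ‖Dg - Dh‖`, and the topology it defines. -/
instance {d k : ℕ} (K : Set (Fin d → ℝ)) : PseudoEMetricSpace (C1Map K k) where
  edist g h := (⨆ x ∈ K, edist (g.toFun x) (h.toFun x)) +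
    ⨆ x ∈ K, edist (fderiv ℝ g.toFun x) (fderiv ℝ h.toFun x)
  edist_self g := by simp
  edist_comm g h := by simp only [edist_comm]
  edist_triangle f g h := by
    rw [add_add_add_comm]
    refine add_le_add (iSup₂_le fun x hx => ?_) (iSup₂_le fun x hx => ?_)
    · exact (edist_triangle _ (g.toFun x) _).trans (add_le_add
        (le_iSup₂ (f := fun x _ => edist (f.toFun x) (g.toFun x)) x hx)
        (le_iSup₂ (f := fun x _ => edist (g.toFun x) (h.toFun x)) x hx))
    · exact (edist_triangle _ (fderiv ℝ g.toFun x) _).trans (add_le_add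
        (le_iSup₂ (f := fun x _ => edist (fderiv ℝ f.toFun x) (fderiv ℝ g.toFun x)) x hx)
        (le_iSup₂ (f := fun x _ => edist (fderiv ℝ g.toFun x) (fderiv ℝ h.toFun x)) x hx))

/-- The orthogonal (for the Euclidean inner product) projection of `ℝ^d` to the subspace `V`,
followed by an affine identification `φ` of `V` with `ℝ^k`. -/
def projection {d k : ℕ} (V : Submodule ℝ (EuclideanSpace ℝ (Fin d)))
    (φ : V ≃ᵃ[ℝ] (Fin k → ℝ)) (x : Fin d → ℝ) : Fin k → ℝ :=
  φ (V.orthogonalProjectionOnto (WithLp.toLp 2 x))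

lemma contDiff_projection {d k : ℕ} (V : Submodule ℝ (EuclideanSpace ℝ (Fin d)))
    (φ : V ≃ᵃ[ℝ] (Fin k → ℝ)) : ContDiff ℝ 1 (projection V φ) := by
  have h : ContDiff ℝ 1 (fun v : V => φ v) := by
    have h2 : (fun v : V => φ v) = fun v => φ.linear v + φ 0 := by
      funext v
      have := φ.map_vadd 0 v
      simpa using this
    rw [h2]
    exact (LinearMap.toContinuousLinearMap (φ.linear : V →ₗ[ℝ] (Fin k → ℝ))).contDiff.add
      contDiff_const
  exact h.comp (V.orthogonalProjectionOnto.contDiff.comp (PiLp.contDiff_toLp))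

/-- The projection, as a point of the space of `C¹` maps on `K`. -/
def projectionC1 {d k : ℕ} (V : Submodule ℝ (EuclideanSpace ℝ (Fin d)))
    (φ : V ≃ᵃ[ℝ] (Fin k → ℝ)) (K : Set (Fin d → ℝ)) : C1Map K k where
  toFun := projection V φ
  contDiff := ⟨univ, isOpen_univ, subset_univ K, (contDiff_projection V φ).contDiffOn⟩

/-- `dim_* gμ`, the lower Hausdorff dimension of the image of `μ` under `g`. -/
def lowerDimImage {d k : ℕ} (μ : ProbabilityMeasure (Fin d → ℝ)) (g : C1Map (supp μ) k) : ℝ≥0∞ :=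
  lowerDim ((μ : Measure (Fin d → ℝ)).map g.toFun)

end CP

end

/-! Let `π₀` be the linear part of the projection. For a sequence of states `ω` and a depth `q`,
`tubeExponent` is the exponent, in base `ρ`, of the mass that the initial measure gives to a tube of
width comparable to `ρ^q` through the `q`-th cell in the direction of the fibres of `π₀`. Let `I q`
be its mean under `P`. The theorem follows from two estimates that relate `I q` to the dimension of
images.

Lower bound (`IsCPChain.ae_le_lowerDimImage`): for almost every state, every `g` that is `ρ^q /
M`-close to the projection has an image of dimension at least `I q - η - C / q`, where `C` depends
neither on `q` nor on `g`. In the coordinates of a deep cell, such a `g` differs from `π₀`, up to a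
translation and the common scaling, by at most `ρ^q`, which cannot be seen within the next `q`
generations. Hence the mass of a ball of radius `ρ^(n₀ + q N)` around `g x` is bounded, up to a
factor `A^N`, by a product of tube masses along every `q`-th magnification at `x`. In integrated
form this is `IsTameState.lintegral_prefixPoints_le`, an induction that removes `q` generations at a
time by means of the covering estimate `lintegral_inv_le_coverNumber`; summing over `N` makes it
pointwise. The ergodic theorem then evaluates the product and the mass distribution principle gives
the dimension. The `q`-th power of the shift need not be ergodic, so `exists_exp_decay` picks, for
each `N`, a residue class modulo `q` on which the sum of exponents is at least average.

Upper bound (`IsCPChain.ae_lowerDim_projection_le`): almost surely the dimension of the projection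
is at most the lower limit of `I q`. Local dimensions bound it by `D`, the lower limit of the
exponents along a random orbit. The lower bound applied to the projection itself shows that `liminf
I` is at most `D`, while Fatou's lemma bounds the mean of `D` by `liminf I`. So `D` is almost surely
constant and the bound follows.

Now choose `q` with `C / q` small and `I q` close to the lower limit or above it: the admissible
distance `ρ^q / M` is the same for all measures because ergodicity makes the regularity constant `M`
uniform (`IsCPChain.exists_ae_isTame`). Semicontinuity at the projection is a consequence of the
uniform statement.

The chain is given by conditional expectations only, and neither the family of boxes nor the
partition operator is assumed measurable. `IsCPChain.lintegral_orbitLaw` identifies `P` with the law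
of the magnification of a random state at a random point, and `ae_map_of_ae_comp` transports almost
sure statements whose sets need not be measurable. -/

noncomputable section

namespace CP

/-! ### A one-sided pointwise ergodic theorem. -/

section Birkhoff
variable {α : Type*} {T : α → α} {f : α → ℝ} {M c : ℝ}

lemma birkhoffSum_nonneg (hf0 : ∀ x, 0 ≤ f x) (n : ℕ) (x : α) : 0 ≤ birkhoffSum T f n x :=
  Finset.sum_nonneg fun _ _ => hf0 _

lemma birkhoffSum_le_mul (hfM : ∀ x, f x ≤ M) (n : ℕ) (x : α) : birkhoffSum T f n x ≤ n * M := by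
  calc birkhoffSum T f n x ≤ ∑ _i ∈ Finset.range n, M := Finset.sum_le_sum fun _ _ => hfM _
    _ = n * M := by simp

variable [MeasurableSpace α] {μ : Measure α}

lemma measurable_birkhoffSum (hT : Measurable T) (hf : Measurable f) (n : ℕ) :
    Measurable (birkhoffSum T f n) :=
  Finset.measurable_fun_sum _ fun i _ => hf.comp (hT.iterate i)

/-- If almost every orbit has some Birkhoff sum of `f ≥ 0` at most `c` times its length, then the
integral of `f` is at most `c`. -/
lemma integral_le_of_exists_birkhoffSum_le [IsProbabilityMeasure μ]
    (hT : MeasurePreserving T μ μ) (hf : Measurable f) (hf0 : ∀ x, 0 ≤ f x) (hfM : ∀ x, f x ≤ M)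
    (hc : 0 ≤ c) (h : ∀ᵐ x ∂μ, ∃ N : ℕ, 1 ≤ N ∧ birkhoffSum T f N x ≤ c * N) :
    ∫ x, f x ∂μ ≤ c := by
  obtain ⟨x₀⟩ := μ.nonempty_of_neZero
  have hM : 0 ≤ M := (hf0 x₀).trans (hfM x₀)
  have hint : Integrable f μ := Integrable.of_bound hf.aestronglyMeasurable M
    (Eventually.of_forall fun x => by rw [Real.norm_of_nonneg (hf0 x)]; exact hfM x)
  let E : ℕ → Set α := fun R => {x | ∃ N ≤ R, 1 ≤ N ∧ birkhoffSum T f N x ≤ c * N}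
  have hE : ∀ R, MeasurableSet (E R) := by
    intro R
    have : E R = ⋃ N ∈ Finset.Icc 1 R, {x | birkhoffSum T f N x ≤ c * N} := by
      ext x
      simp only [E, mem_ofPred_eq, mem_iUnion, Finset.mem_Icc, exists_prop]
      exact ⟨fun ⟨N, a, b, d⟩ => ⟨N, ⟨b, a⟩, d⟩, fun ⟨N, ⟨b, a⟩, d⟩ => ⟨N, a, b, d⟩⟩
    rw [this]
    exact Finset.measurableSet_biUnion _ fun N _ =>
      measurableSet_le (measurable_birkhoffSum hT.measurable hf N) measurable_const
  have key : ∀ R, ∫ x in E R, f x ∂μ ≤ c := by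
    intro R
    set g : α → ℝ := (E R).indicator f with hg
    have hg0 : ∀ x, 0 ≤ g x := fun x => indicator_nonneg (fun x _ => hf0 x) x
    have hgf : ∀ x, g x ≤ f x := fun x => indicator_le_self' (fun x _ => hf0 x) x
    have hgm : Measurable g := hf.indicator (hE R)
    -- Greedy decomposition of the orbit: from a point of `E R` jump over a block of length at most
    -- `R` on which the average is at most `c`; from any other point move one step, where `g`
    -- vanishes. The unfinished last block costs at most `R * M`.
    have bound : ∀ L x, birkhoffSum T g L x ≤ c * L + R * M := by
      intro L
      induction L using Nat.strong_induction_on with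
      | _ L ih =>
        intro x
        rcases le_or_gt L R with hLR | hLR
        · have h1 := birkhoffSum_le_mul (T := T) (fun x => (hgf x).trans (hfM x)) L x
          have h2 : (L : ℝ) * M ≤ R * M := by gcongr
          have h3 : 0 ≤ c * L := by positivity
          linarith
        by_cases hx : x ∈ E R
        · obtain ⟨N, hNR, hN1, hN⟩ := hx
          have hsplit : L = N + (L - N) := by omega
          have h1 := ih (L - N) (by omega) (T^[N] x)
          have h2 : birkhoffSum T g N x ≤ birkhoffSum T f N x :=
            Finset.sum_le_sum fun _ _ => hgf _
          have h3 : birkhoffSum T g L x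
              = birkhoffSum T g N x + birkhoffSum T g (L - N) (T^[N] x) := by
            rw [← birkhoffSum_add]; congr 1
          have h4 : ((L - N : ℕ) : ℝ) = L - N := by
            rw [Nat.cast_sub]; omega
          rw [h3]; rw [h4] at h1
          nlinarith
        · have hsplit : L = (L - 1) + 1 := by omega
          have h1 := ih (L - 1) (by omega) (T x)
          have h3 : birkhoffSum T g L x = g x + birkhoffSum T g (L - 1) (T x) := by
            rw [← birkhoffSum_succ']; congr 1
          have h5 : g x = 0 := indicator_of_notMem hx _
          have h4 : ((L - 1 : ℕ) : ℝ) = L - 1 := by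
            rw [Nat.cast_sub]; simp; omega
          rw [h3, h5]; rw [h4] at h1
          nlinarith
    have hgint : Integrable g μ := hint.indicator (hE R)
    have hI : ∀ L : ℕ, L * ∫ x, g x ∂μ ≤ c * L + R * M := by
      intro L
      have h1 : ∫ x, birkhoffSum T g L x ∂μ = L * ∫ x, g x ∂μ := by
        simp only [birkhoffSum]
        rw [integral_finsetSum]
        · rw [Finset.sum_congr rfl (fun i _ => ?_), Finset.sum_const, Finset.card_range,
            nsmul_eq_mul]
          have := (hT.iterate i)
          rw [← integral_map (f := g) this.measurable.aemeasurable
            hgm.aestronglyMeasurable, this.map_eq]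
        · intro i _
          exact (hT.iterate i).integrable_comp_of_integrable hgint
      rw [← h1]
      calc ∫ x, birkhoffSum T g L x ∂μ ≤ ∫ _x, (c * L + R * M) ∂μ := by
            refine integral_mono_of_nonneg (Eventually.of_forall fun x =>
              birkhoffSum_nonneg hg0 L x) (integrable_const _) (Eventually.of_forall (bound L))
        _ = _ := by simp
    rw [← integral_indicator (hE R)]
    by_contra! hlt
    obtain ⟨L, hL⟩ := exists_nat_gt ((R * M) / (∫ x, g x ∂μ - c))
    rw [div_lt_iff₀ (by linarith)] at hL
    have := hI L
    nlinarith
  have hmono : Monotone E := by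
    rintro R R' hRR x ⟨N, a, b⟩
    exact Exists.intro N ⟨a.trans hRR, b⟩
  have hlim := tendsto_setIntegral_of_monotone (f := f) (μ := μ) hE hmono hint.integrableOn
  have hU : ∫ x in ⋃ R, E R, f x ∂μ = ∫ x, f x ∂μ := by
    refine setIntegral_eq_integral_of_ae_compl_eq_zero ?_
    filter_upwards [h] with x hx hx'
    obtain ⟨N, h1, h2⟩ := hx
    refine absurd ?_ hx'
    rw [mem_iUnion]
    exact ⟨N, N, le_rfl, h1, h2⟩
  rw [hU] at hlim
  exact le_of_tendsto' hlim key

/-- The lower half of the pointwise ergodic theorem, for bounded nonnegative functions. -/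
theorem ergodic_eventually_le_birkhoffSum [IsProbabilityMeasure μ]
    (hT : Ergodic T μ) (hf : Measurable f) (hf0 : ∀ x, 0 ≤ f x) (hfM : ∀ x, f x ≤ M)
    (hc : c < ∫ x, f x ∂μ) :
    ∀ᵐ x ∂μ, ∀ᶠ N : ℕ in atTop, c * N ≤ birkhoffSum T f N x := by
  rcases lt_or_ge c 0 with hc0 | hc0
  · exact Eventually.of_forall fun x => Eventually.of_forall fun N =>
      (mul_nonpos_of_nonpos_of_nonneg hc0.le N.cast_nonneg).trans (birkhoffSum_nonneg hf0 N x)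
  -- `B` is the set where the lower limit of the averages is at most `c`. The slack `1 / (m + 1)`
  -- makes it forward invariant: passing from `x` to `T x` shortens the sum by one term, and the gap
  -- between the slacks at `m + 1` and at `m` absorbs this for large `N`.
  let B : Set α := {x | ∀ m : ℕ, ∃ᶠ N : ℕ in atTop, birkhoffSum T f N x ≤ (c + 1 / (m + 1)) * N}
  have hB : MeasurableSet B := by
    have : B = ⋂ m : ℕ, limsup (fun N : ℕ => {x | birkhoffSum T f N x ≤ (c + 1 / (m + 1)) * N})
        atTop := by
      ext x
      simp [B, mem_limsup_iff_frequently_mem]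
    rw [this]
    exact MeasurableSet.iInter fun m => MeasurableSet.measurableSet_limsup fun N =>
      measurableSet_le (measurable_birkhoffSum hT.measurable hf N) measurable_const
  have hBT : B ⊆ T ⁻¹' B := by
    intro x hx m
    have h1 := hx (m + 1)
    set δ : ℝ := 1 / (m + 1) - 1 / ((m + 1 : ℕ) + 1) with hδ
    have hδ0 : 0 < δ := by
      have : (1 : ℝ) / ((m + 1 : ℕ) + 1) < 1 / (m + 1) := by
        apply one_div_lt_one_div_of_lt (by positivity)
        push_cast; linarith
      linarith
    have hlarge : ∀ᶠ N : ℕ in atTop, c + 1 ≤ δ * N :=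
      (tendsto_natCast_atTop_atTop.const_mul_atTop hδ0).eventually_ge_atTop _
    have h2 : ∃ᶠ N : ℕ in atTop,
        birkhoffSum T f (N + 1) x ≤ (c + 1 / ((m + 1 : ℕ) + 1)) * (N + 1 : ℕ) := by
      rw [frequently_atTop] at h1 ⊢
      intro a
      obtain ⟨b, hb, hb'⟩ := h1 (a + 1)
      refine ⟨b - 1, by omega, ?_⟩
      rwa [Nat.sub_add_cancel (by omega)]
    refine (h2.and_eventually hlarge).mono fun N hN => ?_
    obtain ⟨ha, hb⟩ := hN
    rw [birkhoffSum_succ'] at ha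
    have h3 : (1 : ℝ) / ((m + 1 : ℕ) + 1) ≤ 1 := by
      rw [div_le_one (by positivity)]; push_cast; linarith [(Nat.cast_nonneg m : (0:ℝ) ≤ m)]
    have h4 := hf0 x
    push_cast at ha hb h3 hδ ⊢
    nlinarith
  rcases hT.ae_empty_or_univ_of_ae_le_preimage hB.nullMeasurableSet
    (LE.le.eventuallyLE hBT) with h | h
  · have : ∀ᵐ x ∂μ, x ∉ B := by
      filter_upwards [h] with x hx hx'
      have : B x = (∅ : Set α) x := hx
      exact (this ▸ hx' : (∅ : Set α) x)
    filter_upwards [this] with x hx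
    simp only [B, mem_ofPred_eq, not_forall, not_frequently, not_le] at hx
    obtain ⟨m, hm⟩ := hx
    filter_upwards [hm] with N hN
    refine le_trans ?_ hN.le
    gcongr
    have : (0 : ℝ) < 1 / (m + 1) := by positivity
    linarith
  · exfalso
    -- If `B` had full measure, the maximal-type inequality would force the integral below `c + 1 /
    -- (m + 1)`, hence below itself.
    obtain ⟨m, hm⟩ := exists_nat_one_div_lt (sub_pos.2 hc)
    have : ∫ x, f x ∂μ ≤ c + 1 / (m + 1) := by
      refine integral_le_of_exists_birkhoffSum_le hT.toMeasurePreserving hf hf0 hfM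
        (by positivity) ?_
      filter_upwards [h] with x hx
      have hx' : x ∈ B := by
        have : B x = (univ : Set α) x := hx
        exact (iff_of_eq this).2 trivial
      obtain ⟨N, hN1, hN⟩ := (frequently_atTop.1 (hx' m)) 1
      exact ⟨N, hN1, hN⟩
    linarith
end Birkhoff

/-! ### The space of sequences of states is standard Borel. -/

section StandardBorel

lemma standardBorelSpace_of_measurableEmbedding {α β : Type*} [MeasurableSpace α]
    [MeasurableSpace β] [StandardBorelSpace β] {f : α → β} (hf : MeasurableEmbedding f) :
    StandardBorelSpace α := by
  have := hf.measurableSet_range.standardBorel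
  let e : α ≃ᵐ range f := hf.equivRange
  let := upgradeStandardBorel (range f)
  let : TopologicalSpace α := TopologicalSpace.induced e inferInstance
  have he : Topology.IsInducing e := ⟨rfl⟩
  have hc : Topology.IsClosedEmbedding e :=
    ⟨⟨he, e.injective⟩, by rw [e.surjective.range_eq]; exact isClosed_univ⟩
  refine ⟨this, ⟨?_⟩, hc.polishSpace⟩
  rw [← borel_comap.symm.trans rfl, ← BorelSpace.measurable_eq]
  exact e.measurableEmbedding.comap_eq.symm

/-- The values of the distribution function at the rationals. -/
def ratCDF (μ : ProbabilityMeasure ℝ) (q : ℚ) : ℝ := (μ : Measure ℝ).real (Iic (q : ℝ))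

lemma measurable_ratCDF : Measurable ratCDF := by
  refine measurable_pi_lambda _ fun q => ?_
  exact ((Measure.measurable_coe measurableSet_Iic).comp measurable_subtype_coe).ennreal_toReal

lemma isRatStieltjesPoint_ratCDF (μ : ProbabilityMeasure ℝ) :
    IsRatStieltjesPoint (id : (ℚ → ℝ) → ℚ → ℝ) (ratCDF μ) := by
  have hcdf : ∀ q : ℚ, ratCDF μ q = cdf (μ : Measure ℝ) q := fun q => (cdf_eq_real _ _).symm
  have hfun : ratCDF μ = fun q : ℚ => cdf (μ : Measure ℝ) q := funext hcdf
  refine ⟨fun a b hab => ?_, ?_, ?_, fun t => ?_⟩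
  · simp only [id, hcdf]
    exact monotone_cdf _ (by exact_mod_cast hab)
  · simp only [id, hfun]
    exact (tendsto_cdf_atTop _).comp (tendsto_ratCast_atTop_iff.2 tendsto_id)
  · simp only [id, hfun]
    exact (tendsto_cdf_atBot _).comp (tendsto_ratCast_atBot_iff.2 tendsto_id)
  · simp only [id, hfun]
    have h1 := (cdf (μ : Measure ℝ)).iInf_rat_gt_eq t
    rw [← h1]
    exact (Equiv.iInf_congr (Equiv.subtypeEquivRight (by simp)) (by simp))

/-- A law on the line is determined by its distribution function at the rationals. The functions
that arise are exactly the rational Stieltjes points, which form a measurable set, and the Stieltjes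
construction is a measurable inverse. -/
instance : StandardBorelSpace (ProbabilityMeasure ℝ) := by
  set s : Set (ℚ → ℝ) := {F | IsRatStieltjesPoint (id : (ℚ → ℝ) → ℚ → ℝ) F}
  have hs : MeasurableSet s := measurableSet_isRatStieltjesPoint measurable_id
  let G : (ℚ → ℝ) → ProbabilityMeasure ℝ := fun F =>
    ⟨(stieltjesOfMeasurableRat id measurable_id F).measure,
      StieltjesFunction.isProbabilityMeasure _ (tendsto_stieltjesOfMeasurableRat_atBot _ _)
        (tendsto_stieltjesOfMeasurableRat_atTop _ _)⟩
  have hG : Measurable G := (measurable_measure_stieltjesOfMeasurableRat _).subtype_mk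
  have hGs : ∀ F ∈ s, ratCDF (G F) = F := by
    intro F hF
    funext q
    have h1 := measure_stieltjesOfMeasurableRat_Iic (f := id) measurable_id F q
    simp only [ratCDF, G, ProbabilityMeasure.coe_mk, measureReal_def]
    rw [h1, ENNReal.toReal_ofReal (stieltjesOfMeasurableRat_nonneg _ _ _),
      stieltjesOfMeasurableRat_eq, toRatCDF_of_isRatStieltjesPoint hF]
    rfl
  have hinj : Function.Injective ratCDF := by
    intro μ ν h
    apply Subtype.ext
    change (μ : Measure ℝ) = ν
    refine ext_of_generate_finite _ Real.borel_eq_generateFrom_Iic_rat Real.isPiSystem_Iic_rat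
      ?_ (by simp)
    intro t ht
    simp only [mem_iUnion, mem_singleton_iff] at ht
    obtain ⟨q, rfl⟩ := ht
    have := congrFun h q
    simp only [ratCDF, measureReal_def] at this
    exact (ENNReal.toReal_eq_toReal_iff' (measure_ne_top _ _) (measure_ne_top _ _)).1 this
  have hr : range ratCDF = s := by
    refine Subset.antisymm (range_subset_iff.2 isRatStieltjesPoint_ratCDF) fun F hF =>
      ⟨G F, hGs F hF⟩
  refine standardBorelSpace_of_measurableEmbedding
    (MeasurableEmbedding.of_measurable_inverse measurable_ratCDF (hr ▸ hs) hG fun μ => hinj ?_)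
  exact hGs _ (isRatStieltjesPoint_ratCDF μ)

/-- Push-forward along a measurable embedding of `X` into the line embeds the laws on `X` as those
carried by its range, a measurable condition. -/
instance {X : Type*} [MeasurableSpace X] [StandardBorelSpace X] :
    StandardBorelSpace (ProbabilityMeasure X) := by
  rcases isEmpty_or_nonempty X with hX | hX
  · have : IsEmpty (ProbabilityMeasure X) := ⟨fun μ => hX.elim μ.nonempty.some⟩
    infer_instance
  obtain ⟨e, he⟩ := exists_measurableEmbedding_real X
  let f : ProbabilityMeasure X → ProbabilityMeasure ℝ := fun μ => μ.map he.measurable.aemeasurable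
  let g : ProbabilityMeasure ℝ → ProbabilityMeasure X :=
    fun μ => μ.map he.measurable_invFun.aemeasurable
  have hf : Measurable f :=
    ((Measure.measurable_map _ he.measurable).comp measurable_subtype_coe).subtype_mk
  have hg : Measurable g :=
    ((Measure.measurable_map _ he.measurable_invFun).comp measurable_subtype_coe).subtype_mk
  have hr : range f = {ν : ProbabilityMeasure ℝ | (ν : Measure ℝ) (range e)ᶜ = 0} := by
    ext ν
    constructor
    · rintro ⟨μ, rfl⟩
      change (Measure.map e (μ : Measure X)) _ = 0
      rw [Measure.map_apply he.measurable he.measurableSet_range.compl]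
      simp
    · intro hν
      refine ⟨g ν, Subtype.ext ?_⟩
      change Measure.map e (Measure.map he.invFun (ν : Measure ℝ)) = ν
      rw [Measure.map_map he.measurable he.measurable_invFun]
      have : e ∘ he.invFun =ᵐ[(ν : Measure ℝ)] id := by
        have h1 : ∀ᵐ y ∂(ν : Measure ℝ), y ∈ range e := hν
        filter_upwards [h1] with y hy
        obtain ⟨x, rfl⟩ := hy
        simp [he.leftInverse_invFun x]
      rw [Measure.map_congr this, Measure.map_id]
  refine standardBorelSpace_of_measurableEmbedding
    (MeasurableEmbedding.of_measurable_inverse hf ?_ hg fun μ => ?_)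
  · rw [hr]
    exact measurableSet_eq_fun ((Measure.measurable_coe he.measurableSet_range.compl).comp
      measurable_subtype_coe) measurable_const
  · apply Subtype.ext
    change Measure.map he.invFun (Measure.map e (μ : Measure X)) = μ
    rw [Measure.map_map he.measurable_invFun he.measurable]
    simp [he.leftInverse_invFun.comp_eq_id]

/-- The parameters of a box. -/
def boxParams {d : ℕ} (B : Box d) :
    (Fin d → ℝ) × (Fin d → ℝ) × (Fin d → Bool) × (Fin d → Bool) :=
  (B.lower, B.upper, B.lowerClosed, B.upperClosed)

lemma boxParams_injective {d : ℕ} : Function.Injective (boxParams (d := d)) := by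
  rintro ⟨⟩ ⟨⟩ h
  simp only [boxParams, Prod.mk.injEq] at h
  simp [h]

lemma measurableEmbedding_boxParams {d : ℕ} : MeasurableEmbedding (boxParams (d := d)) := by
  have hr : range (boxParams (d := d)) = {p | ∀ i, p.1 i < p.2.1 i} := by
    ext ⟨a, b, u, v⟩
    constructor
    · rintro ⟨B, hB⟩
      rw [← hB]
      exact B.lower_lt_upper
    · intro h
      exact ⟨⟨a, b, u, v, h⟩, rfl⟩
  refine ⟨boxParams_injective, comap_measurable _, ?_⟩
  rintro _ ⟨t, ht, rfl⟩
  change MeasurableSet (boxParams '' (boxParams ⁻¹' t))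
  rw [image_preimage_eq_inter_range]
  refine ht.inter ?_
  rw [hr]
  measurability

instance {d : ℕ} : StandardBorelSpace (Box d) :=
  standardBorelSpace_of_measurableEmbedding measurableEmbedding_boxParams

instance {d : ℕ} : StandardBorelSpace (State d) := inferInstance
instance {d : ℕ} : StandardBorelSpace (ℕ → State d) := inferInstance

end StandardBorel

/-- If `f` is a measurable map from a standard Borel space and `p ∘ f` holds almost everywhere,
then `p` holds almost everywhere for the image measure, even if `p` is not measurable. -/
lemma ae_map_of_ae_comp {X Y : Type*} [MeasurableSpace X] [StandardBorelSpace X]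
    [MeasurableSpace Y] [StandardBorelSpace Y] {P : Measure X} [IsProbabilityMeasure P] {f : X → Y}
    (hf : Measurable f) {p : Y → Prop} (h : ∀ᵐ x ∂P, p (f x)) : ∀ᵐ y ∂(P.map f), p y := by
  have : Nonempty X := P.nonempty_of_neZero
  obtain ⟨t, hsub, ht, ht0⟩ := exists_measurable_superset_of_null (ae_iff.1 h)
  have h1 : ∀ᵐ z ∂(P.map fun x => (f x, x)), z.1 = f z.2 ∧ z.2 ∉ t := by
    rw [ae_map_iff (hf.prodMk measurable_id').aemeasurable]
    · have : ∀ᵐ x ∂P, x ∉ t := measure_eq_zero_iff_ae_notMem.1 ht0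
      filter_upwards [this] with x hx
      exact ⟨rfl, hx⟩
    · exact (measurableSet_eq_fun measurable_fst (hf.comp measurable_snd)).inter
        (ht.compl.preimage measurable_snd)
  -- Disintegrate `P` over `f`. For almost every `y` the conditional law is carried by points of the
  -- fibre over `y` outside the null set `t`, so such a point exists and witnesses `p y`; no
  -- measurability of `p` enters.
  have h2 := compProd_map_condDistrib (μ := P) (mβ := inferInstance) (X := f) (Y := fun x => x)
    measurable_id'.aemeasurable
  rw [← h2] at h1
  replace h2 := Measure.ae_ae_of_ae_compProd h1
  filter_upwards [h2] with y hy
  obtain ⟨x, hx, hxt⟩ := hy.exists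
  rw [show y = f x from hx]
  by_contra hc
  exact hxt (hsub hc)

/-! ### Lower Hausdorff dimension and local powers of the mass of balls. -/

section Dimension

/-- Mass distribution principle: if the image measure has at almost every point a local power
bound with exponent `b`, then its lower dimension is at least `b`. -/
lemma le_lowerDim_of_ae_closedBall_le {k : ℕ} {α : Type*} [MeasurableSpace α] {μ : Measure α}
    {g : α → Fin k → ℝ} (hg : AEMeasurable g μ) {b : ℝ≥0}
    (h : ∀ᵐ x ∂μ, ∃ K : ℝ≥0, ∀ r : ℝ≥0, 0 < r → r ≤ 1 →
      μ.map g (Metric.closedBall (g x) r) ≤ K * (r : ℝ≥0∞) ^ (b : ℝ)) :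
    (b : ℝ≥0∞) ≤ lowerDim (μ.map g) := by
  set ν := μ.map g with hν
  refine le_iInf fun A => le_iInf fun hA => le_iInf fun hpos => ?_
  -- On `Y n` the power bound holds with one constant. `Y n` is not shown to be measurable, so outer
  -- measure is used below, and its positive mass is first obtained for the preimage under `g`.
  let Y : ℕ → Set (Fin k → ℝ) := fun n => {y | y ∈ A ∧ ∀ r : ℝ≥0, 0 < r → r ≤ 1 →
    ν (Metric.closedBall y r) ≤ n * (r : ℝ≥0∞) ^ (b : ℝ)}
  obtain ⟨n, hn⟩ : ∃ n, μ (g ⁻¹' Y n) ≠ 0 := by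
    by_contra! hcon
    rw [hν, Measure.map_apply_of_aemeasurable hg hA] at hpos
    refine hpos.ne' (measure_mono_null_ae ?_ (measure_iUnion_null hcon))
    filter_upwards [h] with x ⟨K, hK⟩ hx
    obtain ⟨n, hn⟩ := exists_nat_ge K
    refine mem_iUnion.2 ⟨n, hx, fun r h0 h1 => (hK r h0 h1).trans ?_⟩
    gcongr
    exact_mod_cast hn
  have hYn : ν (Y n) ≠ 0 := fun h0 => hn (le_antisymm ((Measure.le_map_apply hg _).trans h0.le)
    bot_le)
  have hc0 : ((n + 1 : ℕ) : ℝ≥0∞) ≠ 0 := by simp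
  have hct : ((n + 1 : ℕ) : ℝ≥0∞) ≠ ∞ := ENNReal.natCast_ne_top _
  have hle : (((n + 1 : ℕ) : ℝ≥0∞)⁻¹ • OuterMeasure.restrict (Y n) ν.toOuterMeasure) ≤
      OuterMeasure.mkMetric fun r => r ^ (b : ℝ) := by
    refine OuterMeasure.le_mkMetric _ _ 2⁻¹ (by simp) fun t ht => ?_
    simp only [smul_apply, OuterMeasure.restrict_apply, smul_eq_mul]
    rw [ENNReal.inv_mul_le_iff hc0 hct]
    rcases (t ∩ Y n).eq_empty_or_nonempty with he | ⟨y, hyt, hy⟩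
    · simp [he]
    have hfin : Metric.ediam t ≠ ∞ := ne_top_of_le_ne_top (by simp) ht
    lift Metric.ediam t to ℝ≥0 using hfin with D hD
    have hD2 : D ≤ 2⁻¹ := by
      have h2 : (D : ℝ≥0∞) ≤ ((2⁻¹ : ℝ≥0) : ℝ≥0∞) := by simpa using ht
      exact_mod_cast h2
    -- The diameter `D` may be zero while the power bound needs a positive radius, so `D` is
    -- enlarged by `1 / (m + 2)`, which keeps the radius at most one, and then `m` tends to
    -- infinity.
    have hbound : ∀ m : ℕ, ν (t ∩ Y n) ≤ ((n + 1 : ℕ) : ℝ≥0∞) *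
        (((D + 1 / ((m + 1 : ℕ) + 1) : ℝ≥0) : ℝ≥0∞)) ^ (b : ℝ) := by
      intro m
      have hm : (1 : ℝ≥0) / ((m + 1 : ℕ) + 1) ≤ 2⁻¹ := by
        rw [one_div]
        apply inv_anti₀ (by simp)
        push_cast
        have : (0 : ℝ≥0) ≤ m := bot_le
        nlinarith
      have hm0 : (0 : ℝ≥0) < 1 / ((m + 1 : ℕ) + 1) := by positivity
      set r : ℝ≥0 := D + 1 / ((m + 1 : ℕ) + 1) with hr
      have hr0 : 0 < r := lt_of_lt_of_le hm0 (by simp [hr])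
      have hr1 : r ≤ 1 := by
        calc r ≤ 2⁻¹ + 2⁻¹ := add_le_add hD2 hm
          _ = 1 := by rw [← two_mul]; exact mul_inv_cancel₀ two_ne_zero
      have hsub : t ∩ Y n ⊆ Metric.closedBall y r := by
        intro z hz
        have h1 : edist z y ≤ D := hD ▸ Metric.edist_le_ediam_of_mem hz.1 hyt
        have h2 : dist z y ≤ D := by
          rw [edist_nndist] at h1
          exact_mod_cast h1
        have h3 : D ≤ r := by simp [hr]
        exact Metric.mem_closedBall.2 (h2.trans (by exact_mod_cast h3))
      calc ν (t ∩ Y n) ≤ ν (Metric.closedBall y r) := measure_mono hsub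
        _ ≤ n * (r : ℝ≥0∞) ^ (b : ℝ) := hy.2 r hr0 hr1
        _ ≤ _ := by gcongr; simp
    refine ge_of_tendsto' (?_ : Tendsto _ atTop _) hbound
    refine ENNReal.Tendsto.const_mul ?_ (Or.inr hct)
    refine ((ENNReal.continuous_rpow_const).tendsto _).comp ?_
    refine ENNReal.tendsto_coe.2 ?_
    have : Tendsto (fun m : ℕ => (1 : ℝ≥0) / ((m + 1 : ℕ) + 1)) atTop (𝓝 0) :=
      (tendsto_add_atTop_iff_nat 1).2 tendsto_one_div_add_atTop_nhds_zero_nat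
    simpa using this.const_add D
  have h3 := hle (Y n)
  rw [smul_apply, OuterMeasure.restrict_apply, inter_self, smul_eq_mul,
    OuterMeasure.coe_mkMetric (X := Fin k → ℝ) (fun r => r ^ (b : ℝ))] at h3
  have h4 : (μH[(b : ℝ)] : Measure (Fin k → ℝ)) (Y n) ≠ 0 := by
    intro h0
    have h5 : ((n + 1 : ℕ) : ℝ≥0∞)⁻¹ * ν (Y n) ≤ 0 := h3.trans h0.le
    rw [nonpos_iff_eq_zero, mul_eq_zero] at h5
    exact h5.elim (ENNReal.inv_ne_zero.2 hct) hYn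
  exact (le_dimH_of_hausdorffMeasure_ne_zero h4).trans (dimH_mono fun y hy => hy.1)

lemma measurable_measure_closedBall {k : ℕ} (ν : Measure (Fin k → ℝ)) [SFinite ν] (r : ℝ) :
    Measurable fun y => ν (Metric.closedBall y r) := by
  have h : MeasurableSet {p : (Fin k → ℝ) × (Fin k → ℝ) | dist p.2 p.1 ≤ r} :=
    measurableSet_le (measurable_snd.dist measurable_fst) measurable_const
  exact measurable_measure_prodMk_left h

/-- The cell of `y` in the grid of cubes of side `r`. -/
def gridIndex {k : ℕ} (r : ℝ) (y : Fin k → ℝ) : Fin k → ℤ := fun j => ⌊y j / r⌋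

lemma measurable_gridIndex {k : ℕ} (r : ℝ) : Measurable (gridIndex (k := k) r) :=
  measurable_pi_lambda _ fun j =>
    Int.measurable_floor.comp (by fun_prop : Measurable fun y : Fin k → ℝ => y j / r)

lemma abs_sub_lt_of_gridIndex_eq {k : ℕ} {r : ℝ} (hr : 0 < r) {y z : Fin k → ℝ}
    (h : gridIndex r y = gridIndex r z) (j : Fin k) : |y j - z j| < r := by
  have h1 := Int.abs_sub_lt_one_of_floor_eq_floor (congrFun h j)
  rwa [← sub_div, abs_div, abs_of_pos hr, div_lt_one hr] at h1

lemma dist_le_of_gridIndex_eq {k : ℕ} {r : ℝ} (hr : 0 < r) {y z : Fin k → ℝ}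
    (h : gridIndex r y = gridIndex r z) : dist y z ≤ r :=
  (dist_pi_le_iff hr.le).2 fun j => (abs_sub_lt_of_gridIndex_eq hr h j).le

lemma tsum_measure_fiber {α ι : Type*} [MeasurableSpace α] [Countable ι] [MeasurableSpace ι]
    [MeasurableSingletonClass ι] {f : α → ι} (hf : Measurable f) (ν : Measure α) :
    ∑' i, ν (f ⁻¹' {i}) = ν univ := by
  rw [← measure_iUnion]
  · congr 1
    ext x
    simp
  · intro i j hij
    exact Disjoint.preimage _ (by simpa using hij)
  · exact fun i => hf (measurableSet_singleton i)

/-- The set of points where a probability measure is frequently at least a power of the radius. -/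
lemma dimH_frequently_lt_closedBall_le {k : ℕ} (ν : Measure (Fin k → ℝ)) [IsProbabilityMeasure ν]
    {ρ C b : ℝ≥0} (hρ0 : 0 < ρ) (hρ1 : ρ < 1) (hC : 0 < C) :
    dimH {y | ∃ᶠ q : ℕ in atTop, ((ρ : ℝ≥0∞) ^ q) ^ (b : ℝ) <
      ν (Metric.closedBall y (C * ρ ^ q : ℝ≥0))} ≤ b := by
  set A : ℕ → Set (Fin k → ℝ) := fun q => {y | ((ρ : ℝ≥0∞) ^ q) ^ (b : ℝ) <
      ν (Metric.closedBall y (C * ρ ^ q : ℝ≥0))} with hAdef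
  refine le_of_forall_gt fun c hc => ?_
  obtain ⟨b', hbb', hb'c⟩ := ENNReal.lt_iff_exists_nnreal_btwn.1 hc
  refine lt_of_le_of_lt ?_ hb'c
  have hbb : b < b' := by exact_mod_cast hbb'
  have hb' : (0 : ℝ) < b' := lt_of_le_of_lt b.2 (by exact_mod_cast hbb)
  have hρ' : (ρ : ℝ≥0∞) ≠ 0 := by exact_mod_cast hρ0.ne'
  set θ : ℝ≥0∞ := (ρ : ℝ≥0∞) ^ ((b' : ℝ) - b) with hθ
  have hθ1 : θ < 1 := ENNReal.rpow_lt_one (by exact_mod_cast hρ1) (by simpa using hbb)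
  set D : ℝ≥0∞ := (3 : ℝ≥0∞) ^ k * (C : ℝ≥0∞) ^ (b' : ℝ) with hD
  have hDt : D ≠ ∞ := by
    refine ENNReal.mul_ne_top (by simp) ?_
    exact ENNReal.rpow_ne_top_of_nonneg hb'.le ENNReal.coe_ne_top
  let r : ℕ → ℝ≥0 := fun q => C * ρ ^ q
  have hr : ∀ q, (0 : ℝ) < r q := fun q => by
    have : 0 < r q := by positivity
    exact_mod_cast this
  let Q : ℕ → (Fin k → ℤ) → Set (Fin k → ℝ) := fun q i => gridIndex (r q) ⁻¹' {i}
  have hdiam : ∀ q i, Metric.ediam (A q ∩ Q q i) ≤ r q := by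
    intro q i
    refine Metric.ediam_le fun y hy z hz => ?_
    rw [edist_nndist]
    have := dist_le_of_gridIndex_eq (hr q) (hy.2.trans hz.2.symm)
    exact_mod_cast this
  -- A grid cell that meets `A q` has, together with its neighbours (`3^k` cells in all), mass at
  -- least `ρ^(q b)`. Charging its cost `r^b'` to that mass counts every cell `3^k` times, and since
  -- `b < b'` the total decays geometrically in `q`.
  have hsumq : ∀ q, ∑' i, Metric.ediam (A q ∩ Q q i) ^ (b' : ℝ) ≤ D * θ ^ q := by
    intro q
    set p : ℝ≥0∞ := (ρ : ℝ≥0∞) ^ q with hp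
    have hp0 : p ≠ 0 := pow_ne_zero _ hρ'
    have hpt : p ≠ ∞ := ENNReal.pow_ne_top ENNReal.coe_ne_top
    have hpb0 : p ^ (b : ℝ) ≠ 0 := (ENNReal.rpow_pos (pos_iff_ne_zero.2 hp0) hpt).ne'
    have hpbt : p ^ (b : ℝ) ≠ ∞ := ENNReal.rpow_ne_top_of_nonneg b.2 hpt
    let e : (Fin k → Fin 3) → Fin k → ℤ := fun s j => (s j : ℤ) - 1
    have h1 : ∀ i, Metric.ediam (A q ∩ Q q i) ^ (b' : ℝ) ≤
        ((r q : ℝ≥0∞) ^ (b' : ℝ) * (p ^ (b : ℝ))⁻¹) * ∑ s, ν (Q q (i + e s)) := by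
      intro i
      rcases (A q ∩ Q q i).eq_empty_or_nonempty with he | ⟨y, hyA, hyQ⟩
      · rw [he, Metric.ediam_empty, ENNReal.zero_rpow_of_pos hb']
        exact bot_le
      have hcov : Metric.closedBall y (r q) ⊆ ⋃ s, Q q (i + e s) := by
        intro z hz
        have hz' : ∀ j, |z j - y j| ≤ r q := fun j =>
          (dist_le_pi_dist z y j).trans (Metric.mem_closedBall.1 hz)
        have hfl : ∀ j, ∃ s : Fin 3, ⌊z j / r q⌋ = i j + ((s : ℤ) - 1) := by
          intro j
          have hyj : ⌊y j / r q⌋ = i j := congrFun hyQ j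
          have h2 : |z j / r q - y j / r q| ≤ 1 := by
            rw [← sub_div, abs_div, abs_of_pos (hr q), div_le_one (hr q)]
            exact hz' j
          have h3 := abs_le.1 h2
          have h4 : i j - 1 ≤ ⌊z j / r q⌋ := by
            rw [Int.le_floor, ← hyj]
            push_cast
            linarith [Int.floor_le (y j / r q)]
          have h5 : ⌊z j / r q⌋ < i j + 2 := by
            rw [Int.floor_lt, ← hyj]
            push_cast
            linarith [Int.lt_floor_add_one (y j / r q)]
          refine ⟨⟨(⌊z j / r q⌋ - i j + 1).toNat, by omega⟩, ?_⟩
          simp only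
          omega
        choose s hs using hfl
        exact mem_iUnion.2 ⟨s, funext hs⟩
      have h2 : p ^ (b : ℝ) ≤ ∑ s, ν (Q q (i + e s)) :=
        hyA.le.trans ((measure_mono hcov).trans (measure_iUnion_fintype_le _ _))
      calc Metric.ediam (A q ∩ Q q i) ^ (b' : ℝ) ≤ (r q : ℝ≥0∞) ^ (b' : ℝ) :=
            ENNReal.rpow_le_rpow (hdiam q i) hb'.le
        _ = ((r q : ℝ≥0∞) ^ (b' : ℝ) * (p ^ (b : ℝ))⁻¹) * p ^ (b : ℝ) := by
            rw [mul_assoc, ENNReal.inv_mul_cancel hpb0 hpbt, mul_one]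
        _ ≤ _ := by gcongr
    calc ∑' i, Metric.ediam (A q ∩ Q q i) ^ (b' : ℝ)
        ≤ ∑' i, ((r q : ℝ≥0∞) ^ (b' : ℝ) * (p ^ (b : ℝ))⁻¹) * ∑ s, ν (Q q (i + e s)) :=
          ENNReal.tsum_le_tsum h1
      _ = ((r q : ℝ≥0∞) ^ (b' : ℝ) * (p ^ (b : ℝ))⁻¹) * ∑ s, ∑' i, ν (Q q (i + e s)) := by
          rw [ENNReal.tsum_mul_left, Summable.tsum_finsetSum fun _ _ => ENNReal.summable]
      _ = ((r q : ℝ≥0∞) ^ (b' : ℝ) * (p ^ (b : ℝ))⁻¹) * 3 ^ k := by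
          have : ∀ s, ∑' i, ν (Q q (i + e s)) = 1 := fun s => by
            have h3 := (Equiv.addRight (e s)).tsum_eq (fun i => ν (Q q i))
            simp only [Equiv.coe_addRight] at h3
            rw [h3, tsum_measure_fiber (measurable_gridIndex _), measure_univ]
          simp [this]
      _ = D * θ ^ q := by
          have hrq : (r q : ℝ≥0∞) = C * p := by simp [r, hp]
          have hθq : θ ^ q = p ^ ((b' : ℝ) - b) := by
            rw [hθ, ← ENNReal.rpow_natCast, ← ENNReal.rpow_mul, mul_comm ((b' : ℝ) - b),
              ENNReal.rpow_mul, ENNReal.rpow_natCast]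
          rw [hrq, ENNReal.mul_rpow_of_nonneg _ _ hb'.le, hD, hθq,
            ENNReal.rpow_sub _ _ hp0 hpt, div_eq_mul_inv]
          ring
  have hzero : (μH[(b' : ℝ)] : Measure (Fin k → ℝ)) {y | ∃ᶠ q : ℕ in atTop, y ∈ A q} = 0 := by
    have hr0 : Tendsto (fun n => (r n : ℝ≥0∞)) atTop (𝓝 0) := by
      rw [← ENNReal.coe_zero, ENNReal.tendsto_coe]
      simpa using (NNReal.tendsto_pow_atTop_nhds_zero_of_lt_one hρ1).const_mul C
    have hle := Measure.hausdorffMeasure_le_liminf_tsum (X := Fin k → ℝ) (b' : ℝ)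
      {y | ∃ᶠ q : ℕ in atTop, y ∈ A q} (l := atTop) (ι := fun _ => ℕ × (Fin k → ℤ))
      (fun n : ℕ => (r n : ℝ≥0∞)) hr0 (fun n mi => A (n + mi.1) ∩ Q (n + mi.1) mi.2)
      (Eventually.of_forall fun n mi => (hdiam _ _).trans (by
        have : r (n + mi.1) ≤ r n := by
          exact mul_le_mul_right (pow_le_pow_of_le_one bot_le hρ1.le (Nat.le_add_right _ _)) _
        exact_mod_cast this))
      (Eventually.of_forall fun n y hy => by
        obtain ⟨q, hnq, hq⟩ := frequently_atTop.1 hy n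
        refine mem_iUnion.2 ⟨(q - n, gridIndex (r q) y), ?_⟩
        simp only [Nat.add_sub_cancel' hnq]
        exact ⟨hq, rfl⟩)
    have htail : ∀ n : ℕ, ∑' mi : ℕ × (Fin k → ℤ),
        Metric.ediam (A (n + mi.1) ∩ Q (n + mi.1) mi.2) ^ (b' : ℝ) ≤
          D * (1 - θ)⁻¹ * θ ^ n := by
      intro n
      rw [ENNReal.tsum_prod (f := fun m i => Metric.ediam (A (n + m) ∩ Q (n + m) i) ^ (b' : ℝ))]
      calc _ ≤ ∑' m : ℕ, D * θ ^ (n + m) := ENNReal.tsum_le_tsum fun m => hsumq _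
        _ = _ := by
          simp_rw [pow_add, ← mul_assoc]
          rw [ENNReal.tsum_mul_left, ENNReal.tsum_geometric]
          ring
    have hlim : Tendsto (fun n : ℕ => D * (1 - θ)⁻¹ * θ ^ n) atTop (𝓝 0) := by
      have h1 : D * (1 - θ)⁻¹ ≠ ∞ :=
        ENNReal.mul_ne_top hDt (ENNReal.inv_ne_top.2 (tsub_pos_of_lt hθ1).ne')
      simpa using ENNReal.Tendsto.const_mul
        (ENNReal.tendsto_pow_atTop_nhds_zero_of_lt_one hθ1) (Or.inr h1)
    refine le_antisymm (hle.trans ?_) bot_le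
    rw [← hlim.liminf_eq]
    exact liminf_le_liminf (Eventually.of_forall htail)
  refine dimH_le_of_hausdorffMeasure_ne_top ?_
  rw [show {y | ∃ᶠ q : ℕ in atTop, ((ρ : ℝ≥0∞) ^ q) ^ (b : ℝ) <
      ν (Metric.closedBall y (C * ρ ^ q : ℝ≥0))} = {y | ∃ᶠ q : ℕ in atTop, y ∈ A q} from rfl, hzero]
  exact ENNReal.zero_ne_top

/-- Below the lower dimension, the measure of small balls is almost everywhere at most the
corresponding power of the radius. -/
lemma ae_eventually_closedBall_le {k : ℕ} (ν : Measure (Fin k → ℝ)) [IsProbabilityMeasure ν]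
    {ρ C b : ℝ≥0} (hρ0 : 0 < ρ) (hρ1 : ρ < 1) (hC : 0 < C) (hb : (b : ℝ≥0∞) < lowerDim ν) :
    ∀ᵐ y ∂ν, ∀ᶠ q : ℕ in atTop,
      ν (Metric.closedBall y (C * ρ ^ q : ℝ≥0)) ≤ ((ρ : ℝ≥0∞) ^ q) ^ (b : ℝ) := by
  set S := {y | ∃ᶠ q : ℕ in atTop, ((ρ : ℝ≥0∞) ^ q) ^ (b : ℝ) <
      ν (Metric.closedBall y (C * ρ ^ q : ℝ≥0))} with hS
  have hSm : MeasurableSet S := by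
    have : S = limsup (fun q : ℕ => {y | ((ρ : ℝ≥0∞) ^ q) ^ (b : ℝ) <
      ν (Metric.closedBall y (C * ρ ^ q : ℝ≥0))}) atTop := by
      ext y
      simp [S, mem_limsup_iff_frequently_mem]
    rw [this]
    exact MeasurableSet.measurableSet_limsup fun q =>
      measurableSet_lt measurable_const (measurable_measure_closedBall _ _)
  have hS0 : ν S = 0 := by
    by_contra h0
    have h1 : lowerDim ν ≤ dimH S := iInf_le_of_le S (iInf_le_of_le hSm
      (iInf_le_of_le (pos_iff_ne_zero.2 h0) le_rfl))
    exact absurd (hb.trans_le (h1.trans (dimH_frequently_lt_closedBall_le ν hρ0 hρ1 hC)))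
      (lt_irrefl _)
  filter_upwards [measure_eq_zero_iff_ae_notMem.1 hS0] with y hy
  simpa [S, not_frequently] using hy

lemma lowerDim_le {k : ℕ} (ν : Measure (Fin k → ℝ)) [IsProbabilityMeasure ν] :
    lowerDim ν ≤ k := by
  have h : 0 < ν univ := by rw [measure_univ]; exact one_pos
  have h1 : lowerDim ν ≤ dimH (univ : Set (Fin k → ℝ)) :=
    iInf_le_of_le univ (iInf_le_of_le MeasurableSet.univ (iInf_le_of_le h le_rfl))
  rwa [Real.dimH_univ_pi_fin] at h1

end Dimension

/-! ### Elementary geometry of boxes. -/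

namespace Box
variable {d : ℕ}

lemma measurableSet_toSet (B : Box d) : MeasurableSet B.toSet := by
  have : B.toSet = ⋂ i, ((fun x : Fin d → ℝ => x i) ⁻¹'
      ((if B.lowerClosed i then Ici (B.lower i) else Ioi (B.lower i)) ∩
        (if B.upperClosed i then Iic (B.upper i) else Iio (B.upper i)))) := by
    ext x
    simp only [toSet, mem_ofPred_eq, mem_iInter, mem_preimage, mem_inter_iff]
    refine forall_congr' fun i => and_congr ?_ ?_ <;> split_ifs <;> simp
  rw [this]
  refine MeasurableSet.iInter fun i => (MeasurableSet.inter ?_ ?_).preimage (measurable_pi_apply i)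
    <;> split_ifs <;> measurability

lemma lower_le_of_mem {B : Box d} {x : Fin d → ℝ} (hx : x ∈ B.toSet) (i : Fin d) :
    B.lower i ≤ x i := by
  have := (hx i).1
  split_ifs at this <;> linarith

lemma le_upper_of_mem {B : Box d} {x : Fin d → ℝ} (hx : x ∈ B.toSet) (i : Fin d) :
    x i ≤ B.upper i := by
  have := (hx i).2
  split_ifs at this <;> linarith

lemma mem_of_lt {B : Box d} {x : Fin d → ℝ} (hl : ∀ i, B.lower i < x i)
    (hu : ∀ i, x i < B.upper i) : x ∈ B.toSet := by
  intro i
  have := hl i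
  have := hu i
  constructor <;> split_ifs <;> linarith

lemma nonempty_interior_toSet (B : Box d) : (interior B.toSet).Nonempty := by
  refine ⟨fun i => (B.lower i + B.upper i) / 2, mem_interior.2
    ⟨Set.pi univ fun i => Ioo (B.lower i) (B.upper i), fun x hx => ?_,
      isOpen_set_pi finite_univ fun i _ => isOpen_Ioo, fun i _ => ?_⟩⟩
  · exact mem_of_lt (fun i => (hx i trivial).1) fun i => (hx i trivial).2
  · have := B.lower_lt_upper i
    constructor <;> linarith

lemma rescale_apply (B : Box d) (x : Fin d → ℝ) (i : Fin d) :
    B.rescale x i = B.scaleFactor * (x i - B.lower i) := rfl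

lemma homothety_mem_iff (B : Box d) {a : ℝ} (ha : 0 < a) (b x : Fin d → ℝ) :
    (fun i => a * x i + b i) ∈ (B.homothety a ha b).toSet ↔ x ∈ B.toSet := by
  simp only [toSet, homothety, mem_ofPred_eq, add_le_add_iff_right, add_lt_add_iff_right,
    mul_le_mul_iff_right₀ ha, mul_lt_mul_iff_right₀ ha]

lemma rescale_mem_normalize_iff (B : Box d) (x : Fin d → ℝ) :
    B.rescale x ∈ B.normalize.toSet ↔ x ∈ B.toSet := by
  rw [normalize, ← homothety_mem_iff B B.scaleFactor_pos (-(B.scaleFactor • B.lower))]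
  have : B.rescale x = fun i => B.scaleFactor * x i + (-(B.scaleFactor • B.lower)) i := by
    funext i
    simp [rescale_apply]
    ring
  rw [this]

lemma measurableEmbedding_rescale (B : Box d) : MeasurableEmbedding B.rescale :=
  ((Homeomorph.subRight B.lower).trans
    (Homeomorph.smulOfNeZero B.scaleFactor B.scaleFactor_pos.ne')).measurableEmbedding

end Box

/-! ### Magnification at a random point. -/

section Skew
variable {d : ℕ} {E : Set (Box d)} {Δ : Box d → Set (Box d)}

lemma IsPartitionOperator.countable (hΔ : IsPartitionOperator E Δ) {A : Box d} (hA : A ∈ E) :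
    (Δ A).Countable :=
  (hΔ.disjoint A hA).countable_of_nonempty_interior fun B _ => B.nonempty_interior_toSet

lemma rescaledMeasure_coe (μ : ProbabilityMeasure (Fin d → ℝ)) (B : Box d)
    (h : (μ : Measure (Fin d → ℝ)) B.toSet ≠ 0) :
    (rescaledMeasure μ B : Measure (Fin d → ℝ)) =
      (ProbabilityTheory.cond (μ : Measure (Fin d → ℝ)) B.toSet).map B.rescale := by
  have h1 := cond_isProbabilityMeasure (μ := (μ : Measure (Fin d → ℝ))) h
  have h2 : rescaledMeasure μ B = ⟨(ProbabilityTheory.cond (μ : Measure (Fin d → ℝ)) B.toSet).map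
      B.rescale, Measure.isProbabilityMeasure_map (by unfold Box.rescale; fun_prop)⟩ := dif_neg h
  rw [h2]
  rfl

open Classical in
/-- The element of the partition `Δ(A^*)` that contains `x`. -/
def cell (E : Set (Box d)) (Δ : Box d → Set (Box d)) (A : Box d) (x : Fin d → ℝ) : Box d :=
  if h : A.normalize ∈ E ∧ ∃ B ∈ Δ A.normalize, x ∈ B.toSet then h.2.choose else A

/-- The state reached from `s` when the box `B` is chosen. -/
def next (s : State d) (B : Box d) : State d := (rescaledMeasure s.1 B, B)

/-- One step of the magnification dynamics: move to the cell that contains the point, and rescale. -/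
def step (E : Set (Box d)) (Δ : Box d → Set (Box d)) (p : State d × (Fin d → ℝ)) :
    State d × (Fin d → ℝ) :=
  (next p.1 (cell E Δ p.1.2 p.2), (cell E Δ p.1.2 p.2).rescale p.2)

/-- The sequence of states along the magnification of the state `s` at the point `x`. -/
def orbit (E : Set (Box d)) (Δ : Box d → Set (Box d)) (s : State d) (x : Fin d → ℝ) (n : ℕ) :
    State d := ((step E Δ)^[n] (s, x)).1

/-- The position of the point `x` in the coordinates of the `n`-th magnification. -/
def orbitPt (E : Set (Box d)) (Δ : Box d → Set (Box d)) (s : State d) (x : Fin d → ℝ) (n : ℕ) :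
    Fin d → ℝ := ((step E Δ)^[n] (s, x)).2

/-- Prepend a state to a sequence of states. -/
def consState (s : State d) (ω : ℕ → State d) : ℕ → State d
  | 0 => s
  | n + 1 => ω n

lemma orbit_zero (s : State d) (x : Fin d → ℝ) : orbit E Δ s x 0 = s := rfl

lemma orbitPt_zero (s : State d) (x : Fin d → ℝ) : orbitPt E Δ s x 0 = x := rfl

lemma orbit_succ' (s : State d) (x : Fin d → ℝ) (n : ℕ) :
    orbit E Δ s x (n + 1) = orbit E Δ (step E Δ (s, x)).1 (step E Δ (s, x)).2 n := rfl

lemma orbitPt_succ' (s : State d) (x : Fin d → ℝ) (n : ℕ) :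
    orbitPt E Δ s x (n + 1) = orbitPt E Δ (step E Δ (s, x)).1 (step E Δ (s, x)).2 n := rfl

lemma orbit_eq_consState (s : State d) (x : Fin d → ℝ) :
    orbit E Δ s x = consState s (orbit E Δ (step E Δ (s, x)).1 (step E Δ (s, x)).2) := by
  funext n
  cases n <;> rfl

lemma iterate_step (s : State d) (x : Fin d → ℝ) (n : ℕ) :
    (step E Δ)^[n] (s, x) = (orbit E Δ s x n, orbitPt E Δ s x n) := rfl

lemma orbit_add (s : State d) (x : Fin d → ℝ) (m n : ℕ) :
    orbit E Δ s x (m + n) = orbit E Δ (orbit E Δ s x m) (orbitPt E Δ s x m) n := by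
  rw [orbit, add_comm, Function.iterate_add_apply, iterate_step]
  rfl

lemma orbitPt_add (s : State d) (x : Fin d → ℝ) (m n : ℕ) :
    orbitPt E Δ s x (m + n) = orbitPt E Δ (orbit E Δ s x m) (orbitPt E Δ s x m) n := by
  rw [orbitPt, add_comm, Function.iterate_add_apply, iterate_step]
  rfl

lemma orbit_succ (s : State d) (x : Fin d → ℝ) (n : ℕ) :
    orbit E Δ s x (n + 1) =
      next (orbit E Δ s x n) (cell E Δ (orbit E Δ s x n).2 (orbitPt E Δ s x n)) := by
  rw [orbit_add]
  rfl

lemma orbitPt_succ (s : State d) (x : Fin d → ℝ) (n : ℕ) :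
    orbitPt E Δ s x (n + 1) =
      (orbit E Δ s x (n + 1)).2.rescale (orbitPt E Δ s x n) := by
  rw [orbitPt_add, orbit_succ]
  rfl

lemma cell_eq (hΔ : IsPartitionOperator E Δ) {A B : Box d} {x : Fin d → ℝ} (hA : A.normalize ∈ E)
    (hB : B ∈ Δ A.normalize) (hx : x ∈ B.toSet) : cell E Δ A x = B := by
  have h : A.normalize ∈ E ∧ ∃ B ∈ Δ A.normalize, x ∈ B.toSet := ⟨hA, B, hB, hx⟩
  rw [cell, dif_pos h]
  by_contra hne
  exact (Set.disjoint_left.1 (hΔ.disjoint _ hA h.2.choose_spec.1 hB hne)) h.2.choose_spec.2 hx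

lemma cell_mem (hΔ : IsPartitionOperator E Δ) {A : Box d} {x : Fin d → ℝ} (hA : A.normalize ∈ E)
    (hx : x ∈ A.normalize.toSet) :
    cell E Δ A x ∈ Δ A.normalize ∧ x ∈ (cell E Δ A x).toSet := by
  rw [← hΔ.cover _ hA, mem_iUnion₂] at hx
  obtain ⟨B, hB, hxB⟩ := hx
  rw [cell_eq hΔ hA hB hxB]
  exact ⟨hB, hxB⟩

lemma step_eq (hΔ : IsPartitionOperator E Δ) {s : State d} {B : Box d} {x : Fin d → ℝ}
    (hA : s.2.normalize ∈ E) (hB : B ∈ Δ s.2.normalize) (hx : x ∈ B.toSet) :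
    step E Δ (s, x) = (next s B, B.rescale x) := by
  simp [step, cell_eq hΔ hA hB hx]

/-- For a fixed state the first step takes countably many values: one for each cell, and the default
of `cell` off the partition. The induction peels off the first step, so only measurability in the
point, never in the state, is needed. -/
lemma measurable_orbit_apply (hΔ : IsPartitionOperator E Δ) (n : ℕ) :
    ∀ s : State d, Measurable fun x => orbit E Δ s x n := by
  induction n with
  | zero => exact fun s => measurable_const
  | succ n ih =>
    intro s
    have hcomp : ∀ B : Box d, Measurable fun x => orbit E Δ (next s B) (B.rescale x) n :=
      fun B => (ih _).comp B.measurableEmbedding_rescale.measurable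
    by_cases hA : s.2.normalize ∈ E
    · have hcount := hΔ.countable hA
      intro t ht
      have hU : MeasurableSet (⋃ B ∈ Δ s.2.normalize, B.toSet) :=
        MeasurableSet.biUnion hcount fun B _ => B.measurableSet_toSet
      have : (fun x => orbit E Δ s x (n + 1)) ⁻¹' t =
          (⋃ B ∈ Δ s.2.normalize, (B.toSet ∩ {x | orbit E Δ (next s B) (B.rescale x) n ∈ t})) ∪
          ((⋃ B ∈ Δ s.2.normalize, B.toSet)ᶜ ∩
            {x | orbit E Δ (next s s.2) (s.2.rescale x) n ∈ t}) := by
        ext x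
        by_cases hx : ∃ B ∈ Δ s.2.normalize, x ∈ B.toSet
        · obtain ⟨B, hB, hxB⟩ := hx
          have h1 : x ∈ ⋃ B ∈ Δ s.2.normalize, B.toSet := mem_iUnion₂.2 ⟨B, hB, hxB⟩
          simp only [mem_preimage, orbit_succ', step_eq hΔ hA hB hxB, mem_union, mem_inter_iff,
            mem_compl_iff, h1, not_true, false_and, or_false, mem_iUnion, mem_ofPred_eq]
          constructor
          · exact fun h => ⟨B, hB, hxB, h⟩
          · rintro ⟨B', hB', hxB', h'⟩
            rwa [← (cell_eq hΔ hA hB' hxB').symm.trans (cell_eq hΔ hA hB hxB)]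
        · have h1 : x ∉ ⋃ B ∈ Δ s.2.normalize, B.toSet := by
            simpa using hx
          have h2 : cell E Δ s.2 x = s.2 := dif_neg fun h => hx h.2
          have h3 : x ∉ ⋃ B ∈ Δ s.2.normalize,
              (B.toSet ∩ {x | orbit E Δ (next s B) (B.rescale x) n ∈ t}) := by
            intro h
            obtain ⟨B', hB', hxB', h'⟩ := mem_iUnion₂.1 h
            exact hx ⟨B', hB', hxB'⟩
          simp only [mem_preimage, orbit_succ', step, h2, mem_union, mem_inter_iff,
            mem_compl_iff, h1, not_false_iff, true_and, h3, false_or, mem_ofPred_eq]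
      rw [this]
      refine (MeasurableSet.biUnion hcount fun B _ => B.measurableSet_toSet.inter (hcomp B ht)).union
        (hU.compl.inter (hcomp _ ht))
    · have h2 : ∀ x, cell E Δ s.2 x = s.2 := fun x => dif_neg fun h => hA h.1
      have : (fun x => orbit E Δ s x (n + 1)) =
          fun x => orbit E Δ (next s s.2) (s.2.rescale x) n := by
        funext x
        simp only [orbit_succ', step, h2]
      rw [this]
      exact hcomp _

lemma measurable_orbit (hΔ : IsPartitionOperator E Δ) (s : State d) :
    Measurable (orbit E Δ s) :=
  measurable_pi_lambda _ fun n => measurable_orbit_apply hΔ n s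

/-- The state `s` consists of a measure on the normalized box, and the partition operator is
defined on the normalized box. -/
def IsValid (E : Set (Box d)) (s : State d) : Prop :=
  s.2.normalize ∈ E ∧ (s.1 : Measure (Fin d → ℝ)) s.2.normalize.toSetᶜ = 0

lemma IsValid.ae_mem {s : State d} (hs : IsValid E s) :
    ∀ᵐ x ∂(s.1 : Measure (Fin d → ℝ)), x ∈ s.2.normalize.toSet := by
  rw [ae_iff]
  exact hs.2

lemma measure_normalize_compl_next (s : State d) (B : Box d)
    (hB : (s.1 : Measure (Fin d → ℝ)) B.toSet ≠ 0) :
    ((next s B).1 : Measure (Fin d → ℝ)) B.normalize.toSetᶜ = 0 := by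
  change (rescaledMeasure s.1 B : Measure (Fin d → ℝ)) _ = 0
  rw [rescaledMeasure_coe _ _ hB,
    B.measurableEmbedding_rescale.map_apply]
  have : B.rescale ⁻¹' B.normalize.toSetᶜ = B.toSetᶜ := by
    ext x
    simp [B.rescale_mem_normalize_iff]
  rw [this, cond_apply B.measurableSet_toSet]
  simp

/-- The one-step formula: the law of the first step of the magnification of `s` at a random point
is given by the transition law. The function `F` is arbitrary. -/
lemma lintegral_step (hΔ : IsPartitionOperator E Δ) {s : State d} (hs : IsValid E s)
    (F : State d × (Fin d → ℝ) → ℝ≥0∞) :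
    ∫⁻ x, F (step E Δ (s, x)) ∂(s.1 : Measure (Fin d → ℝ)) =
      ∑' B : Δ s.2.normalize, (s.1 : Measure (Fin d → ℝ)) B.1.toSet *
        ∫⁻ y, F (next s B, y) ∂((next s B).1 : Measure (Fin d → ℝ)) := by
  have hcount : Countable (Δ s.2.normalize) := (hΔ.countable hs.1).to_subtype
  have hcov : (⋃ B : Δ s.2.normalize, B.1.toSet) = s.2.normalize.toSet := by
    rw [← hΔ.cover _ hs.1, biUnion_eq_iUnion]
  have h1 : (s.1 : Measure (Fin d → ℝ)).restrict (⋃ B : Δ s.2.normalize, B.1.toSet) = s.1 := by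
    rw [hcov, Measure.restrict_eq_self_of_ae_mem hs.ae_mem]
  conv_lhs => rw [← h1]
  rw [lintegral_iUnion (s := fun B : Δ s.2.normalize => B.1.toSet)
    (fun B => B.1.measurableSet_toSet) (fun B B' hBB' =>
    hΔ.disjoint _ hs.1 B.2 B'.2 fun h => hBB' (Subtype.ext h))]
  refine tsum_congr fun B => ?_
  rw [setLIntegral_congr_fun (g := fun x => F (next s B, B.1.rescale x)) B.1.measurableSet_toSet
    fun x hx => by rw [step_eq hΔ hs.1 B.2 hx]]
  by_cases h0 : (s.1 : Measure (Fin d → ℝ)) B.1.toSet = 0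
  · rw [Measure.restrict_eq_zero.2 h0, h0]
    simp
  · change _ = _ * ∫⁻ y, _ ∂(rescaledMeasure s.1 B.1 : Measure (Fin d → ℝ))
    rw [rescaledMeasure_coe _ _ h0, B.1.measurableEmbedding_rescale.lintegral_map,
      ProbabilityTheory.cond, lintegral_smul_measure, smul_eq_mul, ← mul_assoc,
      ENNReal.mul_inv_cancel h0 (measure_ne_top _ _), one_mul]

/-- Null sets can be tested cell by cell because the partition is countable, and rescaling is a
measurable embedding, so they pass in both directions for an arbitrary predicate. -/
lemma ae_step_iff (hΔ : IsPartitionOperator E Δ) {s : State d} (hs : IsValid E s)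
    (p : State d × (Fin d → ℝ) → Prop) :
    (∀ᵐ x ∂(s.1 : Measure (Fin d → ℝ)), p (step E Δ (s, x))) ↔
      ∀ B ∈ Δ s.2.normalize, (s.1 : Measure (Fin d → ℝ)) B.toSet ≠ 0 →
        ∀ᵐ y ∂((next s B).1 : Measure (Fin d → ℝ)), p (next s B, y) := by
  have hkey : ∀ B ∈ Δ s.2.normalize, (s.1 : Measure (Fin d → ℝ)) B.toSet ≠ 0 →
      ((∀ᵐ y ∂((next s B).1 : Measure (Fin d → ℝ)), p (next s B, y)) ↔
        ∀ᵐ x ∂(s.1 : Measure (Fin d → ℝ)), x ∈ B.toSet → p (step E Δ (s, x))) := by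
    intro B hB h0
    change (∀ᵐ y ∂(rescaledMeasure s.1 B : Measure (Fin d → ℝ)), _) ↔ _
    rw [rescaledMeasure_coe _ _ h0, B.measurableEmbedding_rescale.ae_map_iff,
      ProbabilityTheory.cond, Measure.ae_ennreal_smul_measure_iff
        (ENNReal.inv_ne_zero.2 (measure_ne_top _ _)), ae_restrict_iff' B.measurableSet_toSet]
    refine eventually_congr (Eventually.of_forall fun x => forall_congr' fun hx => ?_)
    rw [step_eq hΔ hs.1 hB hx]
  constructor
  · intro h B hB h0
    rw [hkey B hB h0]
    filter_upwards [h] with x hx _ using hx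
  · intro h
    have h2 : ∀ᵐ x ∂(s.1 : Measure (Fin d → ℝ)), ∀ B ∈ Δ s.2.normalize,
        x ∈ B.toSet → p (step E Δ (s, x)) := by
      rw [ae_ball_iff (hΔ.countable hs.1)]
      intro B hB
      by_cases h0 : (s.1 : Measure (Fin d → ℝ)) B.toSet = 0
      · filter_upwards [measure_eq_zero_iff_ae_notMem.1 h0] with x hx hx' using absurd hx' hx
      · exact (hkey B hB h0).1 (h B hB h0)
    filter_upwards [h2, hs.ae_mem] with x hx hxm
    rw [← hΔ.cover _ hs.1, mem_iUnion₂] at hxm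
    obtain ⟨B, hB, hxB⟩ := hxm
    exact hx B hB hxB

/-- All magnifications of the state `s` at typical points are valid. -/
def IsAdmissible (E : Set (Box d)) (Δ : Box d → Set (Box d)) (s : State d) : Prop :=
  IsValid E s ∧ ∀ᵐ x ∂(s.1 : Measure (Fin d → ℝ)), ∀ n, (orbit E Δ s x n).2.normalize ∈ E

lemma IsAdmissible.next (hΔ : IsPartitionOperator E Δ) {s : State d} (hs : IsAdmissible E Δ s)
    {B : Box d} (hB : B ∈ Δ s.2.normalize) (h0 : (s.1 : Measure (Fin d → ℝ)) B.toSet ≠ 0) :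
    IsAdmissible E Δ (next s B) := by
  have h1 : ∀ᵐ x ∂(s.1 : Measure (Fin d → ℝ)), (fun p : State d × (Fin d → ℝ) =>
      ∀ n, (orbit E Δ p.1 p.2 n).2.normalize ∈ E) (step E Δ (s, x)) := by
    filter_upwards [hs.2] with x hx n using hx (n + 1)
  have h2 := (ae_step_iff hΔ hs.1 fun p : State d × (Fin d → ℝ) =>
    ∀ n, (orbit E Δ p.1 p.2 n).2.normalize ∈ E).1 h1 B hB h0
  refine ⟨⟨?_, measure_normalize_compl_next s B h0⟩, h2⟩
  obtain ⟨y, hy⟩ := h2.exists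
  exact hy 0

/-- The Markov property at the level of null sets: given its past, the point in the `n`-th
magnification is distributed by the `n`-th measure. Conditioning on the first step and applying the
induction hypothesis to each cell of positive mass avoids measurability of `p`. -/
lemma IsAdmissible.ae_ae_orbit (hΔ : IsPartitionOperator E Δ)
    (p : State d × (Fin d → ℝ) → Prop) (n : ℕ) : ∀ {s : State d}, IsAdmissible E Δ s →
    (∀ᵐ x ∂(s.1 : Measure (Fin d → ℝ)), p (orbit E Δ s x n, orbitPt E Δ s x n)) →
    ∀ᵐ x ∂(s.1 : Measure (Fin d → ℝ)), IsAdmissible E Δ (orbit E Δ s x n) ∧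
      ∀ᵐ y ∂((orbit E Δ s x n).1 : Measure (Fin d → ℝ)), p (orbit E Δ s x n, y) := by
  induction n with
  | zero => exact fun {s} hs h => Eventually.of_forall fun x => ⟨hs, h⟩
  | succ n ih =>
    intro s hs h
    have h1 := (ae_step_iff hΔ hs.1 (fun q => p (orbit E Δ q.1 q.2 n, orbitPt E Δ q.1 q.2 n))).1 h
    exact (ae_step_iff hΔ hs.1 (fun q => IsAdmissible E Δ (orbit E Δ q.1 q.2 n) ∧
      ∀ᵐ y ∂((orbit E Δ q.1 q.2 n).1 : Measure (Fin d → ℝ)), p (orbit E Δ q.1 q.2 n, y))).2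
      fun B hB h0 => ih (hs.next hΔ hB h0) (h1 B hB h0)

/-- Conditionally on the first `n` steps of the magnification, the position of a random point in
the `n`-th magnification is distributed according to the `n`-th measure. -/
lemma IsAdmissible.lintegral_orbitPt (hΔ : IsPartitionOperator E Δ) (n : ℕ) :
    ∀ {s : State d}, IsAdmissible E Δ s → ∀ F : (ℕ → State d) → (Fin d → ℝ) → ℝ≥0∞,
    (∀ ω ω', (∀ i ≤ n, ω i = ω' i) → F ω = F ω') →
    ∫⁻ x, F (orbit E Δ s x) (orbitPt E Δ s x n) ∂(s.1 : Measure (Fin d → ℝ)) =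
      ∫⁻ x, ∫⁻ y, F (orbit E Δ s x) y ∂((orbit E Δ s x n).1 : Measure (Fin d → ℝ))
        ∂(s.1 : Measure (Fin d → ℝ)) := by
  induction n with
  | zero =>
    intro s hs F hF
    have h : ∀ x, F (orbit E Δ s x) = F (fun _ => s) := fun x => hF _ _ fun i hi => by
      rw [Nat.le_zero.1 hi, orbit_zero]
    simp only [h, orbitPt_zero, orbit_zero]
    simp
  | succ n ih =>
    intro s hs F hF
    have h1 := lintegral_step hΔ hs.1 fun q : State d × (Fin d → ℝ) =>
      F (consState s (orbit E Δ q.1 q.2)) (orbitPt E Δ q.1 q.2 n)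
    have h2 := lintegral_step hΔ hs.1 fun q : State d × (Fin d → ℝ) =>
      ∫⁻ y, F (consState s (orbit E Δ q.1 q.2)) y ∂((orbit E Δ q.1 q.2 n).1 : Measure (Fin d → ℝ))
    simp only [orbitPt_succ', orbit_succ']
    simp only [orbit_eq_consState s]
    rw [h1, h2]
    refine tsum_congr fun B => ?_
    by_cases h0 : (s.1 : Measure (Fin d → ℝ)) B.1.toSet = 0
    · simp [h0]
    congr 1
    -- After the first step the initial state is a constant, so it is absorbed into the function of
    -- the remaining sequence.
    refine ih (hs.next hΔ B.2 h0) (fun ω => F (consState s ω)) fun ω ω' h => hF _ _ fun i hi => ?_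
    cases i with
    | zero => rfl
    | succ i => exact h i (by omega)

end Skew

/-! ### The law of the chain is the law of random magnification. -/

section Law
variable {d : ℕ} {E : Set (Box d)} {Δ : Box d → Set (Box d)} {P : Measure (ℕ → State d)}

/-- The distribution of the first state of the process. -/
def stateMarginal (P : Measure (ℕ → State d)) : Measure (State d) := P.map fun ω => ω 0

lemma shift_iterate (m : ℕ) (ω : ℕ → State d) (n : ℕ) : shift^[m] ω n = ω (n + m) := by
  induction m generalizing ω with
  | zero => rfl
  | succ m ih => rw [Function.iterate_succ_apply, ih, shift, add_assoc]

lemma measurable_shift : Measurable (shift (d := d)) :=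
  measurable_pi_lambda _ fun n => measurable_pi_apply (n + 1)

lemma IsCPChain.map_apply (hP : IsCPChain E Δ P) (m : ℕ) :
    P.map (fun ω => ω m) = stateMarginal P := by
  have h := (hP.stationary.iterate m).map_eq
  rw [stateMarginal]
  conv_rhs => rw [← h]
  rw [Measure.map_map (measurable_pi_apply 0) (measurable_shift.iterate m)]
  congr 1
  funext ω
  simp [shift_iterate]

lemma IsCPChain.isProbabilityMeasure_stateMarginal (hP : IsCPChain E Δ P) :
    IsProbabilityMeasure (stateMarginal P) := by
  have := hP.isProbabilityMeasure
  exact Measure.isProbabilityMeasure_map (measurable_pi_apply 0).aemeasurable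

/-- Membership in the arbitrary family `E` is not a measurable condition, so the passage to the
marginal relies on `ae_map_of_ae_comp`. -/
lemma IsCPChain.ae_isValid (hP : IsCPChain E Δ P) : ∀ᵐ s ∂(stateMarginal P), IsValid E s := by
  have := hP.isProbabilityMeasure
  refine ae_map_of_ae_comp (measurable_pi_apply 0) ?_
  filter_upwards [hP.mem_state] with ω hω using ⟨(hω 0).2.1, (hω 0).2.2⟩

lemma transition_apply (s : State d) (f : State d → ℝ≥0∞) :
    ∫⁻ t, f t ∂(transition Δ s) =
      ∑' B : Δ s.2.normalize, (s.1 : Measure (Fin d → ℝ)) B.1.toSet * f (next s B) := by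
  rw [transition, lintegral_sum_measure]
  refine tsum_congr fun B => ?_
  rw [lintegral_smul_measure, lintegral_dirac, smul_eq_mul]
  rfl

lemma isProbabilityMeasure_transition (hΔ : IsPartitionOperator E Δ) {s : State d}
    (hs : IsValid E s) : IsProbabilityMeasure (transition Δ s) := by
  constructor
  have h1 := lintegral_step hΔ hs fun _ => 1
  have h2 := transition_apply (Δ := Δ) s fun _ => 1
  simp only [lintegral_const, measure_univ, mul_one, one_mul] at h1 h2
  rw [h2, ← h1]

/-- A measurable version of the transition law. -/
def transitionKernel (P : Measure (ℕ → State d)) [IsFiniteMeasure P] [Nonempty (State d)] :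
    Kernel (State d) (State d) :=
  condDistrib (fun ω : ℕ → State d => ω 1) (fun ω => ω 0) P

lemma comap_apply_zero_eq_piLE :
    MeasurableSpace.comap (fun ω : ℕ → State d => ω 0) inferInstance =
      Filtration.piLE (X := fun _ : ℕ => State d) 0 := by
  rw [Filtration.piLE_eq_comap_frestrictLe]
  refine le_antisymm ?_ ?_
  · have : (fun ω : ℕ → State d => ω 0) =
        (fun u : (Π _ : Finset.Iic 0, State d) => u ⟨0, by simp⟩) ∘ Preorder.frestrictLe 0 := rfl
    rw [this, ← MeasurableSpace.comap_comp]
    exact MeasurableSpace.comap_mono (measurable_pi_apply _).comap_le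
  · have : (Preorder.frestrictLe 0 : (ℕ → State d) → _) =
        (fun (s : State d) (_ : Finset.Iic 0) => s) ∘ fun ω => ω 0 := by
      funext ω i
      obtain ⟨i, hi⟩ := i
      have : i = 0 := by simpa using hi
      subst this
      rfl
    rw [this, ← MeasurableSpace.comap_comp]
    exact MeasurableSpace.comap_mono (measurable_pi_lambda _ fun _ => measurable_id).comap_le

/-- `transition Δ` is not known to depend measurably on the state. It agrees almost surely with the
regular conditional distribution on each set of a countable algebra that generates the σ-algebra,
hence as a measure. -/
lemma IsCPChain.ae_transitionKernel_eq (hΔ : IsPartitionOperator E Δ) (hP : IsCPChain E Δ P)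
    [IsFiniteMeasure P] [Nonempty (State d)] :
    ∀ᵐ s ∂(stateMarginal P), transitionKernel P s = transition Δ s := by
  have := hP.isProbabilityMeasure
  have h1 : ∀ S : Set (State d), MeasurableSet S →
      ∀ᵐ s ∂(stateMarginal P), (transitionKernel P s).real S = (transition Δ s).real S := by
    intro S hS
    refine ae_map_of_ae_comp (measurable_pi_apply 0) ?_
    have h2 := condDistrib_ae_eq_condExp (μ := P) (mβ := inferInstance)
      (X := fun ω : ℕ → State d => ω 0)
      (Y := fun ω => ω 1) (measurable_pi_apply 0) (measurable_pi_apply 1) hS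
    have h3 := hP.markov 0 S hS
    rw [← comap_apply_zero_eq_piLE] at h3
    filter_upwards [h2, h3] with ω h2 h3
    rw [transitionKernel, h2, ← h3]
    rfl
  let 𝒜 := generateSetAlgebra (MeasurableSpace.countableGeneratingSet (State d))
  have hAc : 𝒜.Countable :=
    countable_generateSetAlgebra (MeasurableSpace.countable_countableGeneratingSet)
  have hAg : MeasurableSpace.generateFrom 𝒜 = (inferInstance : MeasurableSpace (State d)) := by
    rw [generateFrom_generateSetAlgebra_eq, MeasurableSpace.generateFrom_countableGeneratingSet]
  have hAm : ∀ S ∈ 𝒜, MeasurableSet S := fun S hS => by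
    have h := MeasurableSpace.measurableSet_generateFrom hS
    rwa [hAg] at h
  have h2 : ∀ᵐ s ∂(stateMarginal P), ∀ S ∈ 𝒜,
      (transitionKernel P s).real S = (transition Δ s).real S :=
    (ae_ball_iff hAc).2 fun S hS => h1 S (hAm S hS)
  filter_upwards [h2, hP.ae_isValid] with s hs hv
  have := isProbabilityMeasure_transition hΔ hv
  have : IsProbabilityMeasure (transitionKernel P s) := by
    rw [transitionKernel]; infer_instance
  refine ext_of_generate_finite 𝒜 hAg.symm
    (isSetAlgebra_generateSetAlgebra.isSetRing.isSetSemiring.isPiSystem) (fun S hS => ?_) (by simp)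
  exact (measureReal_eq_measureReal_iff).1 (hs S hS)

/-- The Markov property at time `m` on an event `D` of the past, with the measurable kernel in place
of `transition`. Stationarity carries the identification of the two from time zero to time `m`. -/
lemma IsCPChain.map_restrict_succ (hΔ : IsPartitionOperator E Δ) (hP : IsCPChain E Δ P)
    [IsFiniteMeasure P] [Nonempty (State d)] (m : ℕ) {D : Set (ℕ → State d)}
    (hD : MeasurableSet[Filtration.piLE (X := fun _ : ℕ => State d) m] D) :
    (P.restrict D).map (fun ω => ω (m + 1)) =
      ((P.restrict D).map fun ω => ω m).bind (transitionKernel P) := by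
  have := hP.isProbabilityMeasure
  have hDm : MeasurableSet D := Filtration.le _ m D hD
  have hK : IsMarkovKernel (transitionKernel P) := by rw [transitionKernel]; infer_instance
  have htr : ∀ᵐ ω ∂P, transitionKernel P (ω m) = transition Δ (ω m) := by
    have h := hP.ae_transitionKernel_eq hΔ
    rw [← hP.map_apply m] at h
    exact ae_of_ae_map (measurable_pi_apply m).aemeasurable h
  ext S hS
  have hmeas : Measurable fun ω : ℕ → State d => transitionKernel P (ω m) S :=
    (Kernel.measurable_coe _ hS).comp (measurable_pi_apply m)
  rw [Measure.map_apply (measurable_pi_apply (m + 1)) hS,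
    Measure.bind_apply hS (transitionKernel P).measurable.aemeasurable,
    lintegral_map (Kernel.measurable_coe _ hS) (measurable_pi_apply m)]
  have h1 : ∫ ω in D, (transitionKernel P (ω m) S).toReal ∂P =
      ∫ ω in D, S.indicator (fun _ => (1 : ℝ)) (ω (m + 1)) ∂P := by
    rw [← setIntegral_condExp (f := fun ω : ℕ → State d =>
      S.indicator (fun _ => (1 : ℝ)) (ω (m + 1))) (Filtration.le _ m) ?_ hD]
    · refine setIntegral_congr_ae hDm ?_
      filter_upwards [hP.markov m S hS, htr] with ω h1 h2 _
      rw [h1, h2]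
      rfl
    · refine Integrable.of_bound (C := 1) ?_ (Eventually.of_forall fun ω => ?_)
      · exact ((measurable_const.indicator hS).comp (measurable_pi_apply (m + 1))).aestronglyMeasurable
      · by_cases h : ω (m + 1) ∈ S <;> simp [h]
  rw [integral_toReal hmeas.aemeasurable (Eventually.of_forall fun ω => measure_lt_top _ _)] at h1
  have h2 : ∫ ω in D, S.indicator (fun _ => (1 : ℝ)) (ω (m + 1)) ∂P =
      (P.restrict D ((fun ω => ω (m + 1)) ⁻¹' S)).toReal := by
    have : (fun ω : ℕ → State d => S.indicator (fun _ => (1 : ℝ)) (ω (m + 1))) =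
        ((fun ω => ω (m + 1)) ⁻¹' S).indicator fun _ => (1 : ℝ) := rfl
    rw [this, integral_indicator_const _ (measurable_pi_apply (m + 1) hS)]
    simp [measureReal_def]
  rw [h2] at h1
  refine ((ENNReal.toReal_eq_toReal_iff' ?_ (measure_ne_top _ _)).1 h1).symm
  refine ne_top_of_le_ne_top (b := ∫⁻ ω in D, 1 ∂P) (by simp) (lintegral_mono fun ω => ?_)
  exact prob_le_one

/-- The law of the magnification of the state `s` at a random point. -/
def orbitLaw (E : Set (Box d)) (Δ : Box d → Set (Box d)) (s : State d) :
    Measure (ℕ → State d) :=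
  (s.1 : Measure (Fin d → ℝ)).map (orbit E Δ s)

/-- The cylinder set of sequences whose first `n` states belong to the given sets. -/
def rect (n : ℕ) (S : ℕ → Set (State d)) : Set (ℕ → State d) := {ω | ∀ i < n, ω i ∈ S i}

lemma measurableSet_rect (n : ℕ) {S : ℕ → Set (State d)} (hS : ∀ i, MeasurableSet (S i)) :
    MeasurableSet (rect n S) := by
  have : rect n S = ⋂ i ∈ Finset.range n, (fun ω : ℕ → State d => ω i) ⁻¹' S i := by
    ext ω
    simp [rect]
  rw [this]
  exact Finset.measurableSet_biInter _ fun i _ => measurable_pi_apply i (hS i)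

lemma orbitLaw_rect_succ (hΔ : IsPartitionOperator E Δ) {s : State d} (hs : IsValid E s) (n : ℕ)
    {S : ℕ → Set (State d)} (hS : ∀ i, MeasurableSet (S i)) :
    orbitLaw E Δ s (rect (n + 1) S) = (S 0).indicator
      (fun s => ∫⁻ t, orbitLaw E Δ t (rect n fun i => S (i + 1)) ∂(transition Δ s)) s := by
  have hm := measurableSet_rect (n + 1) hS
  have hm' := measurableSet_rect n fun i => hS (i + 1)
  have hpre : ∀ x, orbit E Δ s x ∈ rect (n + 1) S ↔ s ∈ S 0 ∧
      orbit E Δ (step E Δ (s, x)).1 (step E Δ (s, x)).2 ∈ rect n fun i => S (i + 1) := by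
    intro x
    constructor
    · exact fun h => ⟨h 0 (by omega), fun i hi => h (i + 1) (by omega)⟩
    · rintro ⟨h0, h⟩ i hi
      cases i with
      | zero => exact h0
      | succ i => exact h i (by omega)
  rw [orbitLaw, Measure.map_apply (measurable_orbit hΔ s) hm]
  by_cases h0 : s ∈ S 0
  · rw [indicator_of_mem h0, transition_apply]
    have h1 := lintegral_step hΔ hs fun q : State d × (Fin d → ℝ) =>
      (orbit E Δ q.1 ⁻¹' rect n fun i => S (i + 1)).indicator 1 q.2
    have h2 : ∀ t : State d, ∫⁻ y, (orbit E Δ t ⁻¹' rect n fun i => S (i + 1)).indicator 1 y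
        ∂(t.1 : Measure (Fin d → ℝ)) = orbitLaw E Δ t (rect n fun i => S (i + 1)) := by
      intro t
      rw [lintegral_indicator_one (measurable_orbit hΔ t hm'), orbitLaw,
        Measure.map_apply (measurable_orbit hΔ t) hm']
    simp only [h2] at h1
    rw [← h1, ← lintegral_indicator_one (measurable_orbit hΔ s hm)]
    refine lintegral_congr fun x => ?_
    by_cases hx : orbit E Δ s x ∈ rect (n + 1) S
    · have := ((hpre x).1 hx).2
      rw [indicator_of_mem (by exact hx), indicator_of_mem (by exact this)]
      rfl
    · have : orbit E Δ (step E Δ (s, x)).1 (step E Δ (s, x)).2 ∉ rect n fun i => S (i + 1) :=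
        fun h => hx ((hpre x).2 ⟨h0, h⟩)
      rw [indicator_of_notMem (by exact hx), indicator_of_notMem (by exact this)]
  · rw [indicator_of_notMem h0]
    have : orbit E Δ s ⁻¹' rect (n + 1) S = ∅ :=
      eq_empty_of_forall_notMem fun x hx => h0 ((hpre x).1 hx).1
    rw [this, measure_empty]

lemma isProbabilityMeasure_orbitLaw (hΔ : IsPartitionOperator E Δ) (s : State d) :
    IsProbabilityMeasure (orbitLaw E Δ s) :=
  Measure.isProbabilityMeasure_map (measurable_orbit hΔ s).aemeasurable

/-- Induction on the length of the cylinder by the one-step recursion `orbitLaw_rect_succ`.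
Measurability in the state is available only up to null sets, so it is carried along; the past event
`D` is there to absorb the first constraint of the cylinder at each step. -/
lemma IsCPChain.orbitLaw_rect (hΔ : IsPartitionOperator E Δ) (hP : IsCPChain E Δ P) (n : ℕ) :
    ∀ {S : ℕ → Set (State d)}, (∀ i, MeasurableSet (S i)) →
      AEMeasurable (fun s => orbitLaw E Δ s (rect n S)) (stateMarginal P) ∧
      ∀ (m : ℕ) (D : Set (ℕ → State d)),
        MeasurableSet[Filtration.piLE (X := fun _ : ℕ => State d) m] D →
        ∫⁻ ω in D, orbitLaw E Δ (ω m) (rect n S) ∂P = P (D ∩ {ω | ∀ i < n, ω (m + i) ∈ S i}) := by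
  have := hP.isProbabilityMeasure
  have hne : Nonempty (State d) := ⟨(P.nonempty_of_neZero).some 0⟩
  have hK : IsMarkovKernel (transitionKernel P) := by rw [transitionKernel]; infer_instance
  induction n with
  | zero =>
    intro S hS
    have h1 : ∀ s, orbitLaw E Δ s (rect 0 S) = 1 := fun s => by
      have := isProbabilityMeasure_orbitLaw hΔ s
      have h : rect 0 S = univ := by simp [rect]
      rw [h, measure_univ]
    simp [h1]
  | succ n ih =>
    intro S hS
    obtain ⟨hae, hint⟩ := ih fun i => hS (i + 1)
    set Q := fun s => orbitLaw E Δ s (rect n fun i => S (i + 1)) with hQ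
    obtain ⟨h, hhm, hQh_ae⟩ := hae
    have hbind : (stateMarginal P).bind (transitionKernel P) = stateMarginal P := by
      have h1 := hP.map_restrict_succ hΔ 0 (D := univ) MeasurableSet.univ
      rw [Measure.restrict_univ, hP.map_apply, hP.map_apply] at h1
      exact h1.symm
    -- The marginal is invariant under the kernel, so an exceptional null set of states is almost
    -- surely not reached in one step.
    have hK_ae : ∀ᵐ s ∂(stateMarginal P), ∀ᵐ t ∂(transitionKernel P s), Q t = h t := by
      refine Measure.ae_ae_of_ae_comp ?_
      rw [hbind]
      exact hQh_ae
    have heq : ∀ᵐ s ∂(stateMarginal P), orbitLaw E Δ s (rect (n + 1) S) =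
        (S 0).indicator (fun s => ∫⁻ t, h t ∂(transitionKernel P s)) s := by
      filter_upwards [hK_ae, hP.ae_isValid, hP.ae_transitionKernel_eq hΔ] with s h1 h2 h3
      rw [orbitLaw_rect_succ hΔ h2 n hS]
      by_cases h0 : s ∈ S 0
      · rw [indicator_of_mem h0, indicator_of_mem h0, ← h3]
        exact lintegral_congr_ae h1
      · rw [indicator_of_notMem h0, indicator_of_notMem h0]
    have hmeas : Measurable fun s => ∫⁻ t, h t ∂(transitionKernel P s) :=
      hhm.lintegral_kernel
    refine ⟨⟨_, hmeas.indicator (hS 0), heq⟩, fun m D hD => ?_⟩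
    have hDm : MeasurableSet D := Filtration.le _ m D hD
    have hpre : MeasurableSet[Filtration.piLE (X := fun _ : ℕ => State d) m]
        ((fun ω : ℕ → State d => ω m) ⁻¹' S 0) := by
      rw [Filtration.piLE_eq_comap_frestrictLe]
      exact ⟨(fun u : (Π _ : Finset.Iic m, State d) => u ⟨m, by simp⟩) ⁻¹' S 0,
        measurable_pi_apply (⟨m, by simp⟩ : Finset.Iic m) (hS 0), rfl⟩
    set D' := D ∩ (fun ω : ℕ → State d => ω m) ⁻¹' S 0 with hD'
    have hD'm : MeasurableSet[Filtration.piLE (X := fun _ : ℕ => State d) m] D' := hD.inter hpre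
    have heq' : ∀ᵐ ω ∂P, orbitLaw E Δ (ω m) (rect (n + 1) S) =
        (S 0).indicator (fun s => ∫⁻ t, h t ∂(transitionKernel P s)) (ω m) := by
      rw [← hP.map_apply m] at heq
      exact ae_of_ae_map (measurable_pi_apply m).aemeasurable heq
    have hQh : ∀ᵐ ω ∂P, Q (ω (m + 1)) = h (ω (m + 1)) := by
      rw [← hP.map_apply (m + 1)] at hQh_ae
      exact ae_of_ae_map (measurable_pi_apply _).aemeasurable hQh_ae
    calc ∫⁻ ω in D, orbitLaw E Δ (ω m) (rect (n + 1) S) ∂P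
        = ∫⁻ ω in D, ((fun ω : ℕ → State d => ω m) ⁻¹' S 0).indicator
            (fun ω => ∫⁻ t, h t ∂(transitionKernel P (ω m))) ω ∂P :=
          lintegral_congr_ae (ae_restrict_of_ae heq')
      _ = ∫⁻ ω in D', ∫⁻ t, h t ∂(transitionKernel P (ω m)) ∂P := by
          rw [lintegral_indicator (measurable_pi_apply m (hS 0)),
            Measure.restrict_restrict (measurable_pi_apply m (hS 0)), inter_comm]
      _ = ∫⁻ ω in D', h (ω (m + 1)) ∂P := by
          have h1 := hP.map_restrict_succ hΔ m hD'm
          have h2 : ∫⁻ t, h t ∂((P.restrict D').map fun ω => ω (m + 1)) =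
              ∫⁻ ω in D', h (ω (m + 1)) ∂P :=
            lintegral_map hhm (measurable_pi_apply _)
          rw [← h2, h1, Measure.lintegral_bind (transitionKernel P).measurable.aemeasurable
            hhm.aemeasurable, lintegral_map hmeas (measurable_pi_apply m)]
      _ = ∫⁻ ω in D', Q (ω (m + 1)) ∂P :=
          lintegral_congr_ae (ae_restrict_of_ae (hQh.mono fun _ h => h.symm))
      _ = P (D' ∩ {ω | ∀ i < n, ω (m + 1 + i) ∈ S (i + 1)}) :=
          hint (m + 1) D' (Filtration.mono _ (Nat.le_succ m) D' hD'm)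
      _ = P (D ∩ {ω | ∀ i < n + 1, ω (m + i) ∈ S i}) := by
          congr 1
          ext ω
          simp only [hD', mem_inter_iff, mem_preimage, mem_ofPred_eq]
          constructor
          · rintro ⟨⟨h1, h2⟩, h3⟩
            refine ⟨h1, fun i hi => ?_⟩
            cases i with
            | zero => exact h2
            | succ i => rw [← add_assoc, add_right_comm]; exact h3 i (by omega)
          · rintro ⟨h1, h2⟩
            refine ⟨⟨h1, h2 0 (by omega)⟩, fun i hi => ?_⟩
            rw [add_assoc, add_comm 1 i]
            exact h2 (i + 1) (by omega)

/-- The law of the process is obtained by choosing the initial state at random and magnifying it at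
a random point. -/
lemma IsCPChain.lintegral_orbitLaw (hΔ : IsPartitionOperator E Δ) (hP : IsCPChain E Δ P)
    {C : Set (ℕ → State d)} (hC : MeasurableSet C) :
    AEMeasurable (fun s => orbitLaw E Δ s C) (stateMarginal P) ∧
      ∫⁻ s, orbitLaw E Δ s C ∂(stateMarginal P) = P C := by
  have := hP.isProbabilityMeasure
  have := hP.isProbabilityMeasure_stateMarginal
  have hprob := isProbabilityMeasure_orbitLaw (E := E) hΔ
  induction C, hC using MeasurableSpace.induction_on_inter
    (generateFrom_squareCylinders (ι := ℕ) (α := fun _ => State d)).symm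
    (isPiSystem_squareCylinders (fun _ => MeasurableSpace.isPiSystem_measurableSet)
      fun _ => (MeasurableSet.univ : MeasurableSet (univ : Set (State d)))) with
  | empty => simp
  | basic t ht =>
    obtain ⟨s, S, hS, rfl⟩ := ht
    have hS' : ∀ i, MeasurableSet (S i) := fun i => hS i trivial
    classical
    let S' : ℕ → Set (State d) := fun i => if i ∈ s then S i else univ
    have hSm : ∀ i, MeasurableSet (S' i) := fun i => by
      simp only [S']
      split_ifs
      exacts [hS' i, MeasurableSet.univ]
    have hrect : (s : Set ℕ).pi S = rect (s.sup id + 1) S' := by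
      ext ω
      simp only [rect, S', Set.mem_pi, mem_ofPred_eq]
      constructor
      · intro h i _
        split_ifs with hi
        exacts [h i hi, trivial]
      · intro h i hi
        have h1 := h i (Nat.lt_succ_of_le (Finset.le_sup (f := id) hi))
        rwa [if_pos (by simpa using hi)] at h1
    rw [hrect]
    obtain ⟨h1, h2⟩ := hP.orbitLaw_rect hΔ (s.sup id + 1) hSm
    refine ⟨h1, ?_⟩
    have h3 := h2 0 univ MeasurableSet.univ
    simp only [Measure.restrict_univ, univ_inter, zero_add] at h3
    rw [stateMarginal, lintegral_map' h1 (measurable_pi_apply 0).aemeasurable, h3]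
    rfl
  | compl t ht ih =>
    have h : (fun s => orbitLaw E Δ s tᶜ) = fun s => 1 - orbitLaw E Δ s t := by
      funext s
      rw [prob_compl_eq_one_sub ht]
    rw [h]
    refine ⟨ih.1.const_sub 1, ?_⟩
    rw [lintegral_sub' ih.1, ih.2, prob_compl_eq_one_sub ht]
    · simp
    · rw [ih.2]; exact measure_ne_top _ _
    · exact Eventually.of_forall fun s => prob_le_one
  | iUnion f hd hf ih =>
    have h : (fun s => orbitLaw E Δ s (⋃ i, f i)) = fun s => ∑' i, orbitLaw E Δ s (f i) := by
      funext s
      rw [measure_iUnion hd hf]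
    rw [h]
    refine ⟨AEMeasurable.tsum fun i => (ih i).1, ?_⟩
    rw [lintegral_tsum fun i => (ih i).1, measure_iUnion hd hf]
    exact tsum_congr fun i => (ih i).2

/-- The bridge from sequences to measures: a property of almost every sequence holds along the
magnification of almost every state at almost every one of its points. A measurable null superset
handles arbitrary `p`; the converse `IsCPChain.ae_of_ae_ae_orbit` needs a measurable set. -/
lemma IsCPChain.ae_ae_orbit (hΔ : IsPartitionOperator E Δ) (hP : IsCPChain E Δ P)
    {p : (ℕ → State d) → Prop} (h : ∀ᵐ ω ∂P, p ω) :
    ∀ᵐ s ∂(stateMarginal P), ∀ᵐ x ∂(s.1 : Measure (Fin d → ℝ)), p (orbit E Δ s x) := by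
  obtain ⟨t, hsub, ht, ht0⟩ := exists_measurable_superset_of_null (ae_iff.1 h)
  obtain ⟨h1, h2⟩ := hP.lintegral_orbitLaw hΔ ht
  rw [ht0, lintegral_eq_zero_iff' h1] at h2
  filter_upwards [h2] with s hs
  rw [Pi.zero_apply, orbitLaw, Measure.map_apply (measurable_orbit hΔ s) ht] at hs
  filter_upwards [measure_eq_zero_iff_ae_notMem.1 hs] with x hx
  by_contra hc
  exact hx (hsub hc)

lemma IsCPChain.ae_of_ae_ae_orbit (hΔ : IsPartitionOperator E Δ) (hP : IsCPChain E Δ P)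
    {C : Set (ℕ → State d)} (hC : MeasurableSet C)
    (h : ∀ᵐ s ∂(stateMarginal P), ∀ᵐ x ∂(s.1 : Measure (Fin d → ℝ)), orbit E Δ s x ∈ C) :
    ∀ᵐ ω ∂P, ω ∈ C := by
  obtain ⟨h1, h2⟩ := hP.lintegral_orbitLaw hΔ hC.compl
  change P Cᶜ = 0
  rw [← h2, lintegral_eq_zero_iff' h1]
  filter_upwards [h] with s hs
  rw [Pi.zero_apply, orbitLaw, Measure.map_apply (measurable_orbit hΔ s) hC.compl]
  exact hs

lemma IsCPChain.ae_isAdmissible (hΔ : IsPartitionOperator E Δ) (hP : IsCPChain E Δ P) :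
    ∀ᵐ s ∂(stateMarginal P), IsAdmissible E Δ s := by
  filter_upwards [hP.ae_isValid, hP.ae_ae_orbit hΔ hP.mem_state] with s h1 h2
  refine ⟨h1, ?_⟩
  filter_upwards [h2] with x hx n using (hx n).2.1

end Law

/-! ### Scales and corners of the cells, and tame sequences. -/

section Frames
variable {d : ℕ}

/-- The scaling factor of the `n`-th magnification. -/
def frameScale (ω : ℕ → State d) (n : ℕ) : ℝ := ∏ i ∈ Finset.range n, (ω (i + 1)).2.scaleFactor

/-- The lower left corner of the `n`-th cell, in the coordinates of the initial state. -/
def frameOrigin (ω : ℕ → State d) : ℕ → Fin d → ℝ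
  | 0 => 0
  | n + 1 => frameOrigin ω n + (frameScale ω n)⁻¹ • (ω (n + 1)).2.lower

lemma frameScale_pos (ω : ℕ → State d) (n : ℕ) : 0 < frameScale ω n :=
  Finset.prod_pos fun _ _ => Box.scaleFactor_pos _

lemma frameScale_zero (ω : ℕ → State d) : frameScale ω 0 = 1 := by simp [frameScale]

lemma frameScale_succ (ω : ℕ → State d) (n : ℕ) :
    frameScale ω (n + 1) = frameScale ω n * (ω (n + 1)).2.scaleFactor :=
  Finset.prod_range_succ _ _

lemma frameScale_add (ω : ℕ → State d) (m n : ℕ) :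
    frameScale ω (m + n) = frameScale ω m * frameScale (shift^[m] ω) n := by
  simp only [frameScale, Finset.prod_range_add, shift_iterate]
  congr 1
  exact Finset.prod_congr rfl fun i _ => by rw [show m + i + 1 = i + 1 + m by omega]

lemma frameScale_congr {ω ω' : ℕ → State d} {n : ℕ} (h : ∀ i ≤ n, ω i = ω' i) :
    frameScale ω n = frameScale ω' n :=
  Finset.prod_congr rfl fun i hi => by rw [h (i + 1) (Finset.mem_range.1 hi)]

lemma frameOrigin_congr {ω ω' : ℕ → State d} {n : ℕ} (h : ∀ i ≤ n, ω i = ω' i) :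
    frameOrigin ω n = frameOrigin ω' n := by
  induction n with
  | zero => rfl
  | succ n ih =>
    rw [frameOrigin, frameOrigin, ih fun i hi => h i (by omega),
      frameScale_congr fun i hi => h i (by omega), h (n + 1) le_rfl]

lemma measurable_boxParams : Measurable (boxParams (d := d)) :=
  measurableEmbedding_boxParams.measurable

lemma measurable_lower : Measurable fun B : Box d => B.lower :=
  measurable_fst.comp measurable_boxParams

lemma measurable_upper : Measurable fun B : Box d => B.upper :=
  (measurable_fst.comp measurable_snd).comp measurable_boxParams

lemma measurable_scaleFactor : Measurable fun B : Box d => B.scaleFactor := by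
  have h : Measurable fun B : Box d => B.vol :=
    Finset.measurable_fun_prod _ fun i _ =>
      ((measurable_pi_apply i).comp measurable_upper).sub
        ((measurable_pi_apply i).comp measurable_lower)
  exact h.pow_const _

lemma measurable_box_apply (n : ℕ) : Measurable fun ω : ℕ → State d => (ω n).2 :=
  measurable_snd.comp (measurable_pi_apply n)

lemma measurable_frameScale (n : ℕ) : Measurable fun ω : ℕ → State d => frameScale ω n :=
  Finset.measurable_fun_prod _ fun _ _ => measurable_scaleFactor.comp (measurable_box_apply _)

lemma measurable_frameOrigin (n : ℕ) : Measurable fun ω : ℕ → State d => frameOrigin ω n := by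
  induction n with
  | zero => exact measurable_const
  | succ n ih =>
    exact ih.add ((measurable_frameScale n).inv.smul
      (measurable_lower.comp (measurable_box_apply _)))

variable {E : Set (Box d)} {Δ : Box d → Set (Box d)}

lemma orbit_shift (s : State d) (x : Fin d → ℝ) (n : ℕ) :
    shift^[n] (orbit E Δ s x) = orbit E Δ (orbit E Δ s x n) (orbitPt E Δ s x n) := by
  funext m
  rw [shift_iterate, add_comm, orbit_add]

lemma orbitPt_eq (s : State d) (x : Fin d → ℝ) (n : ℕ) :
    orbitPt E Δ s x n =
      frameScale (orbit E Δ s x) n • (x - frameOrigin (orbit E Δ s x) n) := by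
  induction n with
  | zero => simp [orbitPt_zero, frameScale, frameOrigin]
  | succ n ih =>
    rw [orbitPt_succ, ih, frameScale_succ, frameOrigin, Box.rescale]
    have h := (frameScale_pos (orbit E Δ s x) n).ne'
    funext i
    simp only [Pi.smul_apply, Pi.sub_apply, Pi.add_apply, smul_eq_mul]
    field_simp
    ring

lemma Box.homothety_homothety (B : Box d) {a a' : ℝ} (ha : 0 < a) (ha' : 0 < a')
    (b b' : Fin d → ℝ) :
    (B.homothety a ha b).homothety a' ha' b' =
      B.homothety (a' * a) (mul_pos ha' ha) (a' • b + b') := by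
  simp only [Box.homothety, Box.mk.injEq, and_true, Pi.add_apply, Pi.smul_apply, smul_eq_mul]
  constructor <;> funext i <;> ring

lemma Box.homothety_congr (B : Box d) {a a' : ℝ} (ha : 0 < a) (ha' : 0 < a')
    {b b' : Fin d → ℝ} (h : a = a') (h' : b = b') :
    B.homothety a ha b = B.homothety a' ha' b' := by
  subst h h'
  rfl

lemma Box.homothety_one_zero (B : Box d) : B.homothety 1 one_pos 0 = B := by
  simp [Box.homothety]

/-- The `n`-th cell, in the coordinates of the initial state. -/
def frameCell (ω : ℕ → State d) (n : ℕ) : Box d :=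
  (ω n).2.normalize.homothety (frameScale ω n)⁻¹ (inv_pos.2 (frameScale_pos ω n)) (frameOrigin ω n)

lemma frameCell_zero (ω : ℕ → State d) : frameCell ω 0 = (ω 0).2.normalize := by
  exact (Box.homothety_congr _ _ one_pos (by simp [frameScale]) rfl).trans
    (Box.homothety_one_zero _)

lemma frameCell_homothety (ω : ℕ → State d) (n : ℕ) :
    (frameCell ω n).homothety (frameScale ω n) (frameScale_pos ω n)
      (-(frameScale ω n • frameOrigin ω n)) = (ω n).2.normalize := by
  rw [frameCell, Box.homothety_homothety]
  conv_rhs => rw [← (ω n).2.normalize.homothety_one_zero]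
  exact Box.homothety_congr _ _ _ (mul_inv_cancel₀ (frameScale_pos ω n).ne') (by simp)

lemma frameCell_succ (ω : ℕ → State d) (n : ℕ) :
    frameCell ω (n + 1) = (ω (n + 1)).2.homothety (frameScale ω n)⁻¹
      (inv_pos.2 (frameScale_pos ω n)) (frameOrigin ω n) := by
  rw [frameCell, Box.normalize, Box.homothety_homothety]
  have h := (frameScale_pos ω n).ne'
  have h' := (ω (n + 1)).2.scaleFactor_pos.ne'
  refine Box.homothety_congr _ _ _ ?_ ?_
  · rw [frameScale_succ]
    field_simp
  · rw [frameScale_succ, frameOrigin]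
    funext i
    simp only [Pi.smul_apply, Pi.add_apply, Pi.neg_apply, smul_eq_mul]
    field_simp
    ring

/-- Invariance of the partition operator under homotheties undoes the normalization: the cells seen
in the coordinates of the initial state are nested cells of one iterated partition, so a single
regularity constant governs all of them. -/
lemma frameCell_succ_mem (hΔ : IsPartitionOperator E Δ) {ω : ℕ → State d} {n : ℕ}
    (h1 : (ω n).2.normalize ∈ E) (h2 : (ω (n + 1)).2 ∈ Δ (ω n).2.normalize)
    (h3 : frameCell ω n ∈ E) : frameCell ω (n + 1) ∈ Δ (frameCell ω n) := by
  have h := hΔ.invariant (frameCell ω n) h3 (frameScale ω n) (frameScale_pos ω n)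
    (-(frameScale ω n • frameOrigin ω n)) (by rwa [frameCell_homothety])
  rw [frameCell_homothety] at h
  rw [h] at h2
  obtain ⟨D, hD, hDeq⟩ := h2
  suffices frameCell ω (n + 1) = D by rwa [this]
  rw [frameCell_succ, ← hDeq]
  simp only
  rw [Box.homothety_homothety]
  conv_rhs => rw [← D.homothety_one_zero]
  exact Box.homothety_congr _ _ _ (inv_mul_cancel₀ (frameScale_pos ω n).ne')
    (by rw [smul_neg, smul_smul, inv_mul_cancel₀ (frameScale_pos ω n).ne', one_smul]; simp)

lemma frameCell_mem_iterate (hΔ : IsPartitionOperator E Δ) {ω : ℕ → State d}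
    (h1 : ∀ n, (ω n).2.normalize ∈ E) (h2 : ∀ n, (ω (n + 1)).2 ∈ Δ (ω n).2.normalize) (n : ℕ) :
    frameCell ω n ∈ iterate Δ n (ω 0).2.normalize ∧ frameCell ω n ∈ E := by
  induction n with
  | zero =>
    rw [frameCell_zero]
    exact ⟨rfl, h1 0⟩
  | succ n ih =>
    have h := frameCell_succ_mem hΔ (h1 n) (h2 n) ih.2
    exact ⟨mem_iUnion₂.2 ⟨_, ih.1, h⟩, hΔ.subset _ ih.2 h⟩

lemma two_mul_le_side {B : Box d} {x : Fin d → ℝ} {r : ℝ} (hr : 0 ≤ r)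
    (h : Metric.closedBall x r ⊆ B.toSet) (i : Fin d) : 2 * r ≤ B.upper i - B.lower i := by
  have h1 : (fun j => x j + r) ∈ B.toSet := h (by
    rw [Metric.mem_closedBall, dist_pi_le_iff hr]
    intro j
    simp [abs_of_nonneg hr])
  have h2 : (fun j => x j - r) ∈ B.toSet := h (by
    rw [Metric.mem_closedBall, dist_pi_le_iff hr]
    intro j
    simp [abs_of_nonneg hr])
  have h3 := Box.le_upper_of_mem h1 i
  have h4 := Box.lower_le_of_mem h2 i
  linarith

lemma side_le_two_mul {B : Box d} {x : Fin d → ℝ} {r : ℝ}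
    (h : B.toSet ⊆ Metric.closedBall x r) (i : Fin d) : B.upper i - B.lower i ≤ 2 * r := by
  by_contra! hlt
  have hside : ∀ j, 0 < B.upper j - B.lower j := fun j => sub_pos.2 (B.lower_lt_upper j)
  have hmem : ∀ t : ℝ, 0 < t → t < 1 →
      (fun j => B.lower j + t * (B.upper j - B.lower j)) ∈ B.toSet := fun t h0 h1 =>
    Box.mem_of_lt (fun j => by nlinarith [hside j]) fun j => by nlinarith [hside j]
  have hr : 0 ≤ r := by
    have h1 := h (hmem 2⁻¹ (by norm_num) (by norm_num))
    exact dist_nonneg.trans (Metric.mem_closedBall.1 h1)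
  set L := B.upper i - B.lower i with hL
  have hL0 : 0 < L := hside i
  -- The box may be open, so instead of its faces two points at relative positions `t` and `1 - t`
  -- are used; for this `t` they are still more than `2 * r` apart.
  set t := (L - 2 * r) / (4 * L) with ht
  have ht0 : 0 < t := by apply div_pos <;> linarith
  have ht1 : t < 1 := by rw [ht, div_lt_one (by linarith)]; linarith
  have htL : t * L = (L - 2 * r) / 4 := by rw [ht]; field_simp
  have h1 := (dist_le_pi_dist _ _ i).trans (Metric.mem_closedBall.1 (h (hmem t ht0 ht1)))
  have h2 := (dist_le_pi_dist _ _ i).trans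
    (Metric.mem_closedBall.1 (h (hmem (1 - t) (by linarith) (by linarith))))
  rw [Real.dist_eq, abs_le] at h1 h2
  nlinarith [h1.1, h1.2, h2.1, h2.2]

lemma normalize_lower (B : Box d) (i : Fin d) : B.normalize.lower i = 0 := by
  simp [Box.normalize, Box.homothety]

lemma vol_normalize (hd : 0 < d) (B : Box d) : B.normalize.vol = 1 := by
  have h : B.normalize.vol = B.scaleFactor ^ d * B.vol := by
    simp only [Box.vol, Box.normalize, Box.homothety]
    rw [show B.scaleFactor ^ d = ∏ _i : Fin d, B.scaleFactor by simp, ← Finset.prod_mul_distrib]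
    exact Finset.prod_congr rfl fun i _ => by ring
  rw [h, Box.scaleFactor, ← Real.rpow_natCast, ← Real.rpow_mul B.vol_pos.le]
  rw [neg_mul, inv_mul_cancel₀ (by positivity), Real.rpow_neg_one, inv_mul_cancel₀ B.vol_pos.ne']

lemma frameCell_side (ω : ℕ → State d) (n : ℕ) (i : Fin d) :
    (ω n).2.normalize.upper i =
      frameScale ω n * ((frameCell ω n).upper i - (frameCell ω n).lower i) := by
  have h := (frameScale_pos ω n).ne'
  simp only [frameCell, Box.homothety, normalize_lower]
  field_simp
  simp only [Box.normalize, Box.homothety]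
  ring

/-- All magnifications along `ω` have boxes with side lengths at most `M`, and scale like the powers
of `ρ⁻¹` up to the factor `M`. -/
def IsTame (ρ M : ℝ) (ω : ℕ → State d) : Prop :=
  (∀ n i, (ω n).2.normalize.upper i ≤ M) ∧
    ∀ n m, M⁻¹ ≤ ρ ^ m * frameScale (shift^[n] ω) m ∧ ρ ^ m * frameScale (shift^[n] ω) m ≤ M

lemma IsTame.shift {ρ M : ℝ} {ω : ℕ → State d} (h : IsTame ρ M ω) : IsTame ρ M (shift ω) :=
  ⟨fun n i => h.1 (n + 1) i, fun n m => by
    have := h.2 (n + 1) m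
    rwa [Function.iterate_succ_apply] at this⟩

lemma IsTame.iterate_shift {ρ M : ℝ} {ω : ℕ → State d} (h : IsTame ρ M ω) (n : ℕ) :
    IsTame ρ M (CP.shift^[n] ω) := by
  induction n with
  | zero => exact h
  | succ n ih =>
    rw [Function.iterate_succ_apply']
    exact ih.shift

lemma measurableSet_isTame (ρ M : ℝ) : MeasurableSet {ω : ℕ → State d | IsTame ρ M ω} := by
  have h1 : ∀ n i, Measurable fun ω : ℕ → State d => (ω n).2.normalize.upper i := by
    intro n i
    have : (fun ω : ℕ → State d => (ω n).2.normalize.upper i) = fun ω =>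
        (ω n).2.scaleFactor * (ω n).2.upper i - (ω n).2.scaleFactor * (ω n).2.lower i := by
      funext ω
      simp [Box.normalize, Box.homothety]
      ring
    rw [this]
    have hs := measurable_scaleFactor.comp (measurable_box_apply (d := d) n)
    have hu := (measurable_pi_apply i).comp (measurable_upper.comp (measurable_box_apply (d := d) n))
    have hl := (measurable_pi_apply i).comp (measurable_lower.comp (measurable_box_apply (d := d) n))
    exact (hs.mul hu).sub (hs.mul hl)
  have h2 : ∀ n m, Measurable fun ω : ℕ → State d => ρ ^ m * frameScale (CP.shift^[n] ω) m :=
    fun n m => ((measurable_frameScale m).comp (measurable_shift.iterate n)).const_mul _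
  refine MeasurableSet.inter (?_ : MeasurableSet {ω : ℕ → State d | ∀ n i, _})
    (?_ : MeasurableSet {ω : ℕ → State d | ∀ n m, _ ∧ _})
  · simp only [Set.ofPred_forall]
    exact MeasurableSet.iInter fun n => MeasurableSet.iInter fun i =>
      measurableSet_le (h1 n i) measurable_const
  · simp only [Set.ofPred_forall]
    exact MeasurableSet.iInter fun n => MeasurableSet.iInter fun m =>
      (measurableSet_le measurable_const (h2 n m)).inter
        (measurableSet_le (h2 n m) measurable_const)

lemma orbitPt_mem (hΔ : IsPartitionOperator E Δ) {s : State d} {x : Fin d → ℝ}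
    (h1 : ∀ n, (orbit E Δ s x n).2.normalize ∈ E) (hx : x ∈ s.2.normalize.toSet) (n : ℕ) :
    orbitPt E Δ s x n ∈ (orbit E Δ s x n).2.normalize.toSet := by
  induction n with
  | zero => exact hx
  | succ n ih =>
    rw [orbitPt_succ, Box.rescale_mem_normalize_iff, orbit_succ]
    exact (cell_mem hΔ (h1 n) ih).2

lemma orbit_succ_mem (hΔ : IsPartitionOperator E Δ) {s : State d} {x : Fin d → ℝ}
    (h1 : ∀ n, (orbit E Δ s x n).2.normalize ∈ E) (hx : x ∈ s.2.normalize.toSet) (n : ℕ) :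
    (orbit E Δ s x (n + 1)).2 ∈ Δ (orbit E Δ s x n).2.normalize := by
  rw [orbit_succ]
  exact (cell_mem hΔ (h1 n) (orbitPt_mem hΔ h1 hx n)).1

/-- Regularity makes the magnification of a state at a point tame. -/
lemma exists_isTame (hd : 0 < d) (hΔ : IsPartitionOperator E Δ) {ρ : ℝ} (hρ0 : 0 < ρ)
    (hreg : IsRegular E Δ ρ) {ω : ℕ → State d} (h1 : ∀ n, (ω n).2.normalize ∈ E)
    (h2 : ∀ n, (ω (n + 1)).2 ∈ Δ (ω n).2.normalize) : ∃ M : ℕ, IsTame ρ M ω := by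
  obtain ⟨C, hC1, hC⟩ := hreg _ (h1 0)
  have hC0 : 0 < C := by linarith
  have hside : ∀ n, 1 ≤ n → ∀ i, frameScale ω n * (2 * (ρ ^ n / C)) ≤ (ω n).2.normalize.upper i ∧
      (ω n).2.normalize.upper i ≤ frameScale ω n * (2 * (C * ρ ^ n)) := by
    intro n hn i
    obtain ⟨⟨x, hx⟩, ⟨y, hy⟩⟩ := hC n hn _ (frameCell_mem_iterate hΔ h1 h2 n).1
    rw [frameCell_side]
    have hS := frameScale_pos ω n
    exact ⟨mul_le_mul_of_nonneg_left (two_mul_le_side (by positivity) hx i) hS.le,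
      mul_le_mul_of_nonneg_left (side_le_two_mul hy i) hS.le⟩
  -- Unit volume turns the common bounds on all sides into bounds on the scaling factor itself.
  have hvol : ∀ n, ∏ i, (ω n).2.normalize.upper i = 1 := by
    intro n
    rw [← vol_normalize hd (ω n).2, Box.vol]
    exact Finset.prod_congr rfl fun i _ => by rw [normalize_lower, sub_zero]
  have hup : ∀ n i, 0 ≤ (ω n).2.normalize.upper i := fun n i => by
    have := (ω n).2.normalize.lower_lt_upper i
    rw [normalize_lower] at this
    exact this.le
  have hupper : ∀ n, 1 ≤ n → ρ ^ n * frameScale ω n ≤ C := by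
    intro n hn
    have hS := frameScale_pos ω n
    have h3 : (frameScale ω n * (2 * (ρ ^ n / C))) ^ d ≤ 1 := by
      rw [← hvol n]
      calc (frameScale ω n * (2 * (ρ ^ n / C))) ^ d
          = ∏ _i : Fin d, (frameScale ω n * (2 * (ρ ^ n / C))) := by simp
        _ ≤ _ := Finset.prod_le_prod (fun i _ => by positivity) fun i _ => (hside n hn i).1
    have h4 : frameScale ω n * (2 * (ρ ^ n / C)) ≤ 1 :=
      (pow_le_one_iff_of_nonneg (by positivity) hd.ne').1 h3
    have h5 : frameScale ω n * (2 * (ρ ^ n / C)) = 2 * (ρ ^ n * frameScale ω n) / C := by ring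
    rw [h5, div_le_one hC0] at h4
    have : 0 < ρ ^ n * frameScale ω n := by positivity
    linarith
  have hlower : ∀ n, 1 ≤ n → (2 * C)⁻¹ ≤ ρ ^ n * frameScale ω n := by
    intro n hn
    have hS := frameScale_pos ω n
    have h3 : 1 ≤ (frameScale ω n * (2 * (C * ρ ^ n))) ^ d := by
      rw [← hvol n]
      calc _ ≤ ∏ _i : Fin d, (frameScale ω n * (2 * (C * ρ ^ n))) :=
            Finset.prod_le_prod (fun i _ => hup n i) fun i _ => (hside n hn i).2
        _ = _ := by simp
    have h4 : 1 ≤ frameScale ω n * (2 * (C * ρ ^ n)) := by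
      by_contra! hlt
      exact absurd h3 (not_le.2 (pow_lt_one₀ (by positivity) hlt hd.ne'))
    rw [inv_le_iff_one_le_mul₀ (by positivity)]
    linarith
  have hlow' : ∀ n, (2 * C)⁻¹ ≤ ρ ^ n * frameScale ω n := by
    intro n
    rcases Nat.eq_zero_or_pos n with rfl | hn
    · rw [frameScale_zero, pow_zero, one_mul]
      exact inv_le_one_of_one_le₀ (by linarith)
    · exact hlower n hn
  have hup' : ∀ n, ρ ^ n * frameScale ω n ≤ C := by
    intro n
    rcases Nat.eq_zero_or_pos n with rfl | hn
    · rw [frameScale_zero, pow_zero, one_mul]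
      exact hC1.le
    · exact hupper n hn
  -- `2 * C * C` bounds the sides for `n ≥ 1` and the quotient of the scalings at two depths.
  -- Regularity says nothing about `n = 0`, so the sides of the initial box enter separately.
  obtain ⟨M, hM⟩ := exists_nat_ge (max (2 * C * C) (∑ i, (ω 0).2.normalize.upper i))
  have hM1 : 2 * C * C ≤ M := (le_max_left _ _).trans hM
  have hM2 : ∑ i, (ω 0).2.normalize.upper i ≤ M := (le_max_right _ _).trans hM
  refine ⟨M, fun n i => ?_, fun n m => ?_⟩
  · rcases Nat.eq_zero_or_pos n with rfl | hn
    · exact (Finset.single_le_sum (fun j _ => hup 0 j) (Finset.mem_univ i)).trans hM2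
    · refine ((hside n hn i).2).trans ?_
      have := hupper n hn
      nlinarith
  · have h3 := hlow' n
    have h4 := hup' n
    have h5 := hlow' (n + m)
    have h6 := hup' (n + m)
    have hadd : ρ ^ (n + m) * frameScale ω (n + m) =
        (ρ ^ n * frameScale ω n) * (ρ ^ m * frameScale (CP.shift^[n] ω) m) := by
      rw [frameScale_add, pow_add]; ring
    rw [hadd] at h5 h6
    have hSn := frameScale_pos ω n
    have hSm := frameScale_pos (CP.shift^[n] ω) m
    set a := ρ ^ n * frameScale ω n with ha
    set b := ρ ^ m * frameScale (CP.shift^[n] ω) m with hb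
    have ha0 : 0 < a := by positivity
    have hb0 : 0 < b := by positivity
    constructor
    · have h7 : (2 * C)⁻¹ ≤ C * b := h5.trans (by gcongr)
      have hM0 : (0 : ℝ) < M := by nlinarith
      rw [inv_le_iff_one_le_mul₀ (by positivity)] at h7 ⊢
      nlinarith
    · have h7 : (2 * C)⁻¹ * b ≤ C := le_trans (by gcongr) h6
      rw [inv_mul_le_iff₀ (by positivity)] at h7
      linarith

/-- Almost every sequence is tame, with a constant that does not depend on the sequence. -/
lemma IsCPChain.exists_ae_isTame {P : Measure (ℕ → State d)} (hd : 0 < d)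
    (hΔ : IsPartitionOperator E Δ) {ρ : ℝ} (hρ0 : 0 < ρ) (hreg : IsRegular E Δ ρ)
    (hP : IsCPChain E Δ P) (hergodic : Ergodic CP.shift P) :
    ∃ M : ℝ, 1 ≤ M ∧ ∀ᵐ ω ∂P, IsTame ρ M ω := by
  have := hP.isProbabilityMeasure
  let G : ℕ → Set (ℕ → State d) := fun M => {ω | IsTame ρ M ω}
  have hG : ∀ M, MeasurableSet (G M) := fun M => measurableSet_isTame ρ M
  have hU : ∀ᵐ ω ∂P, ω ∈ ⋃ M, G M := by
    refine hP.ae_of_ae_ae_orbit hΔ (MeasurableSet.iUnion hG) ?_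
    filter_upwards [hP.ae_isAdmissible hΔ] with s hs
    filter_upwards [hs.2, hs.1.ae_mem] with x hx hxm
    obtain ⟨M, hM⟩ := exists_isTame hd hΔ hρ0 hreg hx (orbit_succ_mem hΔ hx hxm)
    exact mem_iUnion.2 ⟨M, hM⟩
  obtain ⟨M, hM⟩ : ∃ M, P (G M) ≠ 0 := by
    by_contra! hcon
    have h0 := measure_iUnion_null hcon
    have h1 : ∀ᵐ ω ∂P, ω ∉ ⋃ M, G M := measure_eq_zero_iff_ae_notMem.1 h0
    obtain ⟨ω, h2, h3⟩ := (hU.and h1).exists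
    exact h3 h2
  -- Tameness with a fixed constant is inherited by the shifted sequence because it speaks of all
  -- starting times; ergodicity then gives it probability zero or one.
  have hsub : G M ⊆ CP.shift ⁻¹' G M := fun ω hω => IsTame.shift hω
  have hae : ∀ᵐ ω ∂P, ω ∈ G M := by
    rcases hergodic.ae_empty_or_univ_of_ae_le_preimage (hG M).nullMeasurableSet
      (LE.le.eventuallyLE hsub) with h | h
    · exact absurd (ae_eq_empty.1 h) hM
    · filter_upwards [h] with ω hω
      exact (iff_of_eq hω).2 trivial
  refine ⟨M, ?_, hae⟩
  obtain ⟨ω, hω⟩ := hae.exists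
  have h1 := (hω.2 0 0)
  rw [frameScale_zero, pow_zero, one_mul] at h1
  exact h1.2

end Frames

/-! ### The covering estimate. -/

section Cover
variable {k : ℕ} {α : Type*} [MeasurableSpace α]

/-- The number of grid cubes of side `r` needed to cover a ball of radius `K r` in `ℝ^k`. -/
def coverNumber (k : ℕ) (K : ℝ) : ℕ := (2 * ⌈K⌉₊ + 1) ^ k

lemma one_le_coverNumber (k : ℕ) (K : ℝ) : 1 ≤ coverNumber k K := Nat.one_le_pow _ _ (by omega)

/-- If `u x` dominates the mass of the points whose `Y`-value is `r`-close to `Y x`, then the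
integral of `1 / u` over the points whose `Y`-value lies in a ball of radius `K r` is bounded. -/
lemma lintegral_inv_le_coverNumber {μ : Measure α} [IsFiniteMeasure μ] {Y : α → Fin k → ℝ}
    (hY : Measurable Y) {u : α → ℝ≥0∞} {r K : ℝ} (hr : 0 < r)
    (hu : ∀ x, μ {x' | dist (Y x') (Y x) ≤ r} ≤ u x) (w : Fin k → ℝ) :
    ∫⁻ x, {x | dist (Y x) w ≤ K * r}.indicator (fun x => (u x)⁻¹) x ∂μ ≤ coverNumber k K := by
  set J : Finset (Fin k → ℤ) :=
    Fintype.piFinset fun _ => Finset.Icc (-(⌈K⌉₊ : ℤ)) ⌈K⌉₊ with hJ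
  have hcard : J.card = coverNumber k K := by
    rw [hJ, Fintype.card_piFinset_const, Int.card_Icc, coverNumber]
    congr 1
    omega
  let A : (Fin k → ℤ) → Set α := fun j => {x | gridIndex r (Y x - w) = j}
  have hA : ∀ j, MeasurableSet (A j) := fun j =>
    ((measurable_gridIndex r).comp (hY.sub_const w)) (measurableSet_singleton j)
  have hS : MeasurableSet {x | dist (Y x) w ≤ K * r} :=
    measurableSet_le (hY.dist measurable_const) measurable_const
  have hsub : {x | dist (Y x) w ≤ K * r} ⊆ ⋃ j ∈ J, A j := by
    intro x hx
    refine mem_iUnion₂.2 ⟨gridIndex r (Y x - w), Fintype.mem_piFinset.2 fun i => ?_, rfl⟩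
    have h1 : |Y x i - w i| ≤ K * r := (dist_le_pi_dist (Y x) w i).trans hx
    rw [abs_le] at h1
    have h2 : (Y x i - w i) / r ≤ K := (div_le_iff₀ hr).2 h1.2
    have h3 : -K ≤ (Y x i - w i) / r := (le_div_iff₀ hr).2 (by linarith [h1.1])
    have h4 := Nat.le_ceil K
    simp only [gridIndex, Pi.sub_apply, Finset.mem_Icc]
    constructor
    · refine Int.le_floor.2 ?_
      push_cast
      linarith
    · exact Int.floor_le_iff.2 (by push_cast; linarith)
  -- Points of one grid cell are mutually `r`-close, so `u` is at least the mass of the cell there,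
  -- and each cell contributes at most one.
  have hpiece : ∀ j, ∫⁻ x in A j, (u x)⁻¹ ∂μ ≤ 1 := by
    intro j
    calc ∫⁻ x in A j, (u x)⁻¹ ∂μ ≤ ∫⁻ _ in A j, (μ (A j))⁻¹ ∂μ := by
          refine setLIntegral_mono' (hA j) fun x hx => ENNReal.inv_le_inv.2 ?_
          refine le_trans (measure_mono fun x' hx' => ?_) (hu x)
          have := dist_le_of_gridIndex_eq hr (show gridIndex r (Y x' - w) = gridIndex r (Y x - w)
            from Eq.trans hx' (Eq.symm hx))
          rwa [dist_sub_right] at this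
      _ = (μ (A j))⁻¹ * μ (A j) := setLIntegral_const _ _
      _ ≤ 1 := ENNReal.inv_mul_le_one _
  calc _ = ∫⁻ x in {x | dist (Y x) w ≤ K * r}, (u x)⁻¹ ∂μ := lintegral_indicator hS _
    _ ≤ ∫⁻ x in ⋃ j : J, A j, (u x)⁻¹ ∂μ :=
        lintegral_mono_set (hsub.trans_eq (biUnion_eq_iUnion _ _))
    _ ≤ ∑' j : J, ∫⁻ x in A j, (u x)⁻¹ ∂μ := lintegral_iUnion_le _ _
    _ ≤ ∑' _j : J, 1 := ENNReal.tsum_le_tsum fun j => hpiece j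
    _ = coverNumber k K := by simp [hcard]

end Cover

/-! ### Tube masses and their exponents. -/

section Tube
variable {d k : ℕ} {E : Set (Box d)} {Δ : Box d → Set (Box d)}
  (π₀ : (Fin d → ℝ) →L[ℝ] (Fin k → ℝ)) (ρ R : ℝ)

/-- The mass that the initial measure gives to the tube over a ball whose radius is comparable to
`ρ^q` around the projection of the `q`-th cell, but at least `ρ^(q(k+1))`. -/
def tubeMass (q : ℕ) (ω : ℕ → State d) : ℝ≥0∞ :=
  max (((ω 0).1 : Measure (Fin d → ℝ)) {x | dist (π₀ x) (π₀ (frameOrigin ω q)) ≤ R * ρ ^ q})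
    (ENNReal.ofReal (ρ ^ (q * (k + 1))))

lemma measurable_tubeMass (q : ℕ) : Measurable (tubeMass (d := d) π₀ ρ R q) := by
  refine Measurable.max ?_ measurable_const
  let κ : Kernel (ℕ → State d) (Fin d → ℝ) :=
    ⟨fun ω => ((ω 0).1 : Measure (Fin d → ℝ)),
      measurable_subtype_coe.comp (measurable_fst.comp (measurable_pi_apply 0))⟩
  have : IsMarkovKernel κ := ⟨fun ω => inferInstanceAs
    (IsProbabilityMeasure ((ω 0).1 : Measure (Fin d → ℝ)))⟩
  have hS : MeasurableSet {p : (ℕ → State d) × (Fin d → ℝ) |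
      dist (π₀ p.2) (π₀ (frameOrigin p.1 q)) ≤ R * ρ ^ q} := by
    refine measurableSet_le (Measurable.dist ?_ ?_) measurable_const
    · exact π₀.continuous.measurable.comp measurable_snd
    · exact π₀.continuous.measurable.comp ((measurable_frameOrigin q).comp measurable_fst)
  exact Kernel.measurable_kernel_prodMk_left (κ := κ) hS

variable {π₀ ρ R}

lemma tubeMass_congr {q : ℕ} {ω ω' : ℕ → State d} (h : ∀ i ≤ q, ω i = ω' i) :
    tubeMass π₀ ρ R q ω = tubeMass π₀ ρ R q ω' := by
  rw [tubeMass, tubeMass, h 0 (by omega), frameOrigin_congr h]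

lemma tubeMass_pos (hρ : 0 < ρ) (q : ℕ) (ω : ℕ → State d) : tubeMass π₀ ρ R q ω ≠ 0 :=
  ne_of_gt (lt_max_of_lt_right (ENNReal.ofReal_pos.2 (by positivity)))

lemma tubeMass_le_one (hρ : 0 < ρ) (hρ1 : ρ < 1) (q : ℕ) (ω : ℕ → State d) :
    tubeMass π₀ ρ R q ω ≤ 1 :=
  max_le prob_le_one (ENNReal.ofReal_le_one.2 (pow_le_one₀ hρ.le hρ1.le))

lemma tubeMass_ne_top (hρ : 0 < ρ) (hρ1 : ρ < 1) (q : ℕ) (ω : ℕ → State d) :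
    tubeMass π₀ ρ R q ω ≠ ∞ := ((tubeMass_le_one hρ hρ1 q ω).trans_lt ENNReal.one_lt_top).ne

variable (π₀ ρ R) in
/-- The exponent of the tube mass. -/
def tubeExponent (q : ℕ) (ω : ℕ → State d) : ℝ :=
  -Real.log (tubeMass π₀ ρ R q ω).toReal / (q * Real.log ρ⁻¹)

lemma measurable_tubeExponent (q : ℕ) : Measurable (tubeExponent (d := d) π₀ ρ R q) :=
  ((Real.measurable_log.comp (measurable_tubeMass π₀ ρ R q).ennreal_toReal).neg).div_const _

lemma log_inv_pos (hρ : 0 < ρ) (hρ1 : ρ < 1) : 0 < Real.log ρ⁻¹ :=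
  Real.log_pos ((one_lt_inv₀ hρ).2 hρ1)

lemma tubeExponent_nonneg (hρ : 0 < ρ) (hρ1 : ρ < 1) (q : ℕ) (ω : ℕ → State d) :
    0 ≤ tubeExponent π₀ ρ R q ω := by
  refine div_nonneg (neg_nonneg.2 (Real.log_nonpos ENNReal.toReal_nonneg ?_))
    (mul_nonneg (Nat.cast_nonneg _) (log_inv_pos hρ hρ1).le)
  exact ENNReal.toReal_le_of_le_ofReal zero_le_one (by simpa using tubeMass_le_one hρ hρ1 q ω)

/-- The floor `ρ^(q(k+1))` in `tubeMass` serves this bound: the exponents become bounded functions,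
as the ergodic theorem and the integrals require. The value `k + 1` exceeds every dimension in the
target, so the floor loses nothing later. -/
lemma tubeExponent_le (hρ : 0 < ρ) (hρ1 : ρ < 1) (q : ℕ) (ω : ℕ → State d) :
    tubeExponent π₀ ρ R q ω ≤ k + 1 := by
  have hL := log_inv_pos hρ hρ1
  rcases Nat.eq_zero_or_pos q with rfl | hq
  · simp [tubeExponent]
    positivity
  · have hq' : (0 : ℝ) < q := Nat.cast_pos.2 hq
    rw [tubeExponent, div_le_iff₀ (by positivity)]
    have h1 : ρ ^ (q * (k + 1)) ≤ (tubeMass π₀ ρ R q ω).toReal := by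
      rw [← ENNReal.ofReal_le_iff_le_toReal (tubeMass_ne_top hρ hρ1 q ω)]
      exact le_max_right _ _
    have h2 := Real.log_le_log (by positivity) h1
    rw [Real.log_pow] at h2
    rw [Real.log_inv]
    push_cast at h2
    nlinarith

lemma tubeMass_eq_exp (hρ : 0 < ρ) (hρ1 : ρ < 1) {q : ℕ} (hq : 0 < q) (ω : ℕ → State d) :
    tubeMass π₀ ρ R q ω =
      ENNReal.ofReal (Real.exp (-(q * Real.log ρ⁻¹ * tubeExponent π₀ ρ R q ω))) := by
  have hL := log_inv_pos hρ hρ1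
  have hq' : (0 : ℝ) < q := Nat.cast_pos.2 hq
  have h0 : 0 < (tubeMass π₀ ρ R q ω).toReal :=
    ENNReal.toReal_pos (tubeMass_pos hρ q ω) (tubeMass_ne_top hρ hρ1 q ω)
  rw [tubeExponent, mul_div_cancel₀ _ (by positivity), neg_neg, Real.exp_log h0,
    ENNReal.ofReal_toReal (tubeMass_ne_top hρ hρ1 q ω)]

end Tube

/-! ### Distances and tube masses at tame points. -/

section Tame
variable {d k : ℕ} {E : Set (Box d)} {Δ : Box d → Set (Box d)} {ρ M : ℝ}

/-- The points of the state `s` whose magnification is well defined and tame. -/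
def tamePoints (E : Set (Box d)) (Δ : Box d → Set (Box d)) (ρ M : ℝ) (s : State d) :
    Set (Fin d → ℝ) :=
  {x | x ∈ s.2.normalize.toSet ∧ (∀ n, (orbit E Δ s x n).2.normalize ∈ E) ∧
    IsTame ρ M (orbit E Δ s x)}

/-- An admissible state almost all of whose points are tame. -/
def IsTameState (E : Set (Box d)) (Δ : Box d → Set (Box d)) (ρ M : ℝ) (s : State d) : Prop :=
  IsAdmissible E Δ s ∧ ∀ᵐ x ∂(s.1 : Measure (Fin d → ℝ)), x ∈ tamePoints E Δ ρ M s

lemma isTameState_of_ae {s : State d} (h : IsAdmissible E Δ s)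
    (h' : ∀ᵐ x ∂(s.1 : Measure (Fin d → ℝ)), IsTame ρ M (orbit E Δ s x)) :
    IsTameState E Δ ρ M s := by
  refine ⟨h, ?_⟩
  filter_upwards [h.1.ae_mem, h.2, h'] with x h1 h2 h3 using ⟨h1, h2, h3⟩

lemma IsTameState.ae_orbit (hΔ : IsPartitionOperator E Δ) {s : State d}
    (hs : IsTameState E Δ ρ M s) (n : ℕ) :
    ∀ᵐ x ∂(s.1 : Measure (Fin d → ℝ)), IsTameState E Δ ρ M (orbit E Δ s x n) := by
  have h := hs.1.ae_ae_orbit hΔ (fun p => IsTame ρ M (orbit E Δ p.1 p.2)) n (by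
    filter_upwards [hs.2] with x hx
    simpa only [← orbit_shift] using hx.2.2.iterate_shift n)
  filter_upwards [h] with x hx using isTameState_of_ae hx.1 hx.2

lemma inv_frameScale_le {ω : ℕ → State d} (hM : 1 ≤ M) (h : IsTame ρ M ω) (n : ℕ) :
    (frameScale ω n)⁻¹ ≤ M * ρ ^ n := by
  have h1 := (h.2 0 n).1
  have h2 := frameScale_pos ω n
  simp only [Function.iterate_zero, id_eq] at h1
  rw [inv_le_iff_one_le_mul₀ (by linarith)] at h1
  rw [inv_le_iff_one_le_mul₀ h2]
  linarith

lemma frameScale_mul_le {ω : ℕ → State d} (h : IsTame ρ M ω) (n : ℕ) :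
    frameScale ω n * ρ ^ n ≤ M := by
  have h1 := (h.2 0 n).2
  simp only [Function.iterate_zero, id_eq] at h1
  linarith

lemma eq_frameOrigin_add (s : State d) (x : Fin d → ℝ) (n : ℕ) :
    x = frameOrigin (orbit E Δ s x) n + (frameScale (orbit E Δ s x) n)⁻¹ • orbitPt E Δ s x n := by
  rw [orbitPt_eq, smul_smul, inv_mul_cancel₀ (frameScale_pos _ _).ne', one_smul, add_sub_cancel]

lemma tamePoints.orbitPt_apply_mem (hΔ : IsPartitionOperator E Δ) {s : State d} {x : Fin d → ℝ}
    (hx : x ∈ tamePoints E Δ ρ M s) (n : ℕ) (i : Fin d) :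
    0 ≤ orbitPt E Δ s x n i ∧ orbitPt E Δ s x n i ≤ M := by
  have h := orbitPt_mem hΔ hx.2.1 hx.1 n
  have h1 := Box.lower_le_of_mem h i
  rw [normalize_lower] at h1
  exact ⟨h1, (Box.le_upper_of_mem h i).trans (hx.2.2.1 n i)⟩

lemma tamePoints.dist_orbitPt_le (hΔ : IsPartitionOperator E Δ) (hM : 1 ≤ M) {s : State d}
    {x x' : Fin d → ℝ} (hx : x ∈ tamePoints E Δ ρ M s) (hx' : x' ∈ tamePoints E Δ ρ M s) (n : ℕ) :
    ‖orbitPt E Δ s x n - orbitPt E Δ s x' n‖ ≤ M := by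
  refine (pi_norm_le_iff_of_nonneg (by linarith)).2 fun i => ?_
  have h1 := orbitPt_apply_mem hΔ hx n i
  have h2 := orbitPt_apply_mem hΔ hx' n i
  rw [Pi.sub_apply, Real.norm_eq_abs, abs_le]
  constructor <;> linarith [h1.1, h1.2, h2.1, h2.2]

lemma tamePoints.norm_sub_frameOrigin_le (hΔ : IsPartitionOperator E Δ) (hρ : 0 < ρ) (hM : 1 ≤ M)
    {s : State d} {x : Fin d → ℝ} (hx : x ∈ tamePoints E Δ ρ M s) (n : ℕ) :
    ‖x - frameOrigin (orbit E Δ s x) n‖ ≤ M ^ 2 * ρ ^ n := by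
  have h1 := inv_frameScale_le hM hx.2.2 n
  have h2 : ‖orbitPt E Δ s x n‖ ≤ M := by
    refine (pi_norm_le_iff_of_nonneg (by linarith)).2 fun i => ?_
    have h1 := orbitPt_apply_mem hΔ hx n i
    rw [Real.norm_eq_abs, abs_of_nonneg h1.1]
    exact h1.2
  have h3 : x - frameOrigin (orbit E Δ s x) n =
      (frameScale (orbit E Δ s x) n)⁻¹ • orbitPt E Δ s x n :=
    sub_eq_iff_eq_add'.2 (eq_frameOrigin_add s x n)
  have h4 := inv_pos.2 (frameScale_pos (orbit E Δ s x) n)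
  rw [h3, norm_smul, Real.norm_of_nonneg h4.le]
  calc _ ≤ M * ρ ^ n * M := mul_le_mul h1 h2 (norm_nonneg _) (by positivity)
    _ = _ := by ring

lemma orbitPt_sub_orbitPt {s : State d} {x x' : Fin d → ℝ} {n : ℕ}
    (h : ∀ i ≤ n, orbit E Δ s x i = orbit E Δ s x' i) :
    orbitPt E Δ s x n - orbitPt E Δ s x' n = frameScale (orbit E Δ s x) n • (x - x') := by
  rw [orbitPt_eq, orbitPt_eq, frameScale_congr h, frameOrigin_congr h, ← smul_sub]
  congr 1
  abel

lemma tamePoints.frameScale_mul_norm_sub_le (hΔ : IsPartitionOperator E Δ) (hM : 1 ≤ M)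
    {s : State d} {x x' : Fin d → ℝ} (hx : x ∈ tamePoints E Δ ρ M s)
    (hx' : x' ∈ tamePoints E Δ ρ M s) {n : ℕ} (h : ∀ i ≤ n, orbit E Δ s x i = orbit E Δ s x' i) :
    frameScale (orbit E Δ s x) n * ‖x - x'‖ ≤ M := by
  have h1 := dist_orbitPt_le hΔ hM hx hx' n
  rwa [orbitPt_sub_orbitPt h, norm_smul, Real.norm_of_nonneg (frameScale_pos _ _).le] at h1

lemma tamePoints.norm_sub_le (hΔ : IsPartitionOperator E Δ) (hρ : 0 < ρ) (hM : 1 ≤ M)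
    {s : State d} {x x' : Fin d → ℝ} (hx : x ∈ tamePoints E Δ ρ M s)
    (hx' : x' ∈ tamePoints E Δ ρ M s) {n : ℕ} (h : ∀ i ≤ n, orbit E Δ s x i = orbit E Δ s x' i) :
    ‖x - x'‖ ≤ M ^ 2 * ρ ^ n := by
  have h1 := frameScale_mul_norm_sub_le hΔ hM hx hx' h
  have h2 := inv_frameScale_le hM hx.2.2 n
  have h3 := frameScale_pos (orbit E Δ s x) n
  calc ‖x - x'‖ = (frameScale (orbit E Δ s x) n)⁻¹ * (frameScale (orbit E Δ s x) n * ‖x - x'‖) := by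
        rw [inv_mul_cancel_left₀ h3.ne']
    _ ≤ M * ρ ^ n * M := mul_le_mul h2 h1 (by positivity) (by positivity)
    _ = _ := by ring

variable {π₀ : (Fin d → ℝ) →L[ℝ] (Fin k → ℝ)} {Λ : ℝ}

lemma dist_map_le (hΛ : ‖π₀‖ ≤ Λ) (x y : Fin d → ℝ) : dist (π₀ x) (π₀ y) ≤ Λ * ‖x - y‖ := by
  rw [dist_eq_norm, ← map_sub]
  exact (π₀.le_opNorm _).trans (by gcongr)

/-- This fixes the tube width `Λ * M ^ 2 + 1`: a tame point projects within `Λ * M ^ 2 * ρ ^ q` of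
the corner of its cell, so the tube contains almost all points whose corners project `ρ^q`-close. It
is the hypothesis of the covering estimate with the corners as the map. -/
lemma IsTameState.measure_le_tubeMass (hΔ : IsPartitionOperator E Δ) (hρ : 0 < ρ) (hM : 1 ≤ M)
    (hΛ : ‖π₀‖ ≤ Λ) {s : State d} (hs : IsTameState E Δ ρ M s) (q : ℕ) (x : Fin d → ℝ) :
    (s.1 : Measure (Fin d → ℝ)) {x' | dist (π₀ (frameOrigin (orbit E Δ s x') q))
      (π₀ (frameOrigin (orbit E Δ s x) q)) ≤ ρ ^ q} ≤
      tubeMass π₀ ρ (Λ * M ^ 2 + 1) q (orbit E Δ s x) := by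
  refine le_trans (measure_mono_ae ?_) (le_max_left _ _)
  filter_upwards [hs.2] with x' hx' hclose
  have h1 := tamePoints.norm_sub_frameOrigin_le hΔ hρ hM hx' q
  have h2 := dist_map_le hΛ x' (frameOrigin (orbit E Δ s x') q)
  have hΛ0 : 0 ≤ Λ := (norm_nonneg _).trans hΛ
  calc dist (π₀ x') (π₀ (frameOrigin (orbit E Δ s x) q))
      ≤ dist (π₀ x') (π₀ (frameOrigin (orbit E Δ s x') q)) + ρ ^ q :=
        (dist_triangle _ _ _).trans (by gcongr; exact hclose)
    _ ≤ Λ * (M ^ 2 * ρ ^ q) + ρ ^ q := by gcongr; exact h2.trans (by gcongr)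
    _ = _ := by ring

lemma measurable_frameOrigin_orbit (hΔ : IsPartitionOperator E Δ) (s : State d) (q : ℕ) :
    Measurable fun x => π₀ (frameOrigin (orbit E Δ s x) q) :=
  π₀.continuous.measurable.comp ((measurable_frameOrigin q).comp (measurable_orbit hΔ s))

lemma IsTameState.lintegral_inv_tubeMass_le (hΔ : IsPartitionOperator E Δ) (hρ : 0 < ρ)
    (hM : 1 ≤ M) (hΛ : ‖π₀‖ ≤ Λ) {s : State d} (hs : IsTameState E Δ ρ M s) (q : ℕ) (K : ℝ)
    (w : Fin k → ℝ) :
    ∫⁻ x, {x | dist (π₀ (frameOrigin (orbit E Δ s x) q)) w ≤ K * ρ ^ q}.indicator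
      (fun x => (tubeMass π₀ ρ (Λ * M ^ 2 + 1) q (orbit E Δ s x))⁻¹) x
      ∂(s.1 : Measure (Fin d → ℝ)) ≤ coverNumber k K :=
  lintegral_inv_le_coverNumber (measurable_frameOrigin_orbit hΔ s q) (by positivity)
    (hs.measure_le_tubeMass hΔ hρ hM hΛ q) w

end Tame

/-! ### Masses of image balls and products of tube masses. -/

section Iterate
variable {d k : ℕ} {E : Set (Box d)} {Δ : Box d → Set (Box d)}
  {π₀ : (Fin d → ℝ) →L[ℝ] (Fin k → ℝ)} {ρ M R Λ : ℝ}

lemma tamePoints.orbitPt_mem_tamePoints (hΔ : IsPartitionOperator E Δ) {s : State d}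
    {x : Fin d → ℝ} (hx : x ∈ tamePoints E Δ ρ M s) (n : ℕ) :
    orbitPt E Δ s x n ∈ tamePoints E Δ ρ M (orbit E Δ s x n) := by
  refine ⟨orbitPt_mem hΔ hx.2.1 hx.1 n, fun m => ?_, ?_⟩
  · rw [← orbit_add]
    exact hx.2.1 _
  · rw [← orbit_shift]
    exact hx.2.2.iterate_shift n

variable (π₀ ρ R) in
/-- The product of `N` tube masses along every `q`-th magnification, starting with the `n₀`-th. -/
def tubeProd (q n₀ N : ℕ) (ω : ℕ → State d) : ℝ≥0∞ :=
  ∏ i ∈ Finset.range N, tubeMass π₀ ρ R q (shift^[n₀ + q * i] ω)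

lemma tubeProd_congr {q n₀ N : ℕ} {ω ω' : ℕ → State d} (h : ∀ i ≤ n₀ + q * N, ω i = ω' i) :
    tubeProd π₀ ρ R q n₀ N ω = tubeProd π₀ ρ R q n₀ N ω' := by
  refine Finset.prod_congr rfl fun i hi => tubeMass_congr fun j hj => ?_
  rw [shift_iterate, shift_iterate]
  have h1 := Nat.mul_le_mul_left q (Nat.succ_le_of_lt (Finset.mem_range.1 hi))
  rw [Nat.mul_succ] at h1
  exact h _ (by omega)

lemma tubeProd_ne_zero (hρ : 0 < ρ) (q n₀ N : ℕ) (ω : ℕ → State d) :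
    tubeProd π₀ ρ R q n₀ N ω ≠ 0 :=
  Finset.prod_ne_zero_iff.2 fun _ _ => tubeMass_pos hρ q _

lemma tubeProd_ne_top (hρ : 0 < ρ) (hρ1 : ρ < 1) (q n₀ N : ℕ) (ω : ℕ → State d) :
    tubeProd π₀ ρ R q n₀ N ω ≠ ∞ :=
  ENNReal.prod_ne_top fun _ _ => tubeMass_ne_top hρ hρ1 q _

lemma measurable_tubeProd (q n₀ N : ℕ) : Measurable (tubeProd (d := d) π₀ ρ R q n₀ N) :=
  Finset.measurable_fun_prod _ fun _ _ =>
    (measurable_tubeMass π₀ ρ R q).comp (measurable_shift.iterate _)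

/-- The points of `G` whose first `n` magnifications are given by `ω` and whose image is `r`-close
to `z`. -/
def prefixPoints (E : Set (Box d)) (Δ : Box d → Set (Box d)) (s : State d) (G : Set (Fin d → ℝ))
    (g : (Fin d → ℝ) → Fin k → ℝ) (z : Fin k → ℝ) (r : ℝ) (n : ℕ) (ω : ℕ → State d) :
    Set (Fin d → ℝ) :=
  {x | x ∈ G ∧ (∀ i ≤ n, orbit E Δ s x i = ω i) ∧ dist (g x) z ≤ r}

lemma prefixPoints_congr {s : State d} {G : Set (Fin d → ℝ)}
    {g : (Fin d → ℝ) → Fin k → ℝ} {z : Fin k → ℝ} {r : ℝ} {n : ℕ} {ω ω' : ℕ → State d}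
    (h : ∀ i ≤ n, ω i = ω' i) :
    prefixPoints E Δ s G g z r n ω = prefixPoints E Δ s G g z r n ω' := by
  ext x
  simp only [prefixPoints, mem_ofPred_eq]
  refine and_congr_right fun _ => and_congr_left fun _ => forall₂_congr fun i hi => by rw [h i hi]

open Classical in
/-- The point `z` in the coordinates of a magnification by the factor `c`, computed from a
reference point chosen in `S`. -/
def magnifiedPoint (E : Set (Box d)) (Δ : Box d → Set (Box d)) (s : State d)
    (π₀ : (Fin d → ℝ) →L[ℝ] (Fin k → ℝ)) (g : (Fin d → ℝ) → Fin k → ℝ) (z : Fin k → ℝ) (n : ℕ)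
    (S : Set (Fin d → ℝ)) (c : ℝ) : Fin k → ℝ :=
  if h : S.Nonempty then π₀ (orbitPt E Δ s h.some n) + c • (z - g h.some) else 0

/-- After magnification of the `n`-th cell, the part of it that `g` sends near `z` lies close to a
single fibre of `π₀`. In the constant, `Λ * M ^ 2` is the distance from a point to the corner of its
cell `q` generations deeper, `M` is the magnified radius of the ball, and `1` is the magnified error
of replacing `g` by `π₀`. -/
lemma dist_magnifiedPoint_le (hΔ : IsPartitionOperator E Δ) (hρ : 0 < ρ) (hM : 1 ≤ M)
    (hΛ : ‖π₀‖ ≤ Λ) {s : State d} {G : Set (Fin d → ℝ)} (hG : G ⊆ tamePoints E Δ ρ M s)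
    {g : (Fin d → ℝ) → Fin k → ℝ} {q n : ℕ}
    (hlip : ∀ x ∈ G, ∀ x' ∈ G, (∀ i ≤ n, orbit E Δ s x i = orbit E Δ s x' i) →
      ‖(g x - g x') - π₀ (x - x')‖ ≤ ρ ^ q / M * ‖x - x'‖)
    {z : Fin k → ℝ} {r : ℝ} (hr : r ≤ ρ ^ (n + q)) {x x' : Fin d → ℝ}
    (hx' : x' ∈ prefixPoints E Δ s G g z r (n + q) (orbit E Δ s x)) :
    dist (π₀ (frameOrigin (orbit E Δ (orbit E Δ s x n) (orbitPt E Δ s x n)) q))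
      (magnifiedPoint E Δ s π₀ g z n (prefixPoints E Δ s G g z r n (orbit E Δ s x))
        (frameScale (orbit E Δ s x) n)) ≤ (Λ * M ^ 2 + M + 1) * ρ ^ q := by
  have hM0 : 0 < M := by linarith
  have hΛ0 : 0 ≤ Λ := (norm_nonneg _).trans hΛ
  have hne : (prefixPoints E Δ s G g z r n (orbit E Δ s x)).Nonempty :=
    ⟨x', hx'.1, fun i hi => hx'.2.1 i (by omega), hx'.2.2⟩
  rw [magnifiedPoint, dif_pos hne]
  obtain ⟨hy1, hy2, -⟩ := hne.some_mem
  set y := hne.some with hy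
  obtain ⟨hx1, hx2, hx3⟩ := hx'
  have hxn : ∀ i ≤ n, orbit E Δ s x' i = orbit E Δ s x i := fun i hi => hx2 i (by omega)
  have hxy : ∀ i ≤ n, orbit E Δ s x' i = orbit E Δ s y i := fun i hi => by
    rw [hxn i hi, hy2 i hi]
  have ha : frameOrigin (orbit E Δ (orbit E Δ s x n) (orbitPt E Δ s x n)) q =
      frameOrigin (orbit E Δ (orbit E Δ s x' n) (orbitPt E Δ s x' n)) q := by
    rw [← orbit_shift, ← orbit_shift]
    refine frameOrigin_congr fun i hi => ?_
    rw [shift_iterate, shift_iterate, hx2 _ (by omega)]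
  rw [ha]
  set a := frameOrigin (orbit E Δ (orbit E Δ s x' n) (orbitPt E Δ s x' n)) q
  have h1 : dist (π₀ (orbitPt E Δ s x' n)) (π₀ a) ≤ Λ * (M ^ 2 * ρ ^ q) :=
    (dist_map_le hΛ _ _).trans (mul_le_mul_of_nonneg_left
      (tamePoints.norm_sub_frameOrigin_le hΔ hρ hM
        (tamePoints.orbitPt_mem_tamePoints hΔ (hG hx1) n) q) hΛ0)
  have hS : frameScale (orbit E Δ s x) n = frameScale (orbit E Δ s x') n :=
    frameScale_congr fun i hi => (hxn i hi).symm
  rw [hS]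
  set c := frameScale (orbit E Δ s x') n with hc
  have hc0 : 0 < c := frameScale_pos _ _
  -- Both points are magnified by the same homothety since their prefixes agree, so only the scaled
  -- differences remain.
  have h2 : π₀ (orbitPt E Δ s x' n) - (π₀ (orbitPt E Δ s y n) + c • (z - g y)) =
      c • ((g x' - z) - ((g x' - g y) - π₀ (x' - y))) := by
    rw [← sub_sub, ← map_sub, orbitPt_sub_orbitPt hxy, map_smul, ← smul_sub]
    congr 1
    abel
  have h3 : c * ‖x' - y‖ ≤ M := tamePoints.frameScale_mul_norm_sub_le hΔ hM (hG hx1) (hG hy1) hxy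
  have h4 : c * ρ ^ n ≤ M := frameScale_mul_le (hG hx1).2.2 n
  have h5 : dist (π₀ (orbitPt E Δ s x' n)) (π₀ (orbitPt E Δ s y n) + c • (z - g y)) ≤
      (M + 1) * ρ ^ q := by
    rw [dist_eq_norm, h2, norm_smul, Real.norm_of_nonneg hc0.le]
    calc c * ‖(g x' - z) - ((g x' - g y) - π₀ (x' - y))‖
        ≤ c * (ρ ^ (n + q) + ρ ^ q / M * ‖x' - y‖) := by
          refine mul_le_mul_of_nonneg_left ((norm_sub_le _ _).trans (add_le_add ?_ ?_)) hc0.le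
          · rw [← dist_eq_norm]
            exact hx3.trans hr
          · exact hlip x' hx1 y hy1 hxy
      _ = c * ρ ^ n * ρ ^ q + ρ ^ q / M * (c * ‖x' - y‖) := by rw [pow_add]; ring
      _ ≤ M * ρ ^ q + ρ ^ q / M * M := by gcongr
      _ = _ := by field_simp
  calc _ ≤ dist (π₀ (orbitPt E Δ s x' n)) (π₀ a) +
        dist (π₀ (orbitPt E Δ s x' n)) (π₀ (orbitPt E Δ s y n) + c • (z - g y)) := by
        rw [dist_comm (π₀ (orbitPt E Δ s x' n)) (π₀ a)]
        exact dist_triangle _ _ _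
    _ ≤ Λ * (M ^ 2 * ρ ^ q) + (M + 1) * ρ ^ q := add_le_add h1 h5
    _ = _ := by ring

-- The main induction. If a point of `G` shares the first `n + q` magnifications of `x` and maps
-- near `z`, then a point shares the first `n`, and the corner reached after `q` further steps
-- projects near a centre determined by the first `n` states. Conditionally on those, the covering
-- estimate bounds the mean of the new inverse tube mass by `coverNumber`, so each block of `q`
-- generations costs one such factor.
open Classical in
lemma IsTameState.lintegral_prefixPoints_le (hΔ : IsPartitionOperator E Δ) (hρ : 0 < ρ)
    (hρ1 : ρ < 1) (hM : 1 ≤ M) (hΛ : ‖π₀‖ ≤ Λ) {s : State d} (hs : IsTameState E Δ ρ M s)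
    {G : Set (Fin d → ℝ)} (hG : G ⊆ tamePoints E Δ ρ M s) {g : (Fin d → ℝ) → Fin k → ℝ} {q m : ℕ}
    (hlip : ∀ x ∈ G, ∀ x' ∈ G, (∀ i ≤ m, orbit E Δ s x i = orbit E Δ s x' i) →
      ‖(g x - g x') - π₀ (x - x')‖ ≤ ρ ^ q / M * ‖x - x'‖)
    {n₀ : ℕ} (hn₀ : m ≤ n₀) (z : Fin k → ℝ) {r : ℝ} (N : ℕ) (hr : r ≤ ρ ^ (n₀ + q * N)) :
    ∫⁻ x, (if (prefixPoints E Δ s G g z r (n₀ + q * N) (orbit E Δ s x)).Nonempty then 1 else 0) *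
      (tubeProd π₀ ρ (Λ * M ^ 2 + 1) q n₀ N (orbit E Δ s x))⁻¹ ∂(s.1 : Measure (Fin d → ℝ)) ≤
      (coverNumber k (Λ * M ^ 2 + M + 1) : ℝ≥0∞) ^ N := by
  induction N with
  | zero =>
    calc _ ≤ ∫⁻ _, 1 ∂(s.1 : Measure (Fin d → ℝ)) := by
          refine lintegral_mono fun x => ?_
          simp only [tubeProd, Finset.range_zero, Finset.prod_empty, inv_one, mul_one]
          split_ifs <;> simp
      _ = _ := by simp
  | succ N ih =>
    set n := n₀ + q * N with hn
    have hn' : n₀ + q * (N + 1) = n + q := by rw [hn]; ring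
    rw [hn'] at hr ⊢
    have ih' := ih (hr.trans (pow_le_pow_of_le_one hρ.le hρ1.le (by omega)))
    let J : (ℕ → State d) → ℝ≥0∞ := fun ω =>
      (if (prefixPoints E Δ s G g z r n ω).Nonempty then 1 else 0) *
        (tubeProd π₀ ρ (Λ * M ^ 2 + 1) q n₀ N ω)⁻¹
    let w : (ℕ → State d) → Fin k → ℝ := fun ω =>
      magnifiedPoint E Δ s π₀ g z n (prefixPoints E Δ s G g z r n ω) (frameScale ω n)
    let H : State d → (Fin k → ℝ) → (Fin d → ℝ) → ℝ≥0∞ := fun t v y =>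
      {y | dist (π₀ (frameOrigin (orbit E Δ t y) q)) v ≤
        (Λ * M ^ 2 + M + 1) * ρ ^ q}.indicator
        (fun y => (tubeMass π₀ ρ (Λ * M ^ 2 + 1) q (orbit E Δ t y))⁻¹) y
    have hJtop : ∀ ω, J ω ≠ ∞ := fun ω => by
      refine ENNReal.mul_ne_top (by split_ifs <;> simp) ?_
      exact ENNReal.inv_ne_top.2 (tubeProd_ne_zero hρ _ _ _ _)
    -- The centre `w` is computed from a reference point chosen in `prefixPoints` rather than from
    -- `x`; this is what makes it a function of the past, as conditioning requires.
    have hF : ∀ ω ω' : ℕ → State d, (∀ i ≤ n, ω i = ω' i) →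
        (fun y => J ω * H (ω n) (w ω) y) = fun y => J ω' * H (ω' n) (w ω') y := by
      intro ω ω' h
      have hJ : J ω = J ω' := by
        simp only [J]
        rw [prefixPoints_congr h, tubeProd_congr h]
      have hw : w ω = w ω' := by
        simp only [w]
        rw [prefixPoints_congr h, frameScale_congr h]
      rw [hJ, hw, h n le_rfl]
    calc _ ≤ ∫⁻ x, J (orbit E Δ s x) * H (orbit E Δ s x n) (w (orbit E Δ s x))
          (orbitPt E Δ s x n) ∂(s.1 : Measure (Fin d → ℝ)) := by
          refine lintegral_mono fun x => ?_
          split_ifs with hne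
          · obtain ⟨x', hx'⟩ := hne
            have hne' : (prefixPoints E Δ s G g z r n (orbit E Δ s x)).Nonempty :=
              ⟨x', hx'.1, fun i hi => hx'.2.1 i (by omega), hx'.2.2⟩
            have hclose := dist_magnifiedPoint_le hΔ hρ hM hΛ hG (fun x hx x' hx' h =>
              hlip x hx x' hx' fun i hi => h i (by omega)) hr hx'
            have hmem : orbitPt E Δ s x n ∈ {y | dist (π₀ (frameOrigin
              (orbit E Δ (orbit E Δ s x n) y) q)) (w (orbit E Δ s x)) ≤
                (Λ * M ^ 2 + M + 1) * ρ ^ q} := hclose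
            simp only [J, H]
            rw [indicator_of_mem hmem, if_pos hne', one_mul, one_mul, ← orbit_shift, tubeProd,
              Finset.prod_range_succ, ← hn, ← tubeProd, ENNReal.mul_inv
                (Or.inl (tubeProd_ne_zero hρ _ _ _ _)) (Or.inr (tubeMass_pos hρ _ _))]
          · simp
      _ = ∫⁻ x, ∫⁻ y, J (orbit E Δ s x) * H (orbit E Δ s x n) (w (orbit E Δ s x)) y
            ∂((orbit E Δ s x n).1 : Measure (Fin d → ℝ)) ∂(s.1 : Measure (Fin d → ℝ)) :=
          hs.1.lintegral_orbitPt hΔ n (fun ω y => J ω * H (ω n) (w ω) y) hF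
      _ ≤ ∫⁻ x, J (orbit E Δ s x) * (coverNumber k (Λ * M ^ 2 + M + 1) : ℝ≥0∞)
            ∂(s.1 : Measure (Fin d → ℝ)) := by
          refine lintegral_mono_ae ?_
          filter_upwards [hs.ae_orbit hΔ n] with x hx
          rw [lintegral_const_mul' _ _ (hJtop _)]
          exact mul_le_mul' le_rfl (hx.lintegral_inv_tubeMass_le hΔ hρ hM hΛ q _ _)
      _ = (∫⁻ x, J (orbit E Δ s x) ∂(s.1 : Measure (Fin d → ℝ))) *
            (coverNumber k (Λ * M ^ 2 + M + 1) : ℝ≥0∞) :=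
          lintegral_mul_const' _ _ (ENNReal.natCast_ne_top _)
      _ ≤ _ := (mul_le_mul' ih' le_rfl).trans_eq (pow_succ _ _).symm

/-- By Tonelli, average first over the centre `x` with `x'` fixed. If `g x` is close to `g x'`, then
`x` itself witnesses that its prefix meets the preimage of the ball around `g x'`, and the main
induction applies with `z = g x'`. -/
lemma IsTameState.lintegral_closedBall_le (hΔ : IsPartitionOperator E Δ) (hρ : 0 < ρ)
    (hρ1 : ρ < 1) (hM : 1 ≤ M) (hΛ : ‖π₀‖ ≤ Λ) {s : State d} (hs : IsTameState E Δ ρ M s)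
    {G : Set (Fin d → ℝ)} (hGae : ∀ᵐ x ∂(s.1 : Measure (Fin d → ℝ)), x ∈ G)
    {g : (Fin d → ℝ) → Fin k → ℝ} (hg : Measurable g) {q m : ℕ}
    (hlip : ∀ x ∈ G, ∀ x' ∈ G, (∀ i ≤ m, orbit E Δ s x i = orbit E Δ s x' i) →
      ‖(g x - g x') - π₀ (x - x')‖ ≤ ρ ^ q / M * ‖x - x'‖) {n₀ : ℕ} (hn₀ : m ≤ n₀) (N : ℕ) :
    ∫⁻ x, (s.1 : Measure (Fin d → ℝ)).map g (Metric.closedBall (g x) (ρ ^ (n₀ + q * N))) *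
      (tubeProd π₀ ρ (Λ * M ^ 2 + 1) q n₀ N (orbit E Δ s x))⁻¹ ∂(s.1 : Measure (Fin d → ℝ)) ≤
      (coverNumber k (Λ * M ^ 2 + M + 1) : ℝ≥0∞) ^ N := by
  set r := ρ ^ (n₀ + q * N)
  set μ := (s.1 : Measure (Fin d → ℝ)) with hμ
  let W : (Fin d → ℝ) → ℝ≥0∞ := fun x =>
    (tubeProd π₀ ρ (Λ * M ^ 2 + 1) q n₀ N (orbit E Δ s x))⁻¹
  have hW : Measurable W := ((measurable_tubeProd q n₀ N).comp (measurable_orbit hΔ s)).inv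
  let S : Set ((Fin d → ℝ) × (Fin d → ℝ)) := {p | dist (g p.2) (g p.1) ≤ r}
  have hS : MeasurableSet S :=
    measurableSet_le ((hg.comp measurable_snd).dist (hg.comp measurable_fst)) measurable_const
  have hSx : ∀ x, MeasurableSet {x' | dist (g x') (g x) ≤ r} := fun x =>
    measurableSet_le (hg.dist measurable_const) measurable_const
  have h1 : ∀ x, μ.map g (Metric.closedBall (g x) r) * W x =
      ∫⁻ x', S.indicator 1 (x, x') * W x ∂μ := by
    intro x
    rw [Measure.map_apply hg Metric.isClosed_closedBall.measurableSet,
      lintegral_mul_const' _ _ (ENNReal.inv_ne_top.2 (tubeProd_ne_zero hρ _ _ _ _))]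
    congr 1
    rw [show g ⁻¹' Metric.closedBall (g x) r = {x' | dist (g x') (g x) ≤ r} from rfl,
      ← lintegral_indicator_one (hSx x)]
    rfl
  calc _ = ∫⁻ x, ∫⁻ x', S.indicator 1 (x, x') * W x ∂μ ∂μ := lintegral_congr h1
    _ = ∫⁻ x', ∫⁻ x, S.indicator 1 (x, x') * W x ∂μ ∂μ := by
        refine lintegral_lintegral_swap (Measurable.aemeasurable ?_)
        exact (measurable_one.indicator hS).mul (hW.comp measurable_fst)
    _ ≤ ∫⁻ _, (coverNumber k (Λ * M ^ 2 + M + 1) : ℝ≥0∞) ^ N ∂μ := by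
        refine lintegral_mono fun x' => ?_
        refine le_trans (lintegral_mono_ae ?_) (hs.lintegral_prefixPoints_le hΔ hρ hρ1 hM hΛ
          (G := G ∩ tamePoints E Δ ρ M s) inter_subset_right
          (fun x hx y hy => hlip x hx.1 y hy.1) hn₀ (g x') N le_rfl)
        filter_upwards [hGae, hs.2] with x hx1 hx2
        refine mul_le_mul' ?_ le_rfl
        by_cases hx : (x, x') ∈ S
        · rw [if_pos ⟨x, ⟨hx1, hx2⟩, fun _ _ => rfl, by rw [dist_comm]; exact hx⟩]
          exact indicator_le_self _ _ _
        · rw [indicator_of_notMem hx]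
          exact zero_le
    _ = _ := by simp [hμ]

/-- The additional factor `2^N` makes the normalized means summable. Their sum is therefore finite
almost everywhere and serves as `K`. -/
lemma IsTameState.ae_exists_closedBall_le (hΔ : IsPartitionOperator E Δ) (hρ : 0 < ρ)
    (hρ1 : ρ < 1) (hM : 1 ≤ M) (hΛ : ‖π₀‖ ≤ Λ) {s : State d} (hs : IsTameState E Δ ρ M s)
    {G : Set (Fin d → ℝ)} (hGae : ∀ᵐ x ∂(s.1 : Measure (Fin d → ℝ)), x ∈ G)
    {g : (Fin d → ℝ) → Fin k → ℝ} (hg : Measurable g) {q m : ℕ}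
    (hlip : ∀ x ∈ G, ∀ x' ∈ G, (∀ i ≤ m, orbit E Δ s x i = orbit E Δ s x' i) →
      ‖(g x - g x') - π₀ (x - x')‖ ≤ ρ ^ q / M * ‖x - x'‖) {n₀ : ℕ} (hn₀ : m ≤ n₀) :
    ∀ᵐ x ∂(s.1 : Measure (Fin d → ℝ)), ∃ K : ℝ≥0, ∀ N : ℕ,
      (s.1 : Measure (Fin d → ℝ)).map g (Metric.closedBall (g x) (ρ ^ (n₀ + q * N))) ≤
        K * (2 * coverNumber k (Λ * M ^ 2 + M + 1) : ℝ≥0∞) ^ N *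
          tubeProd π₀ ρ (Λ * M ^ 2 + 1) q n₀ N (orbit E Δ s x) := by
  set μ := (s.1 : Measure (Fin d → ℝ)) with hμ
  set C : ℝ≥0∞ := (coverNumber k (Λ * M ^ 2 + M + 1) : ℝ≥0∞) with hC
  have hC0 : C ≠ 0 := by
    rw [hC]
    exact_mod_cast Nat.one_le_iff_ne_zero.1 (one_le_coverNumber k _)
  have hCt : C ≠ ∞ := ENNReal.natCast_ne_top _
  have h2C0 : 2 * C ≠ 0 := mul_ne_zero (by simp) hC0
  have h2Ct : 2 * C ≠ ∞ := ENNReal.mul_ne_top (by simp) hCt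
  let f : ℕ → (Fin d → ℝ) → ℝ≥0∞ := fun N x =>
    ((2 * C) ^ N)⁻¹ * (μ.map g (Metric.closedBall (g x) (ρ ^ (n₀ + q * N))) *
      (tubeProd π₀ ρ (Λ * M ^ 2 + 1) q n₀ N (orbit E Δ s x))⁻¹)
  have hprob : IsProbabilityMeasure (μ.map g) := Measure.isProbabilityMeasure_map hg.aemeasurable
  have hf : ∀ N, Measurable (f N) := fun N =>
    (((measurable_measure_closedBall _ _).comp hg).mul
      ((measurable_tubeProd q n₀ N).comp (measurable_orbit hΔ s)).inv).const_mul _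
  have hsum : ∫⁻ x, ∑' N, f N x ∂μ ≠ ∞ := by
    rw [lintegral_tsum fun N => (hf N).aemeasurable]
    refine ne_top_of_le_ne_top (b := ∑' N : ℕ, (2⁻¹ : ℝ≥0∞) ^ N) ?_ ?_
    · rw [ENNReal.tsum_geometric, ENNReal.one_sub_inv_two, inv_inv]
      simp
    refine ENNReal.tsum_le_tsum fun N => ?_
    rw [lintegral_const_mul' _ _ (ENNReal.inv_ne_top.2 (pow_ne_zero _ h2C0))]
    calc _ ≤ ((2 * C) ^ N)⁻¹ * C ^ N := by
          gcongr
          exact hs.lintegral_closedBall_le hΔ hρ hρ1 hM hΛ hGae hg hlip hn₀ N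
      _ = _ := by
          rw [mul_pow, ENNReal.mul_inv (Or.inl (by simp)) (Or.inl (by simp)), mul_assoc,
            ENNReal.inv_mul_cancel (pow_ne_zero _ hC0) (ENNReal.pow_ne_top hCt), mul_one,
            ENNReal.inv_pow]
  filter_upwards [ae_lt_top (Measurable.tsum hf) hsum] with x hx
  refine ⟨(∑' N, f N x).toNNReal, fun N => ?_⟩
  rw [ENNReal.coe_toNNReal hx.ne]
  have h1 : f N x ≤ ∑' N, f N x := ENNReal.le_tsum N
  have hT0 := tubeProd_ne_zero (π₀ := π₀) (R := Λ * M ^ 2 + 1) hρ q n₀ N (orbit E Δ s x)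
  have hTt := tubeProd_ne_top (π₀ := π₀) (R := Λ * M ^ 2 + 1) hρ hρ1 q n₀ N (orbit E Δ s x)
  calc μ.map g (Metric.closedBall (g x) (ρ ^ (n₀ + q * N))) = f N x * (2 * C) ^ N *
        tubeProd π₀ ρ (Λ * M ^ 2 + 1) q n₀ N (orbit E Δ s x) := by
        simp only [f]
        set a := (2 * C) ^ N with ha
        have ha0 : a ≠ 0 := pow_ne_zero _ h2C0
        have hat : a ≠ ∞ := ENNReal.pow_ne_top h2Ct
        rw [mul_comm a⁻¹, mul_assoc _ a⁻¹, ENNReal.inv_mul_cancel ha0 hat, mul_one, mul_assoc,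
          ENNReal.inv_mul_cancel hT0 hTt, mul_one]
    _ ≤ _ := by gcongr

end Iterate

/-! ### Decay along progressions, averages and power bounds. -/

lemma sum_range_mul_eq_sum_sum (f : ℕ → ℝ) (q N : ℕ) :
    ∑ n ∈ Finset.range (q * N), f n =
      ∑ j ∈ Finset.range q, ∑ i ∈ Finset.range N, f (j + q * i) := by
  induction N with
  | zero => simp
  | succ N ih =>
    simp only [Finset.sum_range_succ, Finset.sum_add_distrib, ← ih]
    rw [Nat.mul_succ, Finset.sum_range_add]
    congr 1
    exact Finset.sum_congr rfl fun j _ => by rw [add_comm]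

/-- If `h` decays along every arithmetic progression of step `q` at a rate governed by the sums of
`f` along the progression, then it decays at a rate governed by the averages of `f`. -/
lemma exists_exp_decay {h f : ℕ → ℝ} (hh : Antitone h) (hh1 : ∀ n, h n ≤ 1) {F : ℝ}
    (hf0 : ∀ n, 0 ≤ f n) (hfF : ∀ n, f n ≤ F) {q m : ℕ} (hq : 0 < q) {L A c : ℝ} (hL : 0 < L)
    (hA : 1 ≤ A) (hc : 0 ≤ c)
    (hK : ∀ n₀, m ≤ n₀ → ∃ K : ℝ, 0 ≤ K ∧ ∀ N : ℕ, h (n₀ + q * N) ≤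
      K * A ^ N * Real.exp (-(q * L * ∑ i ∈ Finset.range N, f (n₀ + q * i))))
    (hB : ∀ᶠ N : ℕ in atTop, c * N ≤ ∑ n ∈ Finset.range N, f n) :
    ∃ K : ℝ, 1 ≤ K ∧ ∀ N : ℕ, h (m + q * (N + 1)) ≤
      K * (A ^ N * Real.exp (-(q * L * c * N))) := by
  have hF : 0 ≤ F := (hf0 0).trans (hfF 0)
  have hK' : ∀ j, ∃ K : ℝ, 0 ≤ K ∧ ∀ N : ℕ, h (m + j + q * N) ≤
      K * A ^ N * Real.exp (-(q * L * ∑ i ∈ Finset.range N, f (m + j + q * i))) :=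
    fun j => hK _ (Nat.le_add_right m j)
  choose K hK0 hKN using hK'
  obtain ⟨N₀, hN₀⟩ := eventually_atTop.1 hB
  set K₁ := ∑ j ∈ Finset.range q, K j with hK₁
  have hK₁0 : 0 ≤ K₁ := Finset.sum_nonneg fun j _ => hK0 j
  have hq' : (0 : ℝ) < q := Nat.cast_pos.2 hq
  have hqL : 0 ≤ q * L * c * N₀ := by positivity
  -- The second summand covers the finitely many `N` before the averages settle. The factor in the
  -- first pays for the initial `m` terms, which the progressions skip.
  refine ⟨K₁ * Real.exp (L * (m * F)) + Real.exp (q * L * c * N₀), ?_, fun N => ?_⟩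
  · have := Real.one_le_exp hqL
    have : 0 ≤ K₁ * Real.exp (L * (m * F)) := by positivity
    linarith
  have hAN : 1 ≤ A ^ N := one_le_pow₀ hA
  have hA0 : 0 < A ^ N := by positivity
  rcases lt_or_ge N N₀ with hN | hN
  · calc h (m + q * (N + 1)) ≤ 1 := hh1 _
      _ ≤ Real.exp (q * L * c * N₀) * (1 * Real.exp (-(q * L * c * N))) := by
          rw [one_mul, ← Real.exp_add]
          refine Real.one_le_exp ?_
          have : (N : ℝ) ≤ N₀ := by exact_mod_cast hN.le
          have : q * L * c * N ≤ q * L * c * N₀ := by gcongr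
          linarith
      _ ≤ _ := by
          gcongr
          have : 0 ≤ K₁ * Real.exp (L * (m * F)) := by positivity
          linarith
  · set T := ∑ n ∈ Finset.range (q * N), f (m + n) with hT
    have hTge : c * (q * N) - m * F ≤ T := by
      have h1 := hN₀ (m + q * N) (by nlinarith)
      rw [Finset.sum_range_add] at h1
      have h2 : ∑ n ∈ Finset.range m, f n ≤ m * F := by
        simpa using Finset.sum_le_card_nsmul (Finset.range m) f F fun n _ => hfF n
      push_cast at h1
      have : 0 ≤ c * m := by positivity
      linarith
    -- Some residue class modulo `q` has at least the average sum. It may change with `N`; since `j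
    -- < q` and `h` is antitone, evaluating `h` at `m + q * (N + 1)` covers all classes.
    obtain ⟨j, hj, hjT⟩ : ∃ j ∈ Finset.range q, T / q ≤ ∑ i ∈ Finset.range N, f (m + j + q * i) := by
      refine Finset.exists_le_of_sum_le (Finset.nonempty_range_iff.2 hq.ne') ?_
      rw [Finset.sum_const, Finset.card_range, nsmul_eq_mul, mul_div_cancel₀ _ hq'.ne', hT,
        sum_range_mul_eq_sum_sum]
      exact (Finset.sum_congr rfl fun j _ => Finset.sum_congr rfl fun i _ => by
        rw [add_assoc]).le
    have hjq := Finset.mem_range.1 hj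
    have hKj : K j ≤ K₁ := Finset.single_le_sum (fun j _ => hK0 j) hj
    rw [div_le_iff₀ hq'] at hjT
    calc h (m + q * (N + 1)) ≤ h (m + j + q * N) := hh (by rw [Nat.mul_succ]; omega)
      _ ≤ K j * A ^ N * Real.exp (-(q * L * ∑ i ∈ Finset.range N, f (m + j + q * i))) := hKN j N
      _ ≤ K₁ * A ^ N * Real.exp (L * (m * F) + -(q * L * c * N)) := by
          gcongr
          nlinarith
      _ = K₁ * Real.exp (L * (m * F)) * (A ^ N * Real.exp (-(q * L * c * N))) := by
          rw [Real.exp_add]; ring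
      _ ≤ _ := by
          gcongr
          have := Real.exp_pos (q * L * c * N₀)
          linarith

/-- Exponential decay of the mass of balls along the radii `ρ^(m + q(N + 1))` gives a power bound
for all radii. -/
lemma exists_le_rpow_of_exp_decay {φ : ℝ → ℝ} (hφ : Monotone φ) (hφ1 : ∀ r, φ r ≤ 1) {ρ : ℝ}
    (hρ : 0 < ρ) (hρ1 : ρ < 1) {q m : ℕ} (hq : 0 < q) {K b : ℝ} (hK : 1 ≤ K) (hb : 0 ≤ b)
    (h : ∀ N : ℕ, φ (ρ ^ (m + q * (N + 1))) ≤ K * Real.exp (-(q * Real.log ρ⁻¹ * b * N))) :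
    ∃ K' : ℝ, ∀ r : ℝ, 0 < r → r ≤ 1 → φ r ≤ K' * r ^ b := by
  set L := Real.log ρ⁻¹ with hL
  have hL0 : 0 < L := log_inv_pos hρ hρ1
  refine ⟨K * Real.exp (q * L * b * (m + 2)), fun r hr hr1 => ?_⟩
  obtain ⟨n, hn1, hn2⟩ := exists_nat_pow_near_of_lt_one hr hr1 (pow_pos hρ q)
    (pow_lt_one₀ hρ.le hρ1 hq.ne')
  set N := n - (m + 1) with hN
  have hNn : (n : ℝ) - (m + 1) ≤ N := by
    rw [hN, sub_le_iff_le_add]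
    exact_mod_cast (by omega : n ≤ n - (m + 1) + (m + 1))
  have h1 : φ r ≤ K * Real.exp (-(q * L * b * N)) := by
    rcases le_or_gt (m + 1) n with hmn | hmn
    · refine le_trans (hφ (hn2.trans ?_)) (h N)
      rw [← pow_mul]
      refine pow_le_pow_of_le_one hρ.le hρ1.le ?_
      have : m + 1 + N = n := by omega
      rw [← this]
      nlinarith
    · have : N = 0 := by omega
      rw [this]
      simpa using (hφ1 r).trans hK
  have h2 : -((n + 1) * (q * L)) < Real.log r := by
    have := Real.log_lt_log (by positivity) hn1
    rw [Real.log_pow, Real.log_pow] at this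
    rw [hL, Real.log_inv]
    push_cast at this
    linarith
  calc φ r ≤ K * Real.exp (-(q * L * b * N)) := h1
    _ ≤ K * Real.exp (q * L * b * (m + 2) + b * Real.log r) := by
        have hqLb : 0 ≤ q * L * b := by positivity
        have h3 := mul_le_mul_of_nonneg_left hNn hqLb
        have h4 := mul_le_mul_of_nonneg_left h2.le hb
        gcongr
        nlinarith
    _ = _ := by rw [Real.exp_add, Real.rpow_def_of_pos hr, mul_comm b]; ring

/-! ### From tube exponents to dimension. -/

section Lower
variable {d k : ℕ} {E : Set (Box d)} {Δ : Box d → Set (Box d)}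
  {π₀ : (Fin d → ℝ) →L[ℝ] (Fin k → ℝ)} {ρ M R Λ : ℝ}

lemma tubeProd_eq_exp (hρ : 0 < ρ) (hρ1 : ρ < 1) {q : ℕ} (hq : 0 < q) (n₀ N : ℕ)
    (ω : ℕ → State d) :
    tubeProd π₀ ρ R q n₀ N ω = ENNReal.ofReal (Real.exp (-(q * Real.log ρ⁻¹ *
      ∑ i ∈ Finset.range N, tubeExponent π₀ ρ R q (shift^[n₀ + q * i] ω)))) := by
  rw [Finset.mul_sum, ← Finset.sum_neg_distrib, Real.exp_sum,
    ENNReal.ofReal_prod_of_nonneg fun i _ => (Real.exp_pos _).le]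
  exact Finset.prod_congr rfl fun i _ => tubeMass_eq_exp hρ hρ1 hq _

/-- A lower bound for the dimension of the image of a tame state under a map that is close to `π₀`
at small scales, in terms of the averages of the exponents of the tube masses. -/
theorem IsTameState.le_lowerDim_map (hΔ : IsPartitionOperator E Δ) (hρ : 0 < ρ)
    (hρ1 : ρ < 1) (hM : 1 ≤ M) (hΛ : ‖π₀‖ ≤ Λ) {s : State d} (hs : IsTameState E Δ ρ M s)
    {G : Set (Fin d → ℝ)} (hGae : ∀ᵐ x ∂(s.1 : Measure (Fin d → ℝ)), x ∈ G)
    {g : (Fin d → ℝ) → Fin k → ℝ} (hg : Measurable g) {q m : ℕ} (hq : 0 < q)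
    (hlip : ∀ x ∈ G, ∀ x' ∈ G, (∀ i ≤ m, orbit E Δ s x i = orbit E Δ s x' i) →
      ‖(g x - g x') - π₀ (x - x')‖ ≤ ρ ^ q / M * ‖x - x'‖) {c : ℝ} (hc : 0 ≤ c)
    (hB : ∀ᵐ x ∂(s.1 : Measure (Fin d → ℝ)), ∀ᶠ N : ℕ in atTop,
      c * N ≤ birkhoffSum shift (tubeExponent π₀ ρ (Λ * M ^ 2 + 1) q) N (orbit E Δ s x))
    {b : ℝ≥0} (hb : b ≤ c - Real.log (2 * coverNumber k (Λ * M ^ 2 + M + 1)) /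
      (q * Real.log ρ⁻¹)) :
    (b : ℝ≥0∞) ≤ lowerDim ((s.1 : Measure (Fin d → ℝ)).map g) := by
  have hL := log_inv_pos hρ hρ1
  have hq' : (0 : ℝ) < q := Nat.cast_pos.2 hq
  set L := Real.log ρ⁻¹ with hLdef
  set A : ℝ := 2 * coverNumber k (Λ * M ^ 2 + M + 1) with hA
  have hA1 : 1 ≤ A := by
    have : (1 : ℝ) ≤ coverNumber k (Λ * M ^ 2 + M + 1) := by
      exact_mod_cast one_le_coverNumber k _
    linarith
  have hAe : (2 * coverNumber k (Λ * M ^ 2 + M + 1) : ℝ≥0∞) = ENNReal.ofReal A := by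
    rw [hA, ENNReal.ofReal_mul zero_le_two, ENNReal.ofReal_natCast]
    simp
  refine le_lowerDim_of_ae_closedBall_le hg.aemeasurable ?_
  -- All starting depths are treated outside one null set, because the choice of the progression in
  -- `exists_exp_decay` depends on the point and on `N`.
  have hall : ∀ᵐ x ∂(s.1 : Measure (Fin d → ℝ)), ∀ n₀, m ≤ n₀ → ∃ K : ℝ≥0, ∀ N : ℕ,
      (s.1 : Measure (Fin d → ℝ)).map g (Metric.closedBall (g x) (ρ ^ (n₀ + q * N))) ≤
        K * (2 * coverNumber k (Λ * M ^ 2 + M + 1) : ℝ≥0∞) ^ N *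
          tubeProd π₀ ρ (Λ * M ^ 2 + 1) q n₀ N (orbit E Δ s x) := by
    refine ae_all_iff.2 fun n₀ => ?_
    by_cases hn₀ : m ≤ n₀
    · filter_upwards [hs.ae_exists_closedBall_le hΔ hρ hρ1 hM hΛ hGae hg hlip hn₀] with x hx _
      exact hx
    · exact Eventually.of_forall fun x hx => absurd hx hn₀
  set ν := (s.1 : Measure (Fin d → ℝ)).map g with hν
  have hprob : IsProbabilityMeasure ν := Measure.isProbabilityMeasure_map hg.aemeasurable
  filter_upwards [hall, hB] with x hx hxB
  let φ : ℝ → ℝ := fun r => ν.real (Metric.closedBall (g x) r)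
  have hφ : Monotone φ := fun r r' hr => measureReal_mono (Metric.closedBall_subset_closedBall hr)
  have hφ1 : ∀ r, φ r ≤ 1 := fun r => measureReal_le_one
  obtain ⟨K, hK1, hK⟩ := exists_exp_decay (h := fun n => φ (ρ ^ n))
    (f := fun n => tubeExponent π₀ ρ (Λ * M ^ 2 + 1) q (shift^[n] (orbit E Δ s x)))
    (fun n n' hn => hφ (pow_le_pow_of_le_one hρ.le hρ1.le hn)) (fun n => hφ1 _)
    (fun n => tubeExponent_nonneg hρ hρ1 q _) (fun n => tubeExponent_le hρ hρ1 q _) (m := m) hq hL hA1 hc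
    (fun n₀ hn₀ => by
      obtain ⟨K, hK⟩ := hx n₀ hn₀
      refine ⟨K, K.coe_nonneg, fun N => ?_⟩
      have h1 := hK N
      rw [hAe, tubeProd_eq_exp hρ hρ1 hq, ← ENNReal.ofReal_coe_nnreal,
        ← ENNReal.ofReal_pow (by linarith), ← ENNReal.ofReal_mul K.coe_nonneg,
        ← ENNReal.ofReal_mul (by positivity)] at h1
      exact ENNReal.toReal_le_of_le_ofReal (by positivity) h1) hxB
  obtain ⟨K', hK'⟩ := exists_le_rpow_of_exp_decay hφ hφ1 hρ hρ1 (m := m) hq hK1 b.coe_nonneg (fun N => by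
    refine (hK N).trans ?_
    gcongr
    rw [← Real.exp_log (by positivity : 0 < A ^ N), ← Real.exp_add, Real.log_pow]
    gcongr
    have h1 : Real.log A ≤ (c - b) * (q * L) := by
      rw [← div_le_iff₀ (by positivity)]
      linarith
    have h2 : (0 : ℝ) ≤ N := Nat.cast_nonneg N
    change _ ≤ -(q * L * (b : ℝ) * N)
    nlinarith [mul_le_mul_of_nonneg_left h1 h2])
  refine ⟨K'.toNNReal, fun r hr hr1 => ?_⟩
  have h1 := hK' r hr hr1
  calc ν (Metric.closedBall (g x) r) = ENNReal.ofReal (φ r) := (ofReal_measureReal).symm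
    _ ≤ ENNReal.ofReal (K' * (r : ℝ) ^ (b : ℝ)) := ENNReal.ofReal_le_ofReal h1
    _ = _ := by
      rw [ENNReal.ofReal_mul' (by positivity), ENNReal.ofReal,
        ← ENNReal.ofReal_rpow_of_pos (by exact_mod_cast hr), ENNReal.ofReal_coe_nnreal]

end Lower

/-! ### C¹ perturbations of the projection. -/

section Smooth

/-- A `C¹` map whose derivative is bounded by `δ` on a compact set is `δ`-Lipschitz at small
scales on that set. -/
lemma exists_norm_sub_le_of_norm_fderiv_lt {X Y : Type*} [NormedAddCommGroup X] [NormedSpace ℝ X]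
    [NormedAddCommGroup Y] [NormedSpace ℝ Y] {K U : Set X} (hK : IsCompact K) (hU : IsOpen U)
    (hKU : K ⊆ U) {h : X → Y} (hh : ContDiffOn ℝ 1 h U) {δ : ℝ}
    (hδ : ∀ x ∈ K, ‖fderiv ℝ h x‖ < δ) :
    ∃ r > 0, ∀ x ∈ K, ∀ x' ∈ K, ‖x - x'‖ < r → ‖h x - h x'‖ ≤ δ * ‖x - x'‖ := by
  have hO : IsOpen (U ∩ (fun x => ‖fderiv ℝ h x‖) ⁻¹' Iio δ) :=
    (hh.continuousOn_fderiv_of_isOpen hU le_rfl).norm.isOpen_inter_preimage hU isOpen_Iio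
  obtain ⟨r, hr, hrO⟩ := hK.exists_thickening_subset_open hO fun x hx => ⟨hKU hx, hδ x hx⟩
  refine ⟨r, hr, fun x hx x' _ hxx' => ?_⟩
  have hball : Metric.ball x r ⊆ U ∩ (fun x => ‖fderiv ℝ h x‖) ⁻¹' Iio δ :=
    (Metric.ball_subset_thickening hx r).trans hrO
  rw [← norm_neg (h x - h x'), ← norm_neg (x - x'), neg_sub, neg_sub]
  refine (convex_ball x r).norm_image_sub_le_of_norm_fderiv_le (𝕜 := ℝ) (fun y hy => ?_)
    (fun y hy => (hball hy).2.le) (Metric.mem_ball_self hr) ?_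
  · exact (hh.contDiffAt (hU.mem_nhds (hball hy).1)).differentiableAt one_ne_zero
  · rw [Metric.mem_ball, dist_comm, dist_eq_norm]
    exact hxx'

variable {d k : ℕ}

/-- The linear part of the projection. -/
def projectionLinear (V : Submodule ℝ (EuclideanSpace ℝ (Fin d))) (φ : V ≃ᵃ[ℝ] (Fin k → ℝ)) :
    (Fin d → ℝ) →L[ℝ] (Fin k → ℝ) :=
  LinearMap.toContinuousLinearMap ((φ.linear : V →ₗ[ℝ] (Fin k → ℝ)) ∘ₗ
    (V.orthogonalProjectionOnto : EuclideanSpace ℝ (Fin d) →ₗ[ℝ] V) ∘ₗ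
    ((WithLp.linearEquiv 2 ℝ (Fin d → ℝ)).symm : (Fin d → ℝ) →ₗ[ℝ] EuclideanSpace ℝ (Fin d)))

lemma projection_eq (V : Submodule ℝ (EuclideanSpace ℝ (Fin d))) (φ : V ≃ᵃ[ℝ] (Fin k → ℝ))
    (x : Fin d → ℝ) : projection V φ x = projectionLinear V φ x + φ 0 := by
  have h := φ.map_vadd 0 (V.orthogonalProjectionOnto (WithLp.toLp 2 x))
  rw [vadd_eq_add, vadd_eq_add, add_zero] at h
  exact h

lemma projection_sub (V : Submodule ℝ (EuclideanSpace ℝ (Fin d))) (φ : V ≃ᵃ[ℝ] (Fin k → ℝ))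
    (x y : Fin d → ℝ) : projection V φ x - projection V φ y = projectionLinear V φ (x - y) := by
  rw [projection_eq, projection_eq, map_sub]
  abel

lemma isCompact_supp {μ : ProbabilityMeasure (Fin d → ℝ)} {B : Box d}
    (h : (μ : Measure (Fin d → ℝ)) B.toSetᶜ = 0) : IsCompact (supp μ) := by
  have hsub : supp μ ⊆ Icc B.lower B.upper :=
    Measure.support_subset_of_isClosed isClosed_Icc (by
      rw [mem_ae_iff]
      exact measure_mono_null (compl_subset_compl.2 fun x hx =>
        ⟨Box.lower_le_of_mem hx, Box.le_upper_of_mem hx⟩) h)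
  exact isCompact_Icc.of_isClosed_subset Measure.isClosed_support hsub

lemma C1Map.norm_fderiv_sub_lt {K : Set (Fin d → ℝ)} {g h : C1Map K k} {δ : ℝ}
    (hgh : edist g h < ENNReal.ofReal δ) {x : Fin d → ℝ} (hx : x ∈ K) :
    ‖fderiv ℝ (fun y => g.toFun y - h.toFun y) x‖ < δ := by
  have hd : ∀ f : C1Map K k, DifferentiableAt ℝ f.toFun x := fun f => by
    obtain ⟨U, hU, hKU, hf⟩ := f.contDiff
    exact (hf.contDiffAt (hU.mem_nhds (hKU hx))).differentiableAt one_ne_zero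
  have h1 : edist (fderiv ℝ g.toFun x) (fderiv ℝ h.toFun x) < ENNReal.ofReal δ :=
    lt_of_le_of_lt ((le_iSup₂ (f := fun x (_ : x ∈ K) =>
      edist (fderiv ℝ g.toFun x) (fderiv ℝ h.toFun x)) x hx).trans le_add_self) hgh
  rw [edist_dist, dist_eq_norm] at h1
  have h2 := fderiv_fun_sub (hd g) (hd h)
  rw [h2]
  exact (ENNReal.ofReal_lt_ofReal_iff_of_nonneg (norm_nonneg _)).1 h1

end Smooth

/-! ### Images of a single tame state. -/

section Image
variable {d k : ℕ} {E : Set (Box d)} {Δ : Box d → Set (Box d)} {ρ M Λ : ℝ}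
  {V : Submodule ℝ (EuclideanSpace ℝ (Fin d))} {φ : V ≃ᵃ[ℝ] (Fin k → ℝ)}

/-- The difference of `g` and the projection has derivative below `ρ ^ q / M` on the compact
support, hence this Lipschitz constant at small scales. The depth `m` after which cells are small
enough depends on `g`, but the dimension bound does not depend on `m`. -/
theorem IsTameState.le_lowerDimImage (hΔ : IsPartitionOperator E Δ) (hρ : 0 < ρ)
    (hρ1 : ρ < 1) (hM : 1 ≤ M) (hΛ : ‖projectionLinear V φ‖ ≤ Λ) {s : State d}
    (hs : IsTameState E Δ ρ M s) {q : ℕ} (hq : 0 < q) {c : ℝ} (hc : 0 ≤ c)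
    (hB : ∀ᵐ x ∂(s.1 : Measure (Fin d → ℝ)), ∀ᶠ N : ℕ in atTop, c * N ≤
      birkhoffSum shift (tubeExponent (projectionLinear V φ) ρ (Λ * M ^ 2 + 1) q) N
        (orbit E Δ s x))
    {b : ℝ≥0} (hb : b ≤ c - Real.log (2 * coverNumber k (Λ * M ^ 2 + M + 1)) /
      (q * Real.log ρ⁻¹))
    (g : C1Map (supp s.1) k)
    (hg : edist g (projectionC1 V φ (supp s.1)) < ENNReal.ofReal (ρ ^ q / M)) :
    (b : ℝ≥0∞) ≤ lowerDimImage s.1 g := by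
  obtain ⟨U, hU, hKU, hgU⟩ := g.contDiff
  obtain ⟨r, hr, hr'⟩ := exists_norm_sub_le_of_norm_fderiv_lt (isCompact_supp hs.1.1.2) hU hKU
    (hgU.sub (contDiff_projection V φ).contDiffOn) fun x hx => C1Map.norm_fderiv_sub_lt hg hx
  obtain ⟨m, hm⟩ := exists_pow_lt_of_lt_one (div_pos hr (by positivity : 0 < M ^ 2)) hρ1
  rw [lt_div_iff₀ (by positivity)] at hm
  have hsupp : ∀ᵐ x ∂(s.1 : Measure (Fin d → ℝ)), x ∈ supp s.1 := Measure.support_mem_ae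
  classical
  -- `g` is controlled only near the support; cutting it off outside `U` gives a measurable map with
  -- the same image measure.
  have hgm : Measurable (U.piecewise g.toFun 0) :=
    hgU.continuousOn.measurable_piecewise continuousOn_const hU.measurableSet
  have hae : g.toFun =ᵐ[(s.1 : Measure (Fin d → ℝ))] U.piecewise g.toFun 0 := by
    filter_upwards [hsupp] with x hx
    rw [piecewise_eq_of_mem _ _ _ (hKU hx)]
  rw [lowerDimImage, Measure.map_congr hae]
  refine hs.le_lowerDim_map hΔ hρ hρ1 hM hΛ (G := supp s.1 ∩ tamePoints E Δ ρ M s) (m := m)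
    (hsupp.and hs.2) hgm hq (fun x hx x' hx' hxx' => ?_) hc hB hb
  rw [piecewise_eq_of_mem _ _ _ (hKU hx.1), piecewise_eq_of_mem _ _ _ (hKU hx'.1),
    ← projection_sub V φ, sub_sub_sub_comm]
  refine hr' x hx.1 x' hx'.1 (lt_of_le_of_lt
    (tamePoints.norm_sub_le hΔ hρ hM hx.2 hx'.2 hxx') ?_)
  linarith

/-- The exponents of the tube masses are eventually at least the dimension of the projection. -/
lemma IsTameState.eventually_le_tubeExponent (hΔ : IsPartitionOperator E Δ) (hρ : 0 < ρ)
    (hρ1 : ρ < 1) (hM : 1 ≤ M) (hΛ : ‖projectionLinear V φ‖ ≤ Λ) {s : State d}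
    (hs : IsTameState E Δ ρ M s) {b : ℝ≥0}
    (hb : (b : ℝ≥0∞) < lowerDim ((s.1 : Measure (Fin d → ℝ)).map (projection V φ))) :
    ∀ᵐ x ∂(s.1 : Measure (Fin d → ℝ)), ∀ᶠ q : ℕ in atTop,
      (b : ℝ) ≤ tubeExponent (projectionLinear V φ) ρ (Λ * M ^ 2 + 1) q (orbit E Δ s x) := by
  have hΛ0 : 0 ≤ Λ := (norm_nonneg _).trans hΛ
  have hL := log_inv_pos hρ hρ1
  have hmeas : Measurable (projection V φ) := (contDiff_projection V φ).continuous.measurable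
  set ν := (s.1 : Measure (Fin d → ℝ)).map (projection V φ) with hν
  have hprob : IsProbabilityMeasure ν := Measure.isProbabilityMeasure_map hmeas.aemeasurable
  have hbk : (b : ℝ) ≤ k := by
    have := (hb.trans_le (lowerDim_le ν)).le
    exact_mod_cast this
  lift ρ to ℝ≥0 using hρ.le
  -- The width of the tube plus the distance from the projection of `x` to that of the corner of its
  -- cell, in units of `ρ^q`.
  obtain ⟨C, hC⟩ : ∃ C : ℝ≥0, (C : ℝ) = Λ * M ^ 2 + 1 + Λ * M ^ 2 := ⟨⟨_, by positivity⟩, rfl⟩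
  have hC0 : 0 < C := by
    rw [← NNReal.coe_pos, hC]
    positivity
  have h1 := ae_of_ae_map hmeas.aemeasurable
    (ae_eventually_closedBall_le ν (by exact_mod_cast hρ) (by exact_mod_cast hρ1) hC0 hb)
  filter_upwards [h1, hs.2] with x hx1 hx2
  filter_upwards [hx1, eventually_gt_atTop 0] with q hq hq0
  have hq' : (0 : ℝ) < q := Nat.cast_pos.2 hq0
  have hsub : {x' | dist (projectionLinear V φ x')
      (projectionLinear V φ (frameOrigin (orbit E Δ s x) q)) ≤ (Λ * M ^ 2 + 1) * (ρ : ℝ) ^ q} ⊆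
      projection V φ ⁻¹' Metric.closedBall (projection V φ x) (C * ρ ^ q : ℝ≥0) := by
    intro x' hx'
    have h2 := (dist_map_le hΛ x (frameOrigin (orbit E Δ s x) q)).trans
      (mul_le_mul_of_nonneg_left (tamePoints.norm_sub_frameOrigin_le hΔ hρ hM hx2 q) hΛ0)
    have h3 : dist (projection V φ x') (projection V φ x) =
        dist (projectionLinear V φ x') (projectionLinear V φ x) := by
      rw [projection_eq, projection_eq, dist_add_right]
    rw [mem_preimage, Metric.mem_closedBall, h3]
    push_cast
    rw [hC]
    calc _ ≤ _ := dist_triangle_right _ _ _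
      _ ≤ (Λ * M ^ 2 + 1) * (ρ : ℝ) ^ q + Λ * (M ^ 2 * (ρ : ℝ) ^ q) := add_le_add hx' h2
      _ = _ := by ring
  have hle : tubeMass (projectionLinear V φ) ρ (Λ * M ^ 2 + 1) q (orbit E Δ s x) ≤
      ENNReal.ofReal (((ρ : ℝ) ^ q) ^ (b : ℝ)) := by
    refine max_le ?_ (ENNReal.ofReal_le_ofReal ?_)
    · refine (measure_mono hsub).trans ?_
      rw [← Measure.map_apply hmeas Metric.isClosed_closedBall.measurableSet]
      refine hq.trans_eq ?_
      rw [← ENNReal.ofReal_rpow_of_pos (by positivity), ENNReal.ofReal_pow hρ.le,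
        ENNReal.ofReal_coe_nnreal]
    · rw [pow_mul, ← Real.rpow_natCast _ (k + 1)]
      refine Real.rpow_le_rpow_of_exponent_ge (by positivity) (pow_le_one₀ hρ.le hρ1.le) ?_
      push_cast
      linarith
  have hle' := ENNReal.toReal_le_of_le_ofReal (by positivity) hle
  have hpos : 0 < (tubeMass (projectionLinear V φ) ρ (Λ * M ^ 2 + 1) q (orbit E Δ s x)).toReal :=
    ENNReal.toReal_pos (tubeMass_pos hρ q _) (tubeMass_ne_top hρ hρ1 q _)
  have hlog := Real.log_le_log hpos hle'
  rw [Real.log_rpow (by positivity), Real.log_pow] at hlog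
  rw [tubeExponent, le_div_iff₀ (by positivity), Real.log_inv]
  linarith

end Image

/-! ### The mean exponent and the uniform modulus. -/

section Final
variable {d k : ℕ} {E : Set (Box d)} {Δ : Box d → Set (Box d)} {ρ M Λ : ℝ}
  {V : Submodule ℝ (EuclideanSpace ℝ (Fin d))} {φ : V ≃ᵃ[ℝ] (Fin k → ℝ)}
  {P : Measure (ℕ → State d)}

lemma IsCPChain.ae_isTameState (hΔ : IsPartitionOperator E Δ) (hP : IsCPChain E Δ P)
    (hM : ∀ᵐ ω ∂P, IsTame ρ M ω) : ∀ᵐ s ∂(stateMarginal P), IsTameState E Δ ρ M s := by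
  filter_upwards [hP.ae_isAdmissible hΔ, hP.ae_ae_orbit hΔ hM] with s h1 h2
  exact isTameState_of_ae h1 h2

lemma integrable_tubeExponent [IsFiniteMeasure P] {π₀ : (Fin d → ℝ) →L[ℝ] (Fin k → ℝ)} {R : ℝ}
    (hρ : 0 < ρ) (hρ1 : ρ < 1) (q : ℕ) : Integrable (tubeExponent π₀ ρ R q) P :=
  Integrable.of_bound (measurable_tubeExponent q).aestronglyMeasurable (k + 1)
    (Eventually.of_forall fun ω => by
      rw [Real.norm_of_nonneg (tubeExponent_nonneg hρ hρ1 q ω)]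
      exact tubeExponent_le hρ hρ1 q ω)

lemma liminf_integral_tubeExponent_ne_top [IsProbabilityMeasure P]
    {π₀ : (Fin d → ℝ) →L[ℝ] (Fin k → ℝ)} {R : ℝ} (hρ : 0 < ρ) (hρ1 : ρ < 1) :
    liminf (fun q : ℕ => ENNReal.ofReal (∫ ω, tubeExponent π₀ ρ R q ω ∂P)) atTop ≠ ∞ := by
  refine ne_top_of_le_ne_top (b := ENNReal.ofReal (k + 1)) ENNReal.ofReal_ne_top
    (liminf_le_of_le (by isBoundedDefault) fun b hb => ?_)
  obtain ⟨q, hq⟩ := hb.exists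
  refine hq.trans (ENNReal.ofReal_le_ofReal ?_)
  calc _ ≤ ∫ _, ((k : ℝ) + 1) ∂P :=
        integral_mono (integrable_tubeExponent hρ hρ1 q) (integrable_const _)
          fun ω => tubeExponent_le hρ hρ1 q ω
    _ = _ := by simp

/-- Almost every state: all images under maps close to the projection have dimension at least the
mean exponent of the tube masses, up to an error that is small if `q` is large. -/
lemma IsCPChain.ae_le_lowerDimImage (hΔ : IsPartitionOperator E Δ) (hP : IsCPChain E Δ P)
    (hergodic : Ergodic shift P) (hρ : 0 < ρ) (hρ1 : ρ < 1) (hM : 1 ≤ M)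
    (hMP : ∀ᵐ ω ∂P, IsTame ρ M ω) (hΛ : ‖projectionLinear V φ‖ ≤ Λ) {q : ℕ} (hq : 0 < q)
    {η : ℝ} (hη : 0 < η) :
    ∀ᵐ s ∂(stateMarginal P), ∀ g : C1Map (supp s.1) k,
      edist g (projectionC1 V φ (supp s.1)) < ENNReal.ofReal (ρ ^ q / M) →
      ENNReal.ofReal ((∫ ω, tubeExponent (projectionLinear V φ) ρ (Λ * M ^ 2 + 1) q ω ∂P) - η -
        Real.log (2 * coverNumber k (Λ * M ^ 2 + M + 1)) / (q * Real.log ρ⁻¹)) ≤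
        lowerDimImage s.1 g := by
  have := hP.isProbabilityMeasure
  set I := ∫ ω, tubeExponent (projectionLinear V φ) ρ (Λ * M ^ 2 + 1) q ω ∂P with hI
  -- Truncation at zero because the dimension bound asks for a nonnegative rate; in that case
  -- nonnegativity of the exponents suffices.
  have hB : ∀ᵐ ω ∂P, ∀ᶠ N : ℕ in atTop, max (I - η) 0 * N ≤
      birkhoffSum shift (tubeExponent (projectionLinear V φ) ρ (Λ * M ^ 2 + 1) q) N ω := by
    rcases le_total (I - η) 0 with h | h
    · refine Eventually.of_forall fun ω => Eventually.of_forall fun N => ?_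
      rw [max_eq_right h, zero_mul]
      exact birkhoffSum_nonneg (fun ω => tubeExponent_nonneg hρ hρ1 q ω) N ω
    · rw [max_eq_left h]
      exact ergodic_eventually_le_birkhoffSum hergodic (measurable_tubeExponent q)
        (fun ω => tubeExponent_nonneg hρ hρ1 q ω) (fun ω => tubeExponent_le hρ hρ1 q ω)
        (by linarith)
  filter_upwards [hP.ae_isTameState hΔ hMP, hP.ae_ae_orbit hΔ hB] with s hs hsB g hg
  set t := I - η - Real.log (2 * coverNumber k (Λ * M ^ 2 + M + 1)) / (q * Real.log ρ⁻¹) with ht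
  rcases le_or_gt t 0 with h0 | h0
  · rw [ENNReal.ofReal_of_nonpos h0]
    exact zero_le
  · refine hs.le_lowerDimImage hΔ hρ hρ1 hM hΛ hq (le_max_right _ _) hsB (b := t.toNNReal) ?_ g hg
    rw [Real.coe_toNNReal _ h0.le]
    have := le_max_left (I - η) 0
    linarith

/-- The dimension of the projection is almost surely at most the lower limit of the mean exponents
of the tube masses. -/
lemma IsCPChain.ae_lowerDim_projection_le (hΔ : IsPartitionOperator E Δ) (hP : IsCPChain E Δ P)
    (hergodic : Ergodic shift P) (hρ : 0 < ρ) (hρ1 : ρ < 1) (hM : 1 ≤ M)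
    (hMP : ∀ᵐ ω ∂P, IsTame ρ M ω) (hΛ : ‖projectionLinear V φ‖ ≤ Λ) :
    ∀ᵐ s ∂(stateMarginal P), lowerDimImage s.1 (projectionC1 V φ (supp s.1)) ≤
      liminf (fun q : ℕ => ENNReal.ofReal
        (∫ ω, tubeExponent (projectionLinear V φ) ρ (Λ * M ^ 2 + 1) q ω ∂P)) atTop := by
  have := hP.isProbabilityMeasure
  set f : ℕ → (ℕ → State d) → ℝ := tubeExponent (projectionLinear V φ) ρ (Λ * M ^ 2 + 1) with hf
  set I : ℕ → ℝ := fun q => ∫ ω, f q ω ∂P with hI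
  set C := Real.log (2 * coverNumber k (Λ * M ^ 2 + M + 1)) / Real.log ρ⁻¹ with hC
  set D : (ℕ → State d) → ℝ≥0∞ := fun ω => liminf (fun q => ENNReal.ofReal (f q ω)) atTop with hD
  have hDm : Measurable D := Measurable.liminf fun q => (measurable_tubeExponent q).ennreal_ofReal
  have hint : ∀ q, ∫⁻ ω, ENNReal.ofReal (f q ω) ∂P = ENNReal.ofReal (I q) := fun q =>
    (ofReal_integral_eq_lintegral_ofReal (integrable_tubeExponent hρ hρ1 q)
      (Eventually.of_forall fun ω => tubeExponent_nonneg hρ hρ1 q ω)).symm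
  have hFatou : ∫⁻ ω, D ω ∂P ≤ liminf (fun q => ENNReal.ofReal (I q)) atTop := by
    refine (lintegral_liminf_le fun q => (measurable_tubeExponent q).ennreal_ofReal).trans_eq ?_
    simp only [← hint]
    rfl
  have hupper : ∀ᵐ s ∂(stateMarginal P), ∀ᵐ x ∂(s.1 : Measure (Fin d → ℝ)),
      lowerDimImage s.1 (projectionC1 V φ (supp s.1)) ≤ D (orbit E Δ s x) := by
    filter_upwards [hP.ae_isTameState hΔ hMP] with s hs
    have hall : ∀ᵐ x ∂(s.1 : Measure (Fin d → ℝ)), ∀ b : ℚ,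
        ((b : ℝ).toNNReal : ℝ≥0∞) < lowerDim ((s.1 : Measure (Fin d → ℝ)).map (projection V φ)) →
        ∀ᶠ q : ℕ in atTop, (((b : ℝ).toNNReal : ℝ≥0) : ℝ) ≤ f q (orbit E Δ s x) := by
      refine ae_all_iff.2 fun b => ?_
      by_cases hb : ((b : ℝ).toNNReal : ℝ≥0∞) <
        lowerDim ((s.1 : Measure (Fin d → ℝ)).map (projection V φ))
      · filter_upwards [hs.eventually_le_tubeExponent hΔ hρ hρ1 hM hΛ hb] with x hx _
        exact hx
      · exact Eventually.of_forall fun x hx => absurd hx hb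
    filter_upwards [hall] with x hx
    refine le_of_forall_lt fun a ha => ?_
    obtain ⟨b, -, hab, hb⟩ := ENNReal.lt_iff_exists_rat_btwn.1 ha
    refine hab.trans_le (le_liminf_of_le (by isBoundedDefault) ?_)
    filter_upwards [hx b hb] with q hq
    rw [← ENNReal.ofReal_coe_nnreal]
    exact ENNReal.ofReal_le_ofReal hq
  -- The lower bound is applied to the projection itself, at distance zero, with `η = 1 / q`, so
  -- that the whole error vanishes as `q` grows.
  have hlower : ∀ᵐ s ∂(stateMarginal P), ∀ q : ℕ, 0 < q →
      ENNReal.ofReal (I q - (1 + C) / q) ≤ lowerDimImage s.1 (projectionC1 V φ (supp s.1)) := by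
    refine ae_all_iff.2 fun q => ?_
    rcases Nat.eq_zero_or_pos q with rfl | hq
    · exact Eventually.of_forall fun s hs => absurd hs (lt_irrefl 0)
    have hq' : (0 : ℝ) < q := Nat.cast_pos.2 hq
    filter_upwards [hP.ae_le_lowerDimImage hΔ hergodic hρ hρ1 hM hMP hΛ hq
      (one_div_pos.2 hq')] with s hs _
    have h1 := hs (projectionC1 V φ (supp s.1)) (by
      rw [edist_self]
      exact ENNReal.ofReal_pos.2 (by positivity))
    convert h1 using 2
    rw [add_div, hC, div_div, mul_comm (Real.log ρ⁻¹)]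
    ring
  have hDlower : ∀ᵐ ω ∂P, ∀ q : ℕ, 0 < q → ENNReal.ofReal (I q - (1 + C) / q) ≤ D ω := by
    refine hP.ae_of_ae_ae_orbit hΔ (C := {ω | ∀ q : ℕ, 0 < q → _ ≤ D ω}) ?_ ?_
    · simp only [Set.ofPred_forall]
      exact MeasurableSet.iInter fun q => MeasurableSet.iInter fun _ =>
        measurableSet_le measurable_const hDm
    · filter_upwards [hupper, hlower] with s h1 h2
      filter_upwards [h1] with x hx q hq using (h2 q hq).trans hx
  have hliminf : ∀ᵐ ω ∂P, liminf (fun q => ENNReal.ofReal (I q)) atTop ≤ D ω := by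
    filter_upwards [hDlower] with ω hω
    have hlim : Tendsto (fun q : ℕ => D ω + ENNReal.ofReal ((1 + C) / q)) atTop (𝓝 (D ω)) := by
      have h1 := ENNReal.tendsto_ofReal (tendsto_const_div_atTop_nhds_zero_nat (1 + C))
      rw [ENNReal.ofReal_zero] at h1
      simpa using tendsto_const_nhds.add h1
    rw [← hlim.liminf_eq]
    refine liminf_le_liminf ?_
    filter_upwards [eventually_gt_atTop 0] with q hq
    calc ENNReal.ofReal (I q) ≤ ENNReal.ofReal (I q - (1 + C) / q) +
          ENNReal.ofReal ((1 + C) / q) := by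
          refine le_trans (ENNReal.ofReal_le_ofReal ?_) ENNReal.ofReal_add_le
          linarith
      _ ≤ _ := by gcongr; exact hω q hq
  set J := ∫⁻ ω, D ω ∂P with hJ
  have hJtop : J ≠ ∞ := ne_top_of_le_ne_top (liminf_integral_tubeExponent_ne_top hρ hρ1) hFatou
  -- `D` is almost surely at least `liminf I`, which by Fatou is at least the mean of `D`; a
  -- function almost surely at least its finite mean is almost surely equal to it.
  have hDJ : ∀ᵐ ω ∂P, D ω = J := by
    have h1 : (fun _ => J) ≤ᵐ[P] D := by
      filter_upwards [hliminf] with ω hω using hFatou.trans hω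
    have h2 := ae_eq_of_ae_le_of_lintegral_le h1 (by simpa using hJtop) hDm.aemeasurable
      (by simp [hJ])
    filter_upwards [h2] with ω hω using hω.symm
  filter_upwards [hupper, hP.ae_ae_orbit hΔ hDJ] with s h1 h2
  obtain ⟨x, hx1, hx2⟩ := (h1.and h2).exists
  rw [hx2] at hx1
  exact hx1.trans hFatou

/-- The uniform lower semicontinuity, for almost every state. -/
lemma IsCPChain.exists_ae_lowerDimImage_le (hd : 0 < d) (hΔ : IsPartitionOperator E Δ)
    (hP : IsCPChain E Δ P) (hergodic : Ergodic shift P) (hρ : 0 < ρ) (hρ1 : ρ < 1)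
    (hreg : IsRegular E Δ ρ) {ε : ℝ} (hε : 0 < ε) :
    ∃ δ : ℝ, 0 < δ ∧ ∀ᵐ s ∂(stateMarginal P), ∀ g : C1Map (supp s.1) k,
      edist g (projectionC1 V φ (supp s.1)) < ENNReal.ofReal δ →
        lowerDimImage s.1 (projectionC1 V φ (supp s.1)) ≤
          lowerDimImage s.1 g + ENNReal.ofReal ε := by
  have := hP.isProbabilityMeasure
  obtain ⟨M, hM, hMP⟩ := hP.exists_ae_isTame hd hΔ hρ hreg hergodic
  have hL := log_inv_pos hρ hρ1
  set Λ := ‖projectionLinear V φ‖ with hΛ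
  set I : ℕ → ℝ := fun q =>
    ∫ ω, tubeExponent (projectionLinear V φ) ρ (Λ * M ^ 2 + 1) q ω ∂P with hI
  set C := Real.log (2 * coverNumber k (Λ * M ^ 2 + M + 1)) / Real.log ρ⁻¹ with hC
  set J := liminf (fun q => ENNReal.ofReal (I q)) atTop with hJ
  have h1 : ∀ᶠ q in atTop, J ≤ ENNReal.ofReal (I q) + ENNReal.ofReal (ε / 3) := by
    rcases eq_or_ne J 0 with h0 | h0
    · simp [h0]
    · have hJtop : J ≠ ∞ := liminf_integral_tubeExponent_ne_top hρ hρ1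
      have hlt : J - ENNReal.ofReal (ε / 3) < J :=
        ENNReal.sub_lt_self hJtop h0 (ENNReal.ofReal_pos.2 (by positivity)).ne'
      filter_upwards [eventually_lt_of_lt_liminf hlt] with q hq
      exact tsub_le_iff_right.1 hq.le
  have h2 : ∀ᶠ q : ℕ in atTop, C / q < ε / 3 :=
    (tendsto_const_div_atTop_nhds_zero_nat C).eventually_lt_const (by positivity)
  obtain ⟨q, hq1, hq2, hq⟩ := (h1.and (h2.and (eventually_gt_atTop 0))).exists
  refine ⟨ρ ^ q / M, by positivity, ?_⟩
  filter_upwards [hP.ae_le_lowerDimImage hΔ hergodic hρ hρ1 hM hMP hΛ.ge hq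
    (by positivity : 0 < ε / 3),
    hP.ae_lowerDim_projection_le hΔ hergodic hρ hρ1 hM hMP hΛ.ge] with s hs1 hs2 g hg
  have h3 := hs1 g hg
  rw [mul_comm (q : ℝ), ← div_div, ← hC] at h3
  calc _ ≤ ENNReal.ofReal (I q) + ENNReal.ofReal (ε / 3) := hs2.trans hq1
    _ ≤ ENNReal.ofReal (I q - ε / 3 - C / q) + ENNReal.ofReal (ε / 3 + ε / 3) +
          ENNReal.ofReal (ε / 3) := by
        gcongr
        refine le_trans (ENNReal.ofReal_le_ofReal ?_) ENNReal.ofReal_add_le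
        linarith
    _ = ENNReal.ofReal (I q - ε / 3 - C / q) + ENNReal.ofReal ε := by
        rw [add_assoc, ← ENNReal.ofReal_add (by positivity) (by positivity)]
        congr 2
        ring
    _ ≤ _ := by gcongr

/-- In the application `p` quantifies over all C¹ maps on the support, so measurability of its set
is out of reach and `ae_map_of_ae_comp` is essential. -/
lemma ae_measureMarginal (hP : IsCPChain E Δ P) {p : ProbabilityMeasure (Fin d → ℝ) → Prop}
    (h : ∀ᵐ s ∂(stateMarginal P), p s.1) : ∀ᵐ μ ∂(measureMarginal P), p μ := by
  have := hP.isProbabilityMeasure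
  exact ae_map_of_ae_comp (measurable_fst.comp (measurable_pi_apply 0))
    (ae_of_ae_map (measurable_pi_apply 0).aemeasurable h)

end Final
end CP

end

theorem mainTheorem9 {d k : ℕ} (E : Set (CP.Box d)) (Δ : CP.Box d → Set (CP.Box d))
    (ρ : ℝ) (hρ0 : 0 < ρ) (hρ1 : ρ < 1)
    (hΔ : CP.IsPartitionOperator E Δ) (hreg : CP.IsRegular E Δ ρ)
    (P : Measure (ℕ → CP.State d)) (hP : CP.IsCPChain E Δ P) (hergodic : Ergodic CP.shift P)
    (V : Submodule ℝ (EuclideanSpace ℝ (Fin d))) (φ : V ≃ᵃ[ℝ] (Fin k → ℝ)) :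
    (∀ᵐ μ ∂(CP.measureMarginal P),
      LowerSemicontinuousAt (fun g : CP.C1Map (CP.supp μ) k => CP.lowerDimImage μ g)
        (CP.projectionC1 V φ (CP.supp μ))) ∧
    (∀ ε : ℝ, 0 < ε → ∃ δ : ℝ, 0 < δ ∧ ∀ᵐ μ ∂(CP.measureMarginal P),
      ∀ g : CP.C1Map (CP.supp μ) k,
        edist g (CP.projectionC1 V φ (CP.supp μ)) < ENNReal.ofReal δ →
          CP.lowerDimImage μ (CP.projectionC1 V φ (CP.supp μ)) ≤
            CP.lowerDimImage μ g + ENNReal.ofReal ε) := by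
  have huniform : ∀ ε : ℝ, 0 < ε → ∃ δ : ℝ, 0 < δ ∧ ∀ᵐ μ ∂(CP.measureMarginal P),
      ∀ g : CP.C1Map (CP.supp μ) k,
        edist g (CP.projectionC1 V φ (CP.supp μ)) < ENNReal.ofReal δ →
          CP.lowerDimImage μ (CP.projectionC1 V φ (CP.supp μ)) ≤
            CP.lowerDimImage μ g + ENNReal.ofReal ε := by
    intro ε hε
    -- The normalization by `vol^(-1/d)` is meaningful only for `d > 0`. For `d = 0` also `k = 0`,
    -- and the dimension of the projection vanishes.
    rcases Nat.eq_zero_or_pos d with rfl | hd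
    · have hk : k = 0 := by
        have h1 := φ.linear.finrank_eq
        have h2 := V.finrank_le
        rw [finrank_euclideanSpace_fin] at h2
        rw [Module.finrank_fin_fun] at h1
        omega
      subst hk
      refine ⟨1, one_pos, Eventually.of_forall fun μ g _ => ?_⟩
      have : IsProbabilityMeasure ((μ : Measure (Fin 0 → ℝ)).map
          (CP.projectionC1 V φ (CP.supp μ)).toFun) := Measure.isProbabilityMeasure_map
        (CP.contDiff_projection V φ).continuous.measurable.aemeasurable
      exact ((CP.lowerDim_le _).trans_eq (by simp)).trans (zero_le)
    · obtain ⟨δ, hδ, h⟩ :=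
        hP.exists_ae_lowerDimImage_le (V := V) (φ := φ) hd hΔ hergodic hρ0 hρ1 hreg hε
      exact ⟨δ, hδ, CP.ae_measureMarginal hP
        (p := fun μ => ∀ g : CP.C1Map (CP.supp μ) k,
          edist g (CP.projectionC1 V φ (CP.supp μ)) < ENNReal.ofReal δ →
            CP.lowerDimImage μ (CP.projectionC1 V φ (CP.supp μ)) ≤
              CP.lowerDimImage μ g + ENNReal.ofReal ε) h⟩
  refine ⟨?_, huniform⟩
  -- Only countably many values of `ε` are used, so that one null set of measures serves all of
  -- them.
  choose δ hδ hδμ using fun n : ℕ => huniform (1 / ((n : ℝ) + 1)) (by positivity)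
  filter_upwards [ae_all_iff.2 hδμ] with μ hμ y hy
  obtain ⟨ε, hε, hyε⟩ := ENNReal.lt_iff_exists_add_pos_lt.1 hy
  obtain ⟨n, hn⟩ := exists_nat_one_div_lt (NNReal.coe_pos.2 hε)
  filter_upwards [Metric.eball_mem_nhds (CP.projectionC1 V φ (CP.supp μ))
    (ENNReal.ofReal_pos.2 (hδ n))] with g hg
  by_contra! hle
  refine absurd (hμ n g hg) (not_le.2 (lt_of_le_of_lt (add_le_add hle ?_) hyε))
  rw [← ENNReal.ofReal_coe_nnreal]
  exact ENNReal.ofReal_le_ofReal hn.le
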